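/- Let $n\le N$ and let $f:\mathbb{R}^n\to\mathbb{R}^n$ be smooth; consider the discrete-time system $x_{t+1}=f(x_t)$. For symmetric matrices write $B\preceq C$ if $C-B$ is positive semidefinite and $B\prec C$ if $C-B$ is positive definite. A matrix function $M(x)$ is called uniformly bounded on a set $S$ if there are $a_2\ge a_1>0$ with $a_1I\preceq M(x)\preceq a_2I$ for all $x\in S$. The system is contracting, with contraction metric $M:\mathbb{R}^n\to\mathbb{R}^{n\times n}$, if $M$ is uniformly bounded on $\mathbb{R}^n$ and there is $\beta\in(0,1)$ with $$\frac{\partial f}{\partial x}(x)^\top M(f(x))\,\frac{\partial f}{\partial x}(x)-M(x)\preceq-\beta M(x)\qquad\text{for all }x\in\mathbb{R}^n .$$ A real square matrix is Schur stable if all its complex eigenvalues have modulus less than $1$. For a $C^1$ map $\phi:\mathbb{R}^n\to\mathbb{R}^N$ and a set $S\subset\mathbb{R}^n$ consider the conditions - (D1) there is a Schur stable $A\in\mathbb{R}^{N\times N}$ with $\phi(f(x))=A\phi(x)$ for all $x\in S$; - (D2) for all $x\in S$ the Jacobian $\frac{\partial\phi}{\partial x}(x)$ has full column rank, and $\left(\frac{\partial\phi}{\partial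 x}\right)^\top\frac{\partial\phi}{\partial x}$ is uniformly bounded on $S$. **Theorem.** (i) If a $C^1$ map $\phi:\mathbb{R}^n\to\mathbb{R}^N$ satisfies (D1) and (D2) on $S=\mathbb{R}^n$, then the system is contracting, and for every symmetric positive definite $P$ with $P-A^\top PA\succ0$ the continuous matrix function $M(x)=\frac{\partial\phi}{\partial x}(x)^\top P\,\frac{\partial\phi}{\partial x}(x)$ is a contraction metric. (ii) Conversely, suppose that the system is contracting, that $f$ is invertible with a $C^1$ inverse, and that there are constants $c_1\ge0$, $c_2>0$ such that $|x|\le c_1+c_2|f(x)|$ and $\left\|\frac{\partial f}{\partial x}(x)\right\|<\min\{1,c_2^{-1}\}$ for all $x\in\mathbb{R}^n$ (Euclidean norm and induced matrix norm). Then for every compact set $\mathcal{X}\subset\mathbb{R}^n$ with $f(\mathcal{X})\subset\mathcal{X}$ there is a $C^1$ map $\phi:\mathbb{R}^n\to\mathbb{R}^N$ that is injective on $\mathcal{X}$ and satisfies (D1) and (D2) on $S=\mathcal{X}$. -/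

import Mathlib

open scoped Matrix ContDiff

noncomputable section

/-- The Jacobian matrix `∂φ/∂x` of a map `φ : ℝⁿ → ℝᴺ` at the point `x`. -/
def jacobian {n N : ℕ} (φ : EuclideanSpace ℝ (Fin n) → EuclideanSpace ℝ (Fin N))
    (x : EuclideanSpace ℝ (Fin n)) : Matrix (Fin N) (Fin n) ℝ :=
  Matrix.of fun i j => fderiv ℝ φ x (EuclideanSpace.single j 1) i

/-- The Loewner order `A ≼ B` on real square matrices: `B - A` is symmetric and positive
semidefinite. -/
def LoewnerLE {n : ℕ} (A B : Matrix (Fin n) (Fin n) ℝ) : Prop :=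
  (B - A).PosSemidef

/-- The matrix function `M` is uniformly bounded on `S`:
`a₁ I ≼ M x ≼ a₂ I` on `S` for some constants `a₂ ≥ a₁ > 0`. -/
def UniformlyBoundedOn {n : ℕ} (M : EuclideanSpace ℝ (Fin n) → Matrix (Fin n) (Fin n) ℝ)
    (S : Set (EuclideanSpace ℝ (Fin n))) : Prop :=
  ∃ a₁ a₂ : ℝ, 0 < a₁ ∧ a₁ ≤ a₂ ∧
    ∀ x ∈ S, LoewnerLE (a₁ • 1) (M x) ∧ LoewnerLE (M x) (a₂ • 1)

/-- `M` is a contraction metric for the system `x⁺ = f x` on `ℝⁿ`. -/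
def IsContractionMetric {n : ℕ} (f : EuclideanSpace ℝ (Fin n) → EuclideanSpace ℝ (Fin n))
    (M : EuclideanSpace ℝ (Fin n) → Matrix (Fin n) (Fin n) ℝ) : Prop :=
  UniformlyBoundedOn M Set.univ ∧
    ∃ β : ℝ, 0 < β ∧ β < 1 ∧
      ∀ x, LoewnerLE ((jacobian f x)ᵀ * M (f x) * jacobian f x - M x) (-(β • M x))

/-- The system `x⁺ = f x` is contracting. -/
def IsContracting {n : ℕ} (f : EuclideanSpace ℝ (Fin n) → EuclideanSpace ℝ (Fin n)) : Prop :=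
  ∃ M, IsContractionMetric f M

/-- Schur stability: every complex eigenvalue lies in the open unit disc. -/
def IsSchurStable {N : ℕ} (A : Matrix (Fin N) (Fin N) ℝ) : Prop :=
  ∀ z ∈ spectrum ℂ (A.map ((↑) : ℝ → ℂ)), ‖z‖ < 1

/-- The linear embedding equation `φ (f x) = A φ(x)` on `S`. -/
def IntertwinesOn {n N : ℕ} (f : EuclideanSpace ℝ (Fin n) → EuclideanSpace ℝ (Fin n))
    (A : Matrix (Fin N) (Fin N) ℝ) (φ : EuclideanSpace ℝ (Fin n) → EuclideanSpace ℝ (Fin N))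
    (S : Set (EuclideanSpace ℝ (Fin n))) : Prop :=
  ∀ x ∈ S, φ (f x) = A.toEuclideanLin (φ x)

/-- On `S`, the Jacobian `∂φ/∂x` has full column rank and `(∂φ/∂x)ᵀ (∂φ/∂x)` is uniformly
bounded. -/
def NondegenerateOn {n N : ℕ} (φ : EuclideanSpace ℝ (Fin n) → EuclideanSpace ℝ (Fin N))
    (S : Set (EuclideanSpace ℝ (Fin n))) : Prop :=
  (∀ x ∈ S, (jacobian φ x).rank = n) ∧
    UniformlyBoundedOn (fun x => (jacobian φ x)ᵀ * jacobian φ x) S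

/-- The standing assumption of the converse: `f` is invertible with a `C¹` inverse `g`,
`|x| ≤ c₁ + c₂ |f x|`, and the spectral norm of `∂f/∂x` is everywhere less than
`min {1, c₂⁻¹}`. -/
def InverseGrowthAssumption {n : ℕ}
    (f : EuclideanSpace ℝ (Fin n) → EuclideanSpace ℝ (Fin n)) : Prop :=
  (∃ g : EuclideanSpace ℝ (Fin n) → EuclideanSpace ℝ (Fin n),
      Function.LeftInverse g f ∧ Function.RightInverse g f ∧ ContDiff ℝ 1 g) ∧
    ∃ c₁ c₂ : ℝ, 0 ≤ c₁ ∧ 0 < c₂ ∧ (∀ x, ‖x‖ ≤ c₁ + c₂ * ‖f x‖) ∧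
      ∀ x, ‖fderiv ℝ f x‖ < min 1 c₂⁻¹

end

/-! Part (i) is a change of variables. Differentiating `φ ∘ f = A φ` gives `Jφ(f x) Jf(x) = A
Jφ(x)`, so for `M = Jφᵀ P Jφ` the contraction inequality is the Lyapunov inequality for `P`
conjugated by `Jφ(x)` (`isContractionMetric_of_intertwines`). A suitable `P` is the sum of `(A^k)ᵀ
A^k` over `k < m`, where `‖A^m‖ < 1` (`exists_posDef_lyapunov`).

For (ii), `‖Df‖ < 1` and compactness give a fixed point `x₀ ∈ X` to which the iterates of `X` shrink
uniformly (`exists_fixedPoint_of_fderiv_lt_one`). Hartman's `C¹` linearization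
(`exists_local_linearization`) conjugates `f` near `x₀` to `T = Df(x₀)`, and a cutoff extends the
conjugacy to a global injective immersion `ψ` (`exists_global_linearization`). For some `k`, `f^k`
carries `X` into the region where the conjugacy holds, so `x ↦ ι (ψ (f^k x - x₀))`, with `ι` an
isometric embedding into `ℝᴺ` and `π` a left inverse of it, intertwines `f` on `X` with `ι T π`.

Hartman's theorem for contractions needs no non-resonance condition. The spectrum is grouped by
modulus, and an iterate is taken so that each block of the linear part `A` has norm bounds close to
its modulus. Blocks are then linearized one at a time, slowest decay first. `IsPartialLinearization`
records coordinates `Φ` for the slow blocks and a retraction `P = σ ∘ Φ` onto a slow manifold. The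
coordinate of the next block is the limit of `A^(-k) E (f^k x - f^k (P x))`, with `E` the projection
to that block. These differences decay at a rate `β`; since `Df` is Lipschitz, each step deviates
from the linear one by `O((l β)^k)`, and `l β` lies below the lower bound of `A` on the blocks
treated so far, so the limit exists in `C¹` (`IsPartialLinearization.exists_next_component`). The
enlarged `Φ` has its own slow manifold (`exists_slow_manifold`), and a bootstrap
(`exists_fast_decay`) shows that orbits approach it at the next faster rate. When no block remains,
`Φ` linearizes the iterate, and averaging gives a linearization of the map itself. -/

open Filter Topology

/-! ### Spectral idempotents sorted by modulus -/

open Polynomial in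
-- Complex roots of an irreducible real polynomial are Galois conjugate over `ℝ`, and the only
-- automorphisms are the identity and complex conjugation, both of which preserve the modulus.
theorem Irreducible.exists_norm_eq_of_aeval_eq_zero {q : ℝ[X]} (hq : Irreducible q) :
    ∃ r : ℝ, ∀ z : ℂ, aeval z q = 0 → ‖z‖ = r := by
  by_cases h : ∃ z₀ : ℂ, aeval z₀ q = 0
  · obtain ⟨z₀, hz₀⟩ := h
    refine ⟨‖z₀‖, fun z hz => ?_⟩
    have h1 := minpoly.eq_of_irreducible hq hz₀
    have h2 := minpoly.eq_of_irreducible hq hz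
    have h3 : IsConjRoot ℝ z₀ z := by
      unfold IsConjRoot
      rw [← h1, ← h2]
    have : Normal ℝ ℂ := normal_iff.2 fun w =>
      ⟨Algebra.IsIntegral.isIntegral w, IsAlgClosed.splits _⟩
    obtain ⟨σ, hσ⟩ := (isConjRoot_iff_exists_algEquiv (K := ℝ) (L := ℂ)).1 h3
    rcases Complex.real_algHom_eq_id_or_conj (σ : ℂ →ₐ[ℝ] ℂ) with h | h
    · have := DFunLike.congr_fun h z
      simp only [AlgEquiv.coe_toAlgHom, AlgHom.coe_id, id] at this
      rw [← hσ, this]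
    · have := DFunLike.congr_fun h z
      simp at this
      rw [← hσ, this]
      simp
  · exact ⟨0, fun z hz => (h ⟨z, hz⟩).elim⟩

open Polynomial in
/-- A nonzero real polynomial factors according to the moduli of its complex roots. -/
theorem exists_factorization_by_modulus (p : ℝ[X]) (hp : p ≠ 0) :
    ∃ (M : Finset ℝ) (g : ℝ → ℝ[X]), Associated p (∏ r ∈ M, g r) ∧ (∀ r, r ∉ M → g r = 1) ∧
      (∀ r, ∀ z : ℂ, aeval z (g r) = 0 → ‖z‖ = r) ∧
      (∀ r ∈ M, ∃ z : ℂ, aeval z p = 0 ∧ ‖z‖ = r) := by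
  induction p using WfDvdMonoid.induction_on_irreducible with
  | zero => exact (hp rfl).elim
  | unit u hu =>
    refine ⟨∅, fun _ => 1, by simpa using associated_one_iff_isUnit.2 hu, by simp, by simp,
      by simp⟩
  | mul a q ha hq ih =>
    obtain ⟨M, g, h1, h2, h3, h4⟩ := ih ha
    obtain ⟨r, hr⟩ := hq.exists_norm_eq_of_aeval_eq_zero
    refine ⟨insert r M, Function.update g r (q * g r), ?_, ?_, ?_, ?_⟩
    · have : ∏ s ∈ insert r M, Function.update g r (q * g r) s = q * ∏ s ∈ M, g s := by
        by_cases hrM : r ∈ M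
        · rw [Finset.insert_eq_of_mem hrM, Finset.prod_update_of_mem hrM, mul_assoc,
            ← Finset.prod_sdiff (Finset.singleton_subset_iff.2 hrM), Finset.prod_singleton]
          ring
        · rw [Finset.prod_insert hrM, Function.update_self, h2 r hrM, mul_one]
          congr 1
          refine Finset.prod_congr rfl fun s hs => ?_
          rw [Function.update_of_ne]
          rintro rfl
          exact hrM hs
      rw [this]
      exact h1.mul_left q
    · intro s hs
      rw [Finset.mem_insert, not_or] at hs
      rw [Function.update_of_ne hs.1, h2 s hs.2]
    · intro s z hz
      by_cases hs : s = r
      · subst hs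
        rw [Function.update_self, map_mul, mul_eq_zero] at hz
        exact hz.elim (hr z) (h3 _ z)
      · rw [Function.update_of_ne hs] at hz
        exact h3 s z hz
    · intro s hs
      rcases Finset.mem_insert.1 hs with rfl | hs
      · obtain ⟨z, hz⟩ := IsAlgClosed.exists_aeval_eq_zero ℂ q
          (Polynomial.degree_pos_of_irreducible hq).ne'
        exact ⟨z, by rw [map_mul, hz, zero_mul], hr z hz⟩
      · obtain ⟨z, hz, hzs⟩ := h4 s hs
        exact ⟨z, by rw [map_mul, hz, mul_zero], hzs⟩

open Polynomial in
/-- Complete orthogonal idempotents for the moduli of the roots of an annihilating polynomial. -/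
theorem exists_modulus_idempotents {R : Type*} [Ring R] [Algebra ℝ R] (A : R) (p : ℝ[X])
    (hp : p ≠ 0) (hA : aeval A p = 0) :
    ∃ (M : Finset ℝ) (g h : ℝ → ℝ[X]),
      (∀ r ∈ M, ∃ z : ℂ, aeval z p = 0 ∧ ‖z‖ = r) ∧
      (∀ r ∈ M, aeval A (g r) * aeval A (h r) = 0) ∧
      (∀ r, g r ≠ 0 ∧ ∀ z : ℂ, aeval z (g r) = 0 → ‖z‖ = r) ∧
      (∀ r ∈ M, ∀ s ∈ M, r ≠ s → aeval A (h r) * aeval A (h s) = 0) ∧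
      ∑ r ∈ M, aeval A (h r) = 1 := by
  obtain ⟨M, g, h1, h2, h3, h4⟩ := exists_factorization_by_modulus p hp
  have hprod : aeval A (∏ r ∈ M, g r) = 0 := by
    obtain ⟨c, hc⟩ := h1.dvd
    rw [hc, map_mul, hA, zero_mul]
  have hg0 : ∀ r, g r ≠ 0 := by
    intro r
    by_cases hr : r ∈ M
    · intro h0
      exact hp (h1.eq_zero_iff.2 (Finset.prod_eq_zero hr h0))
    · rw [h2 r hr]
      exact one_ne_zero
  rcases M.eq_empty_or_nonempty with rfl | hM
  · refine ⟨∅, g, g, by simp, by simp, fun r => ⟨hg0 r, h3 r⟩, by simp, ?_⟩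
    simpa using hprod.symm
  -- Factors of different modulus share no complex root, hence are coprime. Multiplying each Bézout
  -- cofactor by the product of the other factors gives the Chinese remainder idempotents.
  · have hcop : Pairwise fun r s : M => IsCoprime (g r) (g s) := by
      intro r s hrs
      rw [Polynomial.isCoprime_iff_aeval_ne_zero_of_isAlgClosed ℝ ℂ]
      intro z
      by_contra! hz
      exact hrs (Subtype.ext ((h3 _ z hz.1).symm.trans (h3 _ z hz.2)))
    obtain ⟨μ, hμ⟩ := (exists_sum_eq_one_iff_pairwise_coprime hM).2 hcop
    refine ⟨M, g, fun r => μ r * ∏ j ∈ M \ {r}, g j, h4, ?_, fun r => ⟨hg0 r, h3 r⟩, ?_, ?_⟩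
    · intro r hr
      rw [← map_mul]
      have : g r * (μ r * ∏ j ∈ M \ {r}, g j) = μ r * ∏ j ∈ M, g j := by
        rw [← Finset.prod_sdiff (Finset.singleton_subset_iff.2 hr), Finset.prod_singleton]
        ring
      rw [this, map_mul, hprod, mul_zero]
    · intro r hr s hs hrs
      rw [← map_mul]
      have hd : (∏ j ∈ M, g j) ∣ (μ r * ∏ j ∈ M \ {r}, g j) * (μ s * ∏ j ∈ M \ {s}, g j) := by
        have e1 : ∏ j ∈ M, g j = (∏ j ∈ M \ {r}, g j) * g r := by
          rw [← Finset.prod_sdiff (Finset.singleton_subset_iff.2 hr), Finset.prod_singleton]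
        have e2 : g r ∣ ∏ j ∈ M \ {s}, g j :=
          Finset.dvd_prod_of_mem _ (by simp [hr, hrs])
        rw [e1]
        exact mul_dvd_mul (Dvd.intro_left _ rfl) (e2.mul_left _)
      obtain ⟨c, hc⟩ := hd
      rw [hc, map_mul, hprod, zero_mul]
    · rw [← map_sum, hμ, map_one]

/-! ### Growth of powers on spectral blocks -/

open Polynomial in
-- Peeling off a root gives `a^(k+1) b = z a^k b + a^k ((a - z) b)`, where `(a - z) b` is killed by
-- the remaining factors. The strict inequality `‖z‖ < β` absorbs the last term, so repeated roots
-- cost no polynomial factor.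
theorem growth_of_prod_sub_mul_eq_zero {R : Type*} [NormedRing R] [NormedAlgebra ℂ R] (a : R)
    {β : ℝ} (hβ : 0 < β) (s : Multiset ℂ) (hs : ∀ z ∈ s, ‖z‖ < β) (b : R)
    (hb : aeval a (s.map fun z => X - C z).prod * b = 0) :
    ∃ K, ∀ k : ℕ, ‖a ^ k * b‖ ≤ K * β ^ k := by
  induction s using Multiset.induction generalizing b with
  | empty => exact ⟨0, by simp_all⟩
  | cons z s ih =>
    have hcomm : aeval a ((Multiset.map (fun z => X - C z) (z ::ₘ s)).prod) * b
        = aeval a (Multiset.map (fun z => X - C z) s).prod * ((a - algebraMap ℂ R z) * b) := by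
      rw [Multiset.map_cons, Multiset.prod_cons, mul_comm, map_mul, mul_assoc]
      simp
    obtain ⟨K, hK⟩ := ih (fun w hw => hs w (Multiset.mem_cons_of_mem hw))
      ((a - algebraMap ℂ R z) * b) (hcomm ▸ hb)
    have hz : ‖z‖ < β := hs z (Multiset.mem_cons_self z s)
    have hpos : 0 < β - ‖z‖ := by linarith
    have hK0 : 0 ≤ K := by simpa using (norm_nonneg _).trans (hK 0)
    refine ⟨max ‖b‖ (K / (β - ‖z‖)), fun k => ?_⟩
    induction k with
    | zero => simp
    | succ k ihk =>
      set L := max ‖b‖ (K / (β - ‖z‖))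
      have hL : K ≤ L * (β - ‖z‖) := by
        rw [← div_le_iff₀ hpos]
        exact le_max_right _ _
      have e : a ^ (k + 1) * b = z • (a ^ k * b) + a ^ k * ((a - algebraMap ℂ R z) * b) := by
        rw [pow_succ, sub_mul, mul_sub, mul_assoc, Algebra.algebraMap_eq_smul_one,
          smul_mul_assoc, one_mul, mul_smul_comm]
        abel
      calc ‖a ^ (k + 1) * b‖ ≤ ‖z‖ * (L * β ^ k) + K * β ^ k := by
            rw [e]
            refine (norm_add_le _ _).trans (add_le_add ?_ (hK k))
            rw [norm_smul]
            exact mul_le_mul_of_nonneg_left ihk (norm_nonneg _)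
        _ ≤ ‖z‖ * (L * β ^ k) + L * (β - ‖z‖) * β ^ k := by gcongr
        _ = L * β ^ (k + 1) := by ring

open Polynomial in
theorem growth_of_aeval_mul_eq_zero {R : Type*} [NormedRing R] [NormedAlgebra ℂ R] (a : R)
    {β : ℝ} (hβ : 0 < β) (p : ℂ[X]) (hp : p ≠ 0) (hroot : ∀ z, p.IsRoot z → ‖z‖ < β) (b : R)
    (hb : aeval a p * b = 0) :
    ∃ K, ∀ k : ℕ, ‖a ^ k * b‖ ≤ K * β ^ k := by
  refine growth_of_prod_sub_mul_eq_zero a hβ p.roots (fun z hz => hroot z (isRoot_of_mem_roots hz))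
    b ?_
  have h := (IsAlgClosed.splits p).eq_prod_roots
  have hl : p.leadingCoeff ≠ 0 := leadingCoeff_ne_zero.2 hp
  rw [h, map_mul, aeval_C, Algebra.algebraMap_eq_smul_one, smul_mul_assoc, one_mul,
    smul_mul_assoc] at hb
  exact (smul_eq_zero.1 hb).resolve_left hl

open Polynomial in
-- Since `a' - z⁻¹ = -z⁻¹ a' (a - z)`, whatever is killed by the product of the `a - z` is killed by
-- the product of the `a' - z⁻¹`, and the forward estimate applies to `a'`.
theorem growth_inv_of_aeval_mul_eq_zero {R : Type*} [NormedRing R] [NormedAlgebra ℂ R]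
    (a a' : R) (haa' : a * a' = 1) (ha'a : a' * a = 1)
    {β : ℝ} (hβ : 0 < β) (p : ℂ[X]) (hp : p ≠ 0)
    (hroot : ∀ z, p.IsRoot z → z ≠ 0 ∧ ‖z‖⁻¹ < β) (b : R)
    (hb : aeval a p * b = 0) :
    ∃ K, ∀ k : ℕ, ‖a' ^ k * b‖ ≤ K * β ^ k := by
  have key : ∀ s : Multiset ℂ, (∀ z ∈ s, z ≠ 0) → ∃ u : R,
      aeval a' ((s.map fun z => z⁻¹).map fun z => X - C z).prod
        = u * aeval a (s.map fun z => X - C z).prod := by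
    intro s
    induction s using Multiset.induction with
    | empty => exact fun _ => ⟨1, by simp⟩
    | cons z s ih =>
      intro hs
      obtain ⟨u, hu⟩ := ih fun w hw => hs w (Multiset.mem_cons_of_mem hw)
      have hz : z ≠ 0 := hs z (Multiset.mem_cons_self z s)
      have e : a' - algebraMap ℂ R z⁻¹ = (-z⁻¹) • (a' * (a - algebraMap ℂ R z)) := by
        rw [mul_sub, ha'a, Algebra.algebraMap_eq_smul_one, Algebra.algebraMap_eq_smul_one,
          mul_smul_comm, mul_one, smul_sub, smul_smul]
        simp [hz]
        abel
      refine ⟨(-z⁻¹) • (u * a'), ?_⟩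
      rw [Multiset.map_cons, Multiset.map_cons, Multiset.prod_cons, mul_comm, map_mul, hu,
        Multiset.map_cons, Multiset.prod_cons, map_mul]
      have c : Commute (aeval a (s.map fun z => X - C z).prod) (a' - algebraMap ℂ R z⁻¹) := by
        have c1 : Commute a a' := haa'.trans ha'a.symm
        have c2 : Commute a (a' - algebraMap ℂ R z⁻¹) :=
          c1.sub_right (Algebra.commute_algebraMap_right _ _)
        rw [aeval_eq_sum_range]
        refine Commute.sum_left _ _ _ fun i _ => ?_
        exact (c2.pow_left i).smul_left _
      simp only [map_sub, aeval_X, aeval_C]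
      rw [mul_assoc, c.eq, e]
      simp only [smul_mul_assoc, mul_smul_comm, mul_assoc]
  have h := (IsAlgClosed.splits p).eq_prod_roots
  have hl : p.leadingCoeff ≠ 0 := leadingCoeff_ne_zero.2 hp
  rw [h, map_mul, aeval_C, Algebra.algebraMap_eq_smul_one, smul_mul_assoc, one_mul,
    smul_mul_assoc] at hb
  have hb' := (smul_eq_zero.1 hb).resolve_left hl
  obtain ⟨u, hu⟩ := key p.roots fun z hz => (hroot z (isRoot_of_mem_roots hz)).1
  refine growth_of_prod_sub_mul_eq_zero a' hβ (p.roots.map fun z => z⁻¹) ?_ b ?_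
  · intro z hz
    obtain ⟨w, hw, rfl⟩ := Multiset.mem_map.1 hz
    rw [norm_inv]
    exact (hroot w (isRoot_of_mem_roots hw)).2
  · rw [hu, mul_assoc, hb', mul_zero]

/-! ### Real operators and their complex spectrum -/

theorem exists_re_im_eigenvector {N : ℕ} (M : Matrix (Fin N) (Fin N) ℝ) {z : ℂ}
    (hz : z ∈ spectrum ℂ (M.map ((↑) : ℝ → ℂ))) :
    ∃ x y : EuclideanSpace ℝ (Fin N), (x ≠ 0 ∨ y ≠ 0) ∧
      Matrix.toEuclideanCLM (𝕜 := ℝ) M x = z.re • x - z.im • y ∧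
      Matrix.toEuclideanCLM (𝕜 := ℝ) M y = z.im • x + z.re • y := by
  rw [← Matrix.spectrum_toLin', ← Module.End.hasEigenvalue_iff_mem_spectrum] at hz
  obtain ⟨w, hw⟩ := hz.exists_hasEigenvector
  have h1 := hw.apply_eq_smul
  rw [Matrix.toLin'_apply] at h1
  refine ⟨WithLp.toLp 2 fun i => (w i).re, WithLp.toLp 2 fun i => (w i).im, ?_, ?_, ?_⟩
  · by_contra! h
    apply hw.2
    ext i
    have h2 := congrArg (fun v : EuclideanSpace ℝ (Fin N) => v i) h.1
    have h3 := congrArg (fun v : EuclideanSpace ℝ (Fin N) => v i) h.2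
    exact Complex.ext (by simpa using h2) (by simpa using h3)
  · ext i
    have := congrArg Complex.re (congrFun h1 i)
    simp only [Matrix.mulVec, dotProduct, Matrix.map_apply, Complex.re_sum,
      Pi.smul_apply, smul_eq_mul, Complex.mul_re] at this
    simpa [Matrix.mulVec, dotProduct] using this
  · ext i
    have := congrArg Complex.im (congrFun h1 i)
    simp only [Matrix.mulVec, dotProduct, Matrix.map_apply, Complex.im_sum,
      Pi.smul_apply, smul_eq_mul, Complex.mul_im] at this
    rw [add_comm] at this
    simpa [Matrix.mulVec, dotProduct] using this

theorem norm_sq_rotation {V : Type*} [NormedAddCommGroup V] [InnerProductSpace ℝ V] (a b : ℝ)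
    (x y : V) : ‖a • x - b • y‖ ^ 2 + ‖b • x + a • y‖ ^ 2
      = (a ^ 2 + b ^ 2) * (‖x‖ ^ 2 + ‖y‖ ^ 2) := by
  rw [norm_sub_sq_real, norm_add_sq_real]
  simp only [norm_smul, inner_smul_left, inner_smul_right, mul_pow, Real.norm_eq_abs, sq_abs]
  simp
  ring

/-- For the real and imaginary parts `x`, `y` of an eigenvector, `norm_sq_rotation` gives `‖M x‖² +
‖M y‖² = |z|² (‖x‖² + ‖y‖²)`, so `|z| ≤ ‖M‖`. -/
theorem norm_mem_spectrum_lt_one {N : ℕ} (M : Matrix (Fin N) (Fin N) ℝ)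
    (hM : ‖Matrix.toEuclideanCLM (𝕜 := ℝ) M‖ < 1) : IsSchurStable M := by
  intro z hz
  obtain ⟨x, y, hxy, hx, hy⟩ := exists_re_im_eigenvector M hz
  set T := Matrix.toEuclideanCLM (𝕜 := ℝ) M
  have h := norm_sq_rotation z.re z.im x y
  rw [← hx, ← hy] at h
  have hpos : 0 < ‖x‖ ^ 2 + ‖y‖ ^ 2 := by
    rcases hxy with h | h
    · have := norm_pos_iff.2 h
      positivity
    · have := norm_pos_iff.2 h
      positivity
  have h1 : ‖T x‖ ^ 2 ≤ ‖T‖ ^ 2 * ‖x‖ ^ 2 := by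
    rw [← mul_pow]
    exact pow_le_pow_left₀ (norm_nonneg _) (T.le_opNorm x) 2
  have h2 : ‖T y‖ ^ 2 ≤ ‖T‖ ^ 2 * ‖y‖ ^ 2 := by
    rw [← mul_pow]
    exact pow_le_pow_left₀ (norm_nonneg _) (T.le_opNorm y) 2
  have h3 : ‖z‖ ^ 2 = z.re ^ 2 + z.im ^ 2 := by
    rw [Complex.sq_norm, Complex.normSq_apply]
    ring
  have h4 : ‖z‖ ^ 2 ≤ ‖T‖ ^ 2 := by
    rw [h3]
    by_contra! hlt
    nlinarith
  exact (abs_le_of_sq_le_sq' h4 (norm_nonneg _) |>.2).trans_lt hM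

theorem ne_zero_of_mem_spectrum {N : ℕ} (M : Matrix (Fin N) (Fin N) ℝ)
    (hM : Function.Injective (Matrix.toEuclideanCLM (𝕜 := ℝ) M)) {z : ℂ}
    (hz : z ∈ spectrum ℂ (M.map ((↑) : ℝ → ℂ))) : z ≠ 0 := by
  rintro rfl
  obtain ⟨x, y, hxy, hx, hy⟩ := exists_re_im_eigenvector M hz
  simp only [Complex.zero_re, Complex.zero_im, zero_smul, sub_zero, add_zero] at hx hy
  rcases hxy with h | h
  · exact h (hM (by rw [hx, map_zero]))
  · exact h (hM (by rw [hy, map_zero]))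

open Polynomial in
theorem mem_spectrum_of_aeval_charpoly {N : ℕ} (M : Matrix (Fin N) (Fin N) ℝ) {z : ℂ}
    (hz : aeval z M.charpoly = 0) : z ∈ spectrum ℂ (M.map ((↑) : ℝ → ℂ)) := by
  apply Matrix.mem_spectrum_of_isRoot_charpoly
  have : (M.map ((↑) : ℝ → ℂ)).charpoly = M.charpoly.map Complex.ofRealHom :=
    Matrix.charpoly_map M Complex.ofRealHom
  rw [this, IsRoot, eval_map]
  exact hz

/-- Operators on `ℝᴺ` embed, up to a norm constant, into a complex normed algebra. -/
theorem exists_complex_matrix_embedding (N : ℕ) :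
    ∃ (R : Type) (_ : NormedRing R) (_ : NormedAlgebra ℂ R)
      (φ : (EuclideanSpace ℝ (Fin N) →L[ℝ] EuclideanSpace ℝ (Fin N)) →ₐ[ℝ] R) (K : ℝ),
      0 ≤ K ∧ ∀ T, ‖T‖ ≤ K * ‖φ T‖ := by
  let _ : NormedRing (Matrix (Fin N) (Fin N) ℂ) := Matrix.linftyOpNormedRing
  let _ : NormedAlgebra ℂ (Matrix (Fin N) (Fin N) ℂ) := Matrix.linftyOpNormedAlgebra
  let φ : (EuclideanSpace ℝ (Fin N) →L[ℝ] EuclideanSpace ℝ (Fin N)) →ₐ[ℝ]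
      Matrix (Fin N) (Fin N) ℂ := (Algebra.ofId ℝ ℂ).mapMatrix.comp
    ((Matrix.toEuclideanCLM (n := Fin N) (𝕜 := ℝ)).symm.toStarAlgHom.toAlgHom)
  have hφ : Function.Injective φ := by
    refine Function.Injective.comp (g := (Algebra.ofId ℝ ℂ).mapMatrix) ?_
      (Matrix.toEuclideanCLM (n := Fin N) (𝕜 := ℝ)).symm.injective
    exact Matrix.map_injective (algebraMap ℝ ℂ).injective
  let _ : NormedAlgebra ℝ (Matrix (Fin N) (Fin N) ℂ) := NormedAlgebra.restrictScalars ℝ ℂ _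
  -- An injective linear map on a finite-dimensional space is bounded below; this yields the norm
  -- constant.
  obtain ⟨K, -, hK⟩ := LinearMap.exists_antilipschitzWith φ.toLinearMap
    (LinearMap.ker_eq_bot.2 hφ)
  refine ⟨_, _, _, φ, K, K.2, fun T => ?_⟩
  simpa using hK.le_mul_dist T 0

open Polynomial in
theorem clm_growth {N : ℕ} (T B : EuclideanSpace ℝ (Fin N) →L[ℝ] EuclideanSpace ℝ (Fin N))
    (p : ℝ[X]) (hp : p ≠ 0) {β : ℝ} (hβ : 0 < β) (hroot : ∀ z : ℂ, aeval z p = 0 → ‖z‖ < β)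
    (hb : aeval T p * B = 0) : ∃ K, ∀ k : ℕ, ‖T ^ k * B‖ ≤ K * β ^ k := by
  obtain ⟨R, _, _, φ, C, hC, hφ⟩ := exists_complex_matrix_embedding N
  have h1 : aeval (φ T) (p.map (algebraMap ℝ ℂ)) * φ B = 0 := by
    rw [aeval_map_algebraMap, aeval_algHom_apply, ← map_mul, hb, map_zero]
  obtain ⟨K, hK⟩ := growth_of_aeval_mul_eq_zero (φ T) hβ (p.map (algebraMap ℝ ℂ))
    ((Polynomial.map_ne_zero_iff (algebraMap ℝ ℂ).injective).2 hp)
    (fun z hz => hroot z (by rwa [IsRoot, eval_map_algebraMap] at hz)) (φ B) h1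
  refine ⟨C * K, fun k => (hφ _).trans ?_⟩
  rw [map_mul, map_pow, mul_assoc]
  exact mul_le_mul_of_nonneg_left (hK k) hC

open Polynomial in
theorem clm_growth_inv {N : ℕ}
    (T T' B : EuclideanSpace ℝ (Fin N) →L[ℝ] EuclideanSpace ℝ (Fin N))
    (hTT' : T * T' = 1) (hT'T : T' * T = 1)
    (p : ℝ[X]) (hp : p ≠ 0) {β : ℝ} (hβ : 0 < β)
    (hroot : ∀ z : ℂ, aeval z p = 0 → z ≠ 0 ∧ ‖z‖⁻¹ < β)
    (hb : aeval T p * B = 0) : ∃ K, ∀ k : ℕ, ‖T' ^ k * B‖ ≤ K * β ^ k := by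
  obtain ⟨R, _, _, φ, C, hC, hφ⟩ := exists_complex_matrix_embedding N
  have h1 : aeval (φ T) (p.map (algebraMap ℝ ℂ)) * φ B = 0 := by
    rw [aeval_map_algebraMap, aeval_algHom_apply, ← map_mul, hb, map_zero]
  obtain ⟨K, hK⟩ := growth_inv_of_aeval_mul_eq_zero (φ T) (φ T') (by rw [← map_mul, hTT', map_one])
    (by rw [← map_mul, hT'T, map_one]) hβ (p.map (algebraMap ℝ ℂ))
    ((Polynomial.map_ne_zero_iff (algebraMap ℝ ℂ).injective).2 hp)
    (fun z hz => hroot z (by rwa [IsRoot, eval_map_algebraMap] at hz)) (φ B) h1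
  refine ⟨C * K, fun k => (hφ _).trans ?_⟩
  rw [map_mul, map_pow, mul_assoc]
  exact mul_le_mul_of_nonneg_left (hK k) hC

/-- A finite set of numbers in `(0, 1)` is listed by an initial segment of a decreasing positive
sequence. -/
theorem Finset.exists_strictAnti_range (M : Finset ℝ) (hM : ∀ r ∈ M, 0 < r ∧ r < 1) :
    ∃ (m : ℕ) (ρ : ℕ → ℝ), StrictAnti ρ ∧ (∀ j, 0 < ρ j) ∧ ρ 0 < 1 ∧
      M = (Finset.range m).image ρ := by
  induction M using Finset.induction_on_min with
  | empty =>
    refine ⟨0, fun j => (1 / 2) ^ (j + 1), ?_, fun j => by positivity, by norm_num, by simp⟩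
    exact strictAnti_nat_of_succ_lt fun j => pow_lt_pow_right_of_lt_one₀ (by norm_num)
      (by norm_num) (by omega)
  | insert a s has ih =>
    obtain ⟨m, ρ, h1, h2, h3, h4⟩ := ih fun r hr => hM r (Finset.mem_insert_of_mem hr)
    obtain ⟨ha0, ha1⟩ := hM a (Finset.mem_insert_self a s)
    have hlt : ∀ j < m, a < ρ j := fun j hj => has _ (by
      rw [h4]
      exact Finset.mem_image_of_mem _ (Finset.mem_range.2 hj))
    -- The entry at `j = m` is the new minimum `a`; the later ones are filler. They ensure that a
    -- rate one past the last block exists, which the final step of the flag uses.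
    refine ⟨m + 1, fun j => if j < m then ρ j else a * (1 / 2) ^ (j - m), ?_, ?_, ?_, ?_⟩
    · refine strictAnti_nat_of_succ_lt fun j => ?_
      rcases lt_trichotomy (j + 1) m with h | h | h
      · rw [if_pos h, if_pos (by omega)]
        exact h1 (by omega)
      · rw [if_neg (by omega), if_pos (by omega), h]
        simpa using hlt j (by omega)
      · rw [if_neg (by omega), if_neg (by omega)]
        exact mul_lt_mul_of_pos_left (pow_lt_pow_right_of_lt_one₀ (by norm_num) (by norm_num)
          (by omega)) ha0
    · intro j
      dsimp only
      split_ifs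
      · exact h2 j
      · positivity
    · dsimp only
      split_ifs
      · exact h3
      · simpa using ha1
    · rw [Finset.range_add_one, Finset.image_insert, h4]
      congr 1
      · simp
      · refine Finset.image_congr fun j hj => ?_
        have : j < m := by simpa using hj
        simp [this]

/-- The decomposition of an invertible linear contraction according to the moduli of its
eigenvalues. -/
theorem exists_modulus_decomposition {N : ℕ}
    (T T' : EuclideanSpace ℝ (Fin N) →L[ℝ] EuclideanSpace ℝ (Fin N))
    (hTT' : T * T' = 1) (hT'T : T' * T = 1) (hT : ‖T‖ < 1) :
    ∃ (m : ℕ) (ρ : ℕ → ℝ)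
      (e : ℕ → EuclideanSpace ℝ (Fin N) →L[ℝ] EuclideanSpace ℝ (Fin N)),
      StrictAnti ρ ∧ (∀ j, 0 < ρ j) ∧ ρ 0 < 1 ∧
      (∀ i < m, ∀ j < m, i ≠ j → e i * e j = 0) ∧ ∑ i ∈ Finset.range m, e i = 1 ∧
      (∀ i, Commute T (e i)) ∧
      ∀ c, 1 < c → ∀ i < m, (∃ K, ∀ k : ℕ, ‖T ^ k * e i‖ ≤ K * (c * ρ i) ^ k) ∧
        ∃ K, ∀ k : ℕ, ‖T' ^ k * e i‖ ≤ K * (c / ρ i) ^ k := by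
  set A := (Matrix.toEuclideanCLM (n := Fin N) (𝕜 := ℝ)).symm T with hA
  have hTA : Matrix.toEuclideanCLM (n := Fin N) (𝕜 := ℝ) A = T := by simp [hA]
  have hann : Polynomial.aeval T A.charpoly = 0 := by
    have := congrArg (Matrix.toEuclideanCLM (n := Fin N) (𝕜 := ℝ)) (Matrix.aeval_self_charpoly A)
    rw [map_zero] at this
    rw [← this, ← hTA]
    exact Polynomial.aeval_algHom_apply
      (Matrix.toEuclideanCLM (n := Fin N) (𝕜 := ℝ)).toStarAlgHom.toAlgHom A A.charpoly
  have hinj : Function.Injective (Matrix.toEuclideanCLM (n := Fin N) (𝕜 := ℝ) A) := by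
    rw [hTA]
    exact Function.LeftInverse.injective (g := T') fun x => DFunLike.congr_fun hT'T x
  obtain ⟨M, g, h, h1, h2, h3, h4, h5⟩ :=
    exists_modulus_idempotents T A.charpoly A.charpoly_monic.ne_zero hann
  obtain ⟨m, ρ, hρ, hρ0, hρ1, hM⟩ := M.exists_strictAnti_range (by
    intro r hr
    obtain ⟨z, hz, rfl⟩ := h1 r hr
    have hz' := mem_spectrum_of_aeval_charpoly A hz
    exact ⟨norm_pos_iff.2 (ne_zero_of_mem_spectrum A hinj hz'),
      norm_mem_spectrum_lt_one A (by rwa [hTA]) z hz'⟩)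
  have hmem : ∀ i < m, ρ i ∈ M := fun i hi => by
    rw [hM]
    exact Finset.mem_image_of_mem _ (Finset.mem_range.2 hi)
  refine ⟨m, ρ, fun i => Polynomial.aeval T (h (ρ i)), hρ, hρ0, hρ1, ?_, ?_, ?_, ?_⟩
  · exact fun i hi j hj hij => h4 _ (hmem i hi) _ (hmem j hj) (hρ.injective.ne hij)
  · rw [hM, Finset.sum_image hρ.injective.injOn] at h5
    exact h5
  · intro i
    have := Polynomial.aeval_X (R := ℝ) T ▸
      (Commute.all Polynomial.X (h (ρ i))).map (Polynomial.aeval T)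
    simpa using this
  · intro c hc i hi
    have hc0 : 0 < c := by linarith
    refine ⟨clm_growth T _ (g (ρ i)) (h3 _).1 (mul_pos hc0 (hρ0 i)) ?_ (h2 _ (hmem i hi)),
      clm_growth_inv T T' _ hTT' hT'T (g (ρ i)) (h3 _).1 (div_pos hc0 (hρ0 i)) ?_
        (h2 _ (hmem i hi))⟩
    · intro z hz
      rw [(h3 _).2 z hz]
      nlinarith [hρ0 i]
    · intro z hz
      have := (h3 _).2 z hz
      refine ⟨?_, ?_⟩
      · rw [← norm_pos_iff, this]
        exact hρ0 i
      · rw [this, inv_eq_one_div]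
        exact div_lt_div_of_pos_right hc (hρ0 i)

/-! ### Cutoffs and `C¹` limits -/

/-- A map vanishing to first order at `0` agrees near `0` with a compactly supported map of small
derivative, obtained by multiplication by a cutoff. -/
theorem exists_cutoff {V W : Type*} [NormedAddCommGroup V] [NormedSpace ℝ V]
    [FiniteDimensional ℝ V] [NormedAddCommGroup W] [NormedSpace ℝ W] {n : ℕ} (hn : n ≠ 0)
    {r : V → W} (hr : ContDiffAt ℝ n r 0) (hr0 : r 0 = 0) (hdr : fderiv ℝ r 0 = 0)
    {ε : ℝ} (hε : 0 < ε) :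
    ∃ χ : V → ℝ, ContDiff ℝ n (fun x => χ x • r x) ∧ (∀ᶠ x in 𝓝 0, χ x = 1) ∧
      (∀ x, ‖fderiv ℝ (fun x => χ x • r x) x‖ ≤ ε) ∧ HasCompactSupport (fun x => χ x • r x) := by
  let b : ContDiffBump (0 : V) := ⟨1, 2, by norm_num, by norm_num⟩
  have hb : ContDiff ℝ ∞ b := b.contDiff
  obtain ⟨K, hK⟩ := (b.hasCompactSupport.fderiv (𝕜 := ℝ)).exists_bound_of_continuous
    (hb.continuous_fderiv (by simp))
  have hK0 : 0 ≤ K := (norm_nonneg _).trans (hK 0)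
  set η := ε / (1 + 2 * K) with hη
  have hη0 : 0 < η := by positivity
  have hn1 : (n : WithTop ℕ∞) ≠ 0 := by exact_mod_cast hn
  have hcont : ContinuousAt (fderiv ℝ r) 0 := hr.continuousAt_fderiv hn1
  have hev : ∀ᶠ x in 𝓝 (0 : V), ContDiffAt ℝ n r x ∧ ‖fderiv ℝ r x‖ < η := by
    refine (hr.eventually (by simp)).and ?_
    have := hcont.norm
    rw [ContinuousAt, hdr, norm_zero] at this
    exact this.eventually_lt_const hη0
  obtain ⟨δ', hδ', hball⟩ := Metric.eventually_nhds_iff_ball.1 hev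
  -- The bump is supported in radius `2 δ < δ'`, where `‖r‖ ≤ 2 δ η`. This compensates the
  -- derivative `K / δ` of the bump, and the total `η (1 + 2 K)` equals `ε`.
  set δ := δ' / 3 with hδ
  have hδ0 : 0 < δ := by positivity
  have hr_small : ∀ x ∈ Metric.ball (0 : V) δ', ‖r x‖ ≤ η * ‖x‖ := by
    intro x hx
    have := (convex_ball (0 : V) δ').norm_image_sub_le_of_norm_fderiv_le (𝕜 := ℝ) (f := r)
      (fun y hy => (hball y hy).1.differentiableAt hn1) (fun y hy => (hball y hy).2.le)
      (Metric.mem_ball_self hδ') hx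
    simpa [hr0] using this
  set χ : V → ℝ := fun x => b (δ⁻¹ • x) with hχ
  have hχd : ContDiff ℝ ∞ χ := hb.comp (contDiff_const_smul _)
  have hχ0 : ∀ x, 2 * δ ≤ ‖x‖ → χ x = 0 := by
    intro x hx
    apply b.zero_of_le_dist
    rw [dist_zero_right, norm_smul, norm_inv, Real.norm_eq_abs, abs_of_pos hδ0, inv_mul_eq_div,
      le_div_iff₀ hδ0]
    exact hx
  have hzero : ∀ x, 2 * δ < ‖x‖ → (fun x => χ x • r x) =ᶠ[𝓝 x] fun _ => 0 := by
    intro x hx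
    filter_upwards [(isOpen_lt continuous_const continuous_norm).mem_nhds hx] with y hy
    rw [hχ0 y (le_of_lt hy), zero_smul]
  have hsm : ∀ x ∈ Metric.ball (0 : V) δ', ContDiffAt ℝ n (fun x => χ x • r x) x := fun x hx =>
    ((hχd.of_le (by exact_mod_cast le_top)).contDiffAt).smul (hball x hx).1
  refine ⟨χ, ?_, ?_, ?_, ?_⟩
  · rw [contDiff_iff_contDiffAt]
    intro x
    by_cases hx : x ∈ Metric.ball (0 : V) δ'
    · exact hsm x hx
    · refine contDiffAt_const.congr_of_eventuallyEq (hzero x ?_)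
      rw [mem_ball_zero_iff, not_lt] at hx
      linarith
  · filter_upwards [Metric.ball_mem_nhds (0 : V) hδ0] with x hx
    apply b.one_of_mem_closedBall
    rw [mem_closedBall_zero_iff, norm_smul, norm_inv, Real.norm_eq_abs, abs_of_pos hδ0,
      inv_mul_eq_div, div_le_one hδ0]
    exact (mem_ball_zero_iff.1 hx).le
  · intro x
    rcases lt_or_ge (2 * δ) ‖x‖ with hx | hx
    · rw [(hzero x hx).fderiv_eq]
      simpa using hε.le
    · have hxb : x ∈ Metric.ball (0 : V) δ' := by
        rw [mem_ball_zero_iff]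
        linarith
      have hd1 : DifferentiableAt ℝ χ x := hχd.differentiable (by simp) x
      have hd2 : DifferentiableAt ℝ r x := (hball x hxb).1.differentiableAt hn1
      have hχ' : ‖fderiv ℝ χ x‖ ≤ K * δ⁻¹ := by
        have h1 : HasFDerivAt χ ((fderiv ℝ b (δ⁻¹ • x)).comp
            (δ⁻¹ • ContinuousLinearMap.id ℝ V)) x :=
          (hb.differentiable (by simp) _).hasFDerivAt.comp x
            ((hasFDerivAt_id x).const_smul δ⁻¹)
        rw [h1.fderiv]
        refine (ContinuousLinearMap.opNorm_comp_le _ _).trans ?_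
        refine mul_le_mul (hK _) ?_ (norm_nonneg _) hK0
        rw [norm_smul, norm_inv, Real.norm_eq_abs, abs_of_pos hδ0]
        exact mul_le_of_le_one_right (by positivity) ContinuousLinearMap.norm_id_le
      rw [fderiv_fun_smul hd1 hd2]
      calc ‖χ x • fderiv ℝ r x + (fderiv ℝ χ x).smulRight (r x)‖
          ≤ ‖χ x • fderiv ℝ r x‖ + ‖(fderiv ℝ χ x).smulRight (r x)‖ := norm_add_le _ _
        _ ≤ 1 * η + (K * δ⁻¹) * (η * (2 * δ)) := by
            rw [norm_smul, ContinuousLinearMap.norm_smulRight_apply]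
            refine add_le_add ?_ ?_
            · refine mul_le_mul ?_ (hball x hxb).2.le (norm_nonneg _) zero_le_one
              rw [Real.norm_eq_abs, abs_of_nonneg b.nonneg]
              exact b.le_one
            · refine mul_le_mul hχ' ?_ (norm_nonneg _) (by positivity)
              exact (hr_small x hxb).trans (mul_le_mul_of_nonneg_left hx hη0.le)
        _ = η * (1 + 2 * K) := by
            field_simp
        _ = ε := by
            rw [hη]
            field_simp
        _ ≤ ε := le_rfl
  · refine HasCompactSupport.intro (isCompact_closedBall (0 : V) (2 * δ)) fun x hx => ?_
    rw [mem_closedBall_zero_iff, not_le] at hx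
    rw [hχ0 x hx.le, zero_smul]

/-- Geometric convergence of the derivatives gives a `C¹` limit on a ball. -/
theorem exists_contDiffOn_limit {V W : Type*} [NormedAddCommGroup V] [NormedSpace ℝ V]
    [NormedAddCommGroup W] [NormedSpace ℝ W] [CompleteSpace W] (u : ℕ → V → W)
    {R C θ : ℝ} (hu : ∀ k, ContDiffOn ℝ 1 (u k) (Metric.ball 0 R))
    (hu0 : ∀ k, u k 0 = 0) (hθ1 : θ < 1)
    (h : ∀ k, ∀ x ∈ Metric.ball (0 : V) R,
      ‖fderiv ℝ (u (k + 1)) x - fderiv ℝ (u k) x‖ ≤ C * θ ^ k) :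
    ∃ ψ : V → W, ContDiffOn ℝ 1 ψ (Metric.ball 0 R) ∧ ∀ x ∈ Metric.ball (0 : V) R,
      Tendsto (fun k => u k x) atTop (𝓝 (ψ x)) ∧
      Tendsto (fun k => fderiv ℝ (u k) x) atTop (𝓝 (fderiv ℝ ψ x)) := by
  have hopen : IsOpen (Metric.ball (0 : V) R) := Metric.isOpen_ball
  have hd : ∀ k, ∀ x ∈ Metric.ball (0 : V) R, DifferentiableAt ℝ (u k) x := fun k x hx =>
    ((hu k).contDiffAt (hopen.mem_nhds hx)).differentiableAt (by simp)
  have hdist : ∀ x ∈ Metric.ball (0 : V) R, ∀ k,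
      dist (fderiv ℝ (u k) x) (fderiv ℝ (u (k + 1)) x) ≤ C * θ ^ k := by
    intro x hx k
    rw [dist_comm, dist_eq_norm]
    exact h k x hx
  have hval : ∀ x ∈ Metric.ball (0 : V) R, ∀ k,
      dist (u k x) (u (k + 1) x) ≤ (C * ‖x‖) * θ ^ k := by
    intro x hx k
    have hpos : (0 : V) ∈ Metric.ball (0 : V) R :=
      Metric.mem_ball_self (Metric.pos_of_mem_ball hx)
    have := (convex_ball (0 : V) R).norm_image_sub_le_of_norm_fderiv_le (𝕜 := ℝ)
      (f := fun y => u (k + 1) y - u k y) (C := C * θ ^ k)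
      (fun y hy => (hd (k + 1) y hy).sub (hd k y hy))
      (fun y hy => by
        rw [fderiv_fun_sub (hd (k + 1) y hy) (hd k y hy)]
        exact h k y hy) hpos hx
    simp only [hu0, sub_self, sub_zero] at this
    rw [dist_comm, dist_eq_norm]
    exact this.trans_eq (by ring)
  have hlim : ∀ x ∈ Metric.ball (0 : V) R, ∃ y, Tendsto (fun k => u k x) atTop (𝓝 y) :=
    fun x hx => cauchySeq_tendsto_of_complete (cauchySeq_of_le_geometric θ _ hθ1 (hval x hx))
  have hlim' : ∀ x ∈ Metric.ball (0 : V) R,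
      ∃ L, Tendsto (fun k => fderiv ℝ (u k) x) atTop (𝓝 L) :=
    fun x hx => cauchySeq_tendsto_of_complete (cauchySeq_of_le_geometric θ _ hθ1 (hdist x hx))
  choose! ψ hψ using hlim
  choose! L hL using hlim'
  have hunif : TendstoUniformlyOn (fun k => fderiv ℝ (u k)) L atTop (Metric.ball (0 : V) R) := by
    rcases le_or_gt R 0 with hR | hR
    · rw [Metric.ball_eq_empty.2 hR]
      exact tendstoUniformlyOn_empty
    have hC0 : 0 ≤ C := by simpa using (norm_nonneg _).trans (h 0 0 (Metric.mem_ball_self hR))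
    -- The sign of `θ` is not given: for `C = 0` the derivatives do not depend on `k`, and for `C >
    -- 0` the bound at `k = 1` forces `θ ≥ 0`.
    rcases hC0.eq_or_lt with hC | hC
    · rw [Metric.tendstoUniformlyOn_iff]
      intro ε hε
      filter_upwards with k x hx
      have := dist_le_of_le_geometric_of_tendsto θ C hθ1 (hdist x hx) (hL x hx) k
      rw [← hC] at this
      rw [dist_comm]
      simp only [zero_mul, zero_div] at this
      exact this.trans_lt hε
    have hθ0 : 0 ≤ θ := by
      have := (norm_nonneg _).trans (h 1 0 (Metric.mem_ball_self hR))
      rw [pow_one] at this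
      exact nonneg_of_mul_nonneg_right this hC
    have ht : Tendsto (fun k : ℕ => C * θ ^ k / (1 - θ)) atTop (𝓝 0) := by
      have := ((tendsto_pow_atTop_nhds_zero_of_lt_one hθ0 hθ1).const_mul C).div_const (1 - θ)
      simpa using this
    rw [Metric.tendstoUniformlyOn_iff]
    intro ε hε
    filter_upwards [ht.eventually_lt_const hε] with k hk x hx
    rw [dist_comm]
    exact (dist_le_of_le_geometric_of_tendsto θ C hθ1 (hdist x hx) (hL x hx) k).trans_lt hk
  have hder : ∀ x ∈ Metric.ball (0 : V) R, HasFDerivAt ψ (L x) x := fun x hx =>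
    hasFDerivAt_of_tendstoUniformlyOn hopen hunif (fun k y hy => (hd k y hy).hasFDerivAt) hψ hx
  refine ⟨ψ, ?_, fun x hx => ⟨hψ x hx, ?_⟩⟩
  · rw [show (1 : WithTop ℕ∞) = 0 + 1 from (zero_add 1).symm, contDiffOn_succ_iff_fderiv_of_isOpen hopen]
    refine ⟨fun x hx => (hder x hx).differentiableAt.differentiableWithinAt, by simp, ?_⟩
    rw [contDiffOn_zero]
    have hc : ContinuousOn L (Metric.ball 0 R) := hunif.continuousOn (Frequently.of_forall fun k =>
      (hu k).continuousOn_fderiv_of_isOpen hopen (by simp))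
    exact hc.congr fun x hx => (hder x hx).fderiv
  · rw [(hder x hx).fderiv]
    exact hL x hx

/-! ### The slow invariant manifold -/

section SlowManifold

variable {V : Type*} [NormedAddCommGroup V] [NormedSpace ℝ V]

/-- `A` stretches the slow part by at least `a` and the fast part by at most `b`, while `w` adds a
fast error `ε ‖d‖ ≤ ε (1 + κ) ‖p d‖`. Hence slopes transform by `κ ↦ ((b + ε) κ + ε) / a`, an affine
contraction when `b + ε < a`. -/
theorem cone_condition_step (A : V ≃L[ℝ] V) (p : V →L[ℝ] V) (hpp : ∀ x, p (p x) = p x)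
    (hAp : ∀ x, p (A x) = A (p x)) {a b ε κ : ℝ} (ha : 0 < a) (hb : 0 ≤ b) (hε : 0 ≤ ε)
    (hfast : ∀ v, p v = 0 → ‖A v‖ ≤ b * ‖v‖) (hslow : ∀ v, a * ‖p v‖ ≤ ‖A (p v)‖)
    (hκ : 0 ≤ κ) {d w : V} (hd : ‖d - p d‖ ≤ κ * ‖p d‖) (hw : ‖w‖ ≤ ε * ‖d‖) (hpw : p w = 0) :
    ‖(A d + w) - p (A d + w)‖ ≤ ((b + ε) * κ + ε) / a * ‖p (A d + w)‖ := by
  have e1 : p (A d + w) = A (p d) := by rw [map_add, hpw, add_zero, hAp]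
  have e2 : (A d + w) - A (p d) = A (d - p d) + w := by
    rw [map_sub]
    abel
  have h1 : ‖A (d - p d)‖ ≤ b * (κ * ‖p d‖) :=
    (hfast _ (by rw [map_sub, hpp, sub_self])).trans (mul_le_mul_of_nonneg_left hd hb)
  have h2 : ‖d‖ ≤ ‖p d‖ + κ * ‖p d‖ := by
    calc ‖d‖ = ‖p d + (d - p d)‖ := by rw [add_sub_cancel]
      _ ≤ _ := (norm_add_le _ _).trans (by gcongr)
  have h3 : ‖w‖ ≤ ε * (‖p d‖ + κ * ‖p d‖) := hw.trans (mul_le_mul_of_nonneg_left h2 hε)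
  have h4 : ‖p d‖ ≤ ‖A (p d)‖ / a := by
    rw [le_div_iff₀ ha, mul_comm]
    exact hslow d
  rw [e1, e2]
  calc ‖A (d - p d) + w‖ ≤ b * (κ * ‖p d‖) + ε * (‖p d‖ + κ * ‖p d‖) :=
        (norm_add_le _ _).trans (add_le_add h1 h3)
    _ = ((b + ε) * κ + ε) * ‖p d‖ := by ring
    _ ≤ ((b + ε) * κ + ε) * (‖A (p d)‖ / a) := by gcongr
    _ = _ := by ring

/-- A differentiable map satisfying ever sharper cone conditions near the kernel of `p` is `C¹`. -/
theorem contDiff_of_cone_condition (p : V →L[ℝ] V) {σ : V → V}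
    (hpσ : ∀ x, p (σ x) = p x)
    (hoff : ∀ x, p x ≠ 0 → ContDiffAt ℝ 1 σ x)
    (hcone : ∀ κ > 0, ∃ δ > 0, ∀ x y, ‖p x‖ < δ → ‖p y‖ < δ →
      ‖(σ x - σ y) - p (σ x - σ y)‖ ≤ κ * ‖p (σ x - σ y)‖) :
    ContDiff ℝ 1 σ ∧ HasFDerivAt σ p 0 := by
  have hopen : ∀ δ, IsOpen {x | ‖p x‖ < δ} := fun δ =>
    isOpen_lt p.continuous.norm continuous_const
  -- As `p (σ x - σ y) = p (x - y)`, the cone condition says that `σ - p` has small Lipschitz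
  -- constant near `ker p`. So `Dσ = p` on the kernel, and `Dσ` is close to `p` nearby.
  have hcone' : ∀ κ > 0, ∃ δ > 0, ∀ x y, ‖p x‖ < δ → ‖p y‖ < δ →
      ‖(σ x - p x) - (σ y - p y)‖ ≤ κ * ‖x - y‖ := by
    intro κ hκ
    obtain ⟨δ, hδ, h⟩ := hcone (κ / (‖p‖ + 1)) (by positivity)
    refine ⟨δ, hδ, fun x y hx hy => ?_⟩
    have h1 := h x y hx hy
    rw [map_sub, hpσ, hpσ] at h1
    have h2 : ‖p x - p y‖ ≤ (‖p‖ + 1) * ‖x - y‖ := by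
      rw [← map_sub]
      exact (p.le_opNorm _).trans (by gcongr; linarith)
    calc ‖(σ x - p x) - (σ y - p y)‖ = ‖σ x - σ y - (p x - p y)‖ := by congr 1; abel
      _ ≤ κ / (‖p‖ + 1) * ((‖p‖ + 1) * ‖x - y‖) := h1.trans (by gcongr)
      _ = κ * ‖x - y‖ := by field_simp
  have hker : ∀ x, p x = 0 → HasFDerivAt σ p x := by
    intro x hx
    rw [hasFDerivAt_iff_isLittleO, Asymptotics.isLittleO_iff]
    intro κ hκ
    obtain ⟨δ, hδ, h⟩ := hcone' κ hκ
    filter_upwards [(hopen δ).mem_nhds (show ‖p x‖ < δ by rwa [hx, norm_zero])] with y hy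
    have := h y x hy (by rwa [hx, norm_zero])
    rw [map_sub]
    refine le_trans (le_of_eq ?_) this
    congr 1
    abel
  have hdiff : Differentiable ℝ σ := fun x => by
    by_cases hx : p x = 0
    · exact (hker x hx).differentiableAt
    · exact (hoff x hx).differentiableAt (by simp)
  refine ⟨?_, hker 0 (map_zero p)⟩
  rw [contDiff_one_iff_fderiv]
  refine ⟨hdiff, continuous_iff_continuousAt.2 fun x => ?_⟩
  by_cases hx : p x = 0
  · rw [Metric.continuousAt_iff']
    intro κ hκ
    obtain ⟨δ, hδ, h⟩ := hcone' (κ / 2) (by positivity)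
    filter_upwards [(hopen δ).mem_nhds (show ‖p x‖ < δ by rwa [hx, norm_zero])] with y hy
    rw [(hker x hx).fderiv, dist_eq_norm]
    have h1 : HasFDerivAt (fun x => σ x - p x) (fderiv ℝ σ y - p) y :=
      (hdiff y).hasFDerivAt.sub p.hasFDerivAt
    refine (h1.le_of_lip' (by positivity) ?_).trans_lt (half_lt_self hκ)
    filter_upwards [(hopen δ).mem_nhds hy] with z hz
    exact h z y hz hy
  · exact (hoff x hx).continuousAt_fderiv (by simp)

/-- The pseudo-unstable (slow) manifold of a small compactly supported perturbation of a linear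
contraction, parametrized so that the induced dynamics on it is linear. -/
theorem exists_slow_manifold (A : V ≃L[ℝ] V) (p : V →L[ℝ] V) (hpp : ∀ x, p (p x) = p x)
    (hAp : ∀ x, p (A x) = A (p x)) {r : V → V} (hr : ContDiff ℝ 1 r) (hr0 : r 0 = 0)
    (hdr : fderiv ℝ r 0 = 0) (hpr : ∀ x, p (r x) = 0) {R : ℝ} (hsupp : ∀ x, R ≤ ‖x‖ → r x = 0)
    {a b ε l : ℝ} (ha : 0 < a) (hb : 0 ≤ b) (hε : 0 < ε) (hrε : ∀ x, ‖fderiv ℝ r x‖ ≤ ε)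
    (hfast : ∀ v, p v = 0 → ‖A v‖ ≤ b * ‖v‖) (hslow : ∀ v, a * ‖p v‖ ≤ ‖A (p v)‖)
    (hgap : b + ε < a) (hl0 : 0 ≤ l) (hl1 : l < 1) (hAl : ∀ v, ‖A v‖ ≤ l * ‖v‖) :
    ∃ σ : V → V, ContDiff ℝ 1 σ ∧ HasFDerivAt σ p 0 ∧ σ 0 = 0 ∧ (∀ x, p (σ x) = p x) ∧
      ∀ x, σ (A x) = A (σ x) + r (σ x) := by
  have hAp' : ∀ x, p (A.symm x) = A.symm (p x) := fun x => by
    apply A.injective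
    rw [← hAp, A.apply_symm_apply, A.apply_symm_apply]
  have hlip : ∀ x y, ‖r x - r y‖ ≤ ε * ‖x - y‖ := fun x y =>
    convex_univ.norm_image_sub_le_of_norm_fderiv_le (𝕜 := ℝ)
      (fun z _ => hr.differentiable (by simp) z) (fun z _ => hrε z) trivial trivial
  -- Graph transform started at the linear slow space: `s (m + 1) = (A + r) ∘ s m ∘ A⁻¹`.
  let s : ℕ → V → V := fun m => Nat.rec (motive := fun _ => V → V) p
    (fun _ g x => A (g (A.symm x)) + r (g (A.symm x))) m
  have s0 : ∀ x, s 0 x = p x := fun _ => rfl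
  have ss : ∀ m x, s (m + 1) x = A (s m (A.symm x)) + r (s m (A.symm x)) := fun _ _ => rfl
  have hps : ∀ m x, p (s m x) = p x := by
    intro m
    induction m with
    | zero => exact hpp
    | succ m ih =>
      intro x
      rw [ss, map_add, hpr, add_zero, hAp, ih, hAp', A.apply_symm_apply]
  have hsmooth : ∀ m, ContDiff ℝ 1 (s m) := by
    intro m
    induction m with
    | zero => exact p.contDiff
    | succ m ih =>
      have h1 : ContDiff ℝ 1 fun x => s m (A.symm x) := ih.comp A.symm.contDiff
      exact (A.contDiff.comp h1).add (hr.comp h1)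
  have hker : ∀ m x, p x = 0 → s m x = 0 := by
    intro m
    induction m with
    | zero => exact fun x hx => hx
    | succ m ih =>
      intro x hx
      rw [ss, ih _ (by rw [hAp', hx, map_zero]), map_zero, hr0, add_zero]
  have hstab : ∀ m x, R ≤ ‖A.symm^[m + 1] (p x)‖ → s (m + 1) x = s m x := by
    intro m
    induction m with
    | zero =>
      intro x hx
      have hz : r (A.symm (p x)) = 0 := hsupp _ hx
      rw [ss, s0, s0, hAp', hz, add_zero, A.apply_symm_apply]
    | succ m ih =>
      intro x hx
      rw [Function.iterate_succ_apply, ← hAp'] at hx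
      rw [ss (m + 1), ih _ hx, ← ss]
  have hexp : ∀ k y, ‖y‖ ≤ l ^ k * ‖A.symm^[k] y‖ := by
    intro k
    induction k with
    | zero => simp
    | succ k ih =>
      intro y
      rw [Function.iterate_succ_apply']
      calc ‖y‖ ≤ l ^ k * ‖A (A.symm (A.symm^[k] y))‖ := by
            rw [A.apply_symm_apply]
            exact ih y
        _ ≤ l ^ k * (l * ‖A.symm (A.symm^[k] y)‖) := by
            gcongr
            exact hAl _
        _ = _ := by ring
  -- `A⁻¹` expands by at least `1 / l`, so the backward orbit of `p x` leaves the support of `r`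
  -- after a number of steps uniform in `‖p x‖ ≥ c`. From then on `s m x` is constant, which makes
  -- the limit `C¹` off `ker p`.
  have hconst : ∀ c > 0, ∃ m₀, ∀ m ≥ m₀, ∀ x, c ≤ ‖p x‖ → s m x = s m₀ x := by
    intro c hc
    have ht : Tendsto (fun k : ℕ => l ^ k * |R|) atTop (𝓝 0) := by
      simpa using (tendsto_pow_atTop_nhds_zero_of_lt_one hl0 hl1).mul_const |R|
    obtain ⟨m₀, hm₀⟩ := eventually_atTop.1 (ht.eventually_lt_const hc)
    refine ⟨m₀, fun m hm x hx => ?_⟩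
    induction m, hm using Nat.le_induction with
    | base => rfl
    | succ m hm ih =>
      rw [hstab m x ?_, ih]
      by_contra! hlt
      have h1 := hexp (m + 1) (p x)
      have h2 := hm₀ (m + 1) (by omega)
      have h3 : l ^ (m + 1) * ‖A.symm^[m + 1] (p x)‖ ≤ l ^ (m + 1) * |R| :=
        mul_le_mul_of_nonneg_left (hlt.le.trans (le_abs_self R)) (by positivity)
      linarith
  have hlimit : ∀ x, ∃ y, ∀ᶠ m in atTop, s m x = y := by
    intro x
    by_cases hx : p x = 0
    · exact ⟨0, Eventually.of_forall fun m => hker m x hx⟩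
    · obtain ⟨m₀, hm₀⟩ := hconst ‖p x‖ (norm_pos_iff.2 hx)
      exact ⟨s m₀ x, eventually_atTop.2 ⟨m₀, fun m hm => hm₀ m hm x le_rfl⟩⟩
  choose σ hσ using hlimit
  have hpσ : ∀ x, p (σ x) = p x := fun x => by
    obtain ⟨m, hm⟩ := (hσ x).exists
    rw [← hm, hps]
  have hσker : ∀ x, p x = 0 → σ x = 0 := fun x hx => by
    obtain ⟨m, hm⟩ := (hσ x).exists
    rw [← hm, hker m x hx]
  have hσA : ∀ x, σ (A x) = A (σ x) + r (σ x) := fun x => by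
    obtain ⟨m, h1, h2⟩ := (((tendsto_add_atTop_nat 1).eventually (hσ (A x))).and (hσ x)).exists
    rw [← h1, ← h2, ss, A.symm_apply_apply]
  have hoff : ∀ x, p x ≠ 0 → ContDiffAt ℝ 1 σ x := by
    intro x hx
    obtain ⟨m₀, hm₀⟩ := hconst (‖p x‖ / 2) (half_pos (norm_pos_iff.2 hx))
    refine (hsmooth m₀).contDiffAt.congr_of_eventuallyEq ?_
    have : ∀ᶠ y in 𝓝 x, ‖p x‖ / 2 < ‖p y‖ :=
      p.continuous.norm.continuousAt.eventually_const_lt (half_lt_self (norm_pos_iff.2 hx))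
    filter_upwards [this] with y hy
    obtain ⟨m, h1, h2⟩ := ((hσ y).and (eventually_ge_atTop m₀)).exists
    rw [← h1, hm₀ m h2 y hy.le]
  -- The fixed point of the slope recursion, so this cone is preserved by the graph transform.
  set κ := ε / (a - b - ε) with hκ
  have hgap' : 0 < a - b - ε := by linarith
  have hκ0 : 0 ≤ κ := by positivity
  have hκfix : ((b + ε) * κ + ε) / a = κ := by
    rw [hκ]
    field_simp
    ring
  have hcone_s : ∀ m x y, ‖(s m x - s m y) - p (s m x - s m y)‖ ≤ κ * ‖p (s m x - s m y)‖ := by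
    intro m
    induction m with
    | zero =>
      intro x y
      simp only [s0, map_sub, hpp, sub_self, norm_zero]
      positivity
    | succ m ih =>
      intro x y
      have := cone_condition_step A p hpp hAp ha hb hε.le hfast hslow hκ0
        (ih (A.symm x) (A.symm y)) (hlip (s m (A.symm x)) (s m (A.symm y)))
        (by rw [map_sub, hpr, hpr, sub_self])
      rw [hκfix] at this
      have e : A (s m (A.symm x) - s m (A.symm y)) + (r (s m (A.symm x)) - r (s m (A.symm y)))
          = s (m + 1) x - s (m + 1) y := by
        rw [ss, ss, map_sub]
        abel
      rwa [e] at this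
  have hcone : ∀ x y, ‖(σ x - σ y) - p (σ x - σ y)‖ ≤ κ * ‖p (σ x - σ y)‖ := by
    intro x y
    obtain ⟨m, h1, h2⟩ := ((hσ x).and (hσ y)).exists
    rw [← h1, ← h2]
    exact hcone_s m x y
  have hσbound : ∀ x, ‖σ x‖ ≤ (1 + κ) * ‖p x‖ := by
    intro x
    have h := hcone x 0
    rw [hσker 0 (map_zero p), sub_zero, hpσ] at h
    calc ‖σ x‖ = ‖p x + (σ x - p x)‖ := by rw [add_sub_cancel]
      _ ≤ ‖p x‖ + κ * ‖p x‖ := (norm_add_le _ _).trans (by gcongr)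
      _ = _ := by ring
  set Good : ℝ → Prop := fun k => ∃ δ > 0, ∀ x y, ‖p x‖ < δ → ‖p y‖ < δ →
      ‖(σ x - σ y) - p (σ x - σ y)‖ ≤ k * ‖p (σ x - σ y)‖ with hGood
  have hmono : ∀ k k', k ≤ k' → Good k → Good k' := by
    rintro k k' hk ⟨δ, hδ, h⟩
    exact ⟨δ, hδ, fun x y hx hy => (h x y hx hy).trans (by gcongr)⟩
  set θ := (b + ε) / a with hθ
  have hθ0 : 0 ≤ θ := by positivity
  have hθ1 : θ < 1 := (div_lt_one ha).2 hgap
  -- Near `0` the Lipschitz constant of `r` can be taken as small as desired, so one application of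
  -- the invariance equation contracts the slope by `θ` up to an arbitrary `η`. Iterating drives the
  -- slope near `ker p` to zero.
  have himprove : ∀ k, 0 ≤ k → Good k → ∀ η > 0, Good (θ * k + η) := by
    rintro k hk ⟨δ, hδ, h⟩ η hη
    set ε' := min ε (a * η) with hε'
    have hε'0 : 0 < ε' := lt_min hε (by positivity)
    have hc : ∀ᶠ x in 𝓝 (0 : V), ‖fderiv ℝ r x‖ < ε' := by
      have : Tendsto (fun x => ‖fderiv ℝ r x‖) (𝓝 0) (𝓝 0) := by
        have := (hr.continuous_fderiv (by simp)).norm.tendsto (0 : V)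
        simpa [hdr] using this
      exact this.eventually_lt_const hε'0
    obtain ⟨δr, hδr, hball⟩ := Metric.eventually_nhds_iff_ball.1 hc
    have hlip' : ∀ x ∈ Metric.ball (0 : V) δr, ∀ y ∈ Metric.ball (0 : V) δr,
        ‖r x - r y‖ ≤ ε' * ‖x - y‖ := fun x hx y hy =>
      (convex_ball (0 : V) δr).norm_image_sub_le_of_norm_fderiv_le (𝕜 := ℝ)
        (fun z _ => hr.differentiable (by simp) z) (fun z hz => (hball z hz).le) hy hx
    refine ⟨min (δ * a) (δr * a / (1 + κ)), by positivity, ?_⟩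
    have hback : ∀ x, ‖p (A.symm x)‖ ≤ ‖p x‖ / a := by
      intro x
      have := hslow (A.symm x)
      rw [← hAp, A.apply_symm_apply] at this
      rw [le_div_iff₀ ha]
      linarith
    have hin : ∀ x, ‖p x‖ < min (δ * a) (δr * a / (1 + κ)) →
        ‖p (A.symm x)‖ < δ ∧ σ (A.symm x) ∈ Metric.ball (0 : V) δr := by
      intro x hx
      have h1 := hx.trans_le (min_le_left _ _)
      have h2 := hx.trans_le (min_le_right _ _)
      refine ⟨(hback x).trans_lt ((div_lt_iff₀ ha).2 h1), ?_⟩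
      rw [mem_ball_zero_iff]
      calc ‖σ (A.symm x)‖ ≤ (1 + κ) * (‖p x‖ / a) :=
            (hσbound _).trans (by gcongr; exact hback x)
        _ < (1 + κ) * (δr * a / (1 + κ) / a) := by gcongr
        _ = δr := by field_simp
    intro x y hx hy
    obtain ⟨hx1, hx2⟩ := hin x hx
    obtain ⟨hy1, hy2⟩ := hin y hy
    have := cone_condition_step A p hpp hAp ha hb hε'0.le hfast hslow hk
      (h _ _ hx1 hy1) (hlip' _ hx2 _ hy2) (by rw [map_sub, hpr, hpr, sub_self])
    have e : A (σ (A.symm x) - σ (A.symm y)) + (r (σ (A.symm x)) - r (σ (A.symm y)))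
        = σ x - σ y := by
      have ex := hσA (A.symm x)
      have ey := hσA (A.symm y)
      rw [A.apply_symm_apply] at ex ey
      rw [ex, ey, map_sub]
      abel
    rw [e] at this
    refine this.trans (mul_le_mul_of_nonneg_right ?_ (norm_nonneg _))
    have h1 : ε' ≤ ε := min_le_left _ _
    have h2 : ε' ≤ a * η := min_le_right _ _
    rw [add_div, hθ]
    refine add_le_add ?_ ?_
    · rw [mul_div_right_comm]
      gcongr
    · rw [div_le_iff₀ ha]
      linarith
  have hpow : ∀ n : ℕ, ∀ η > 0, Good (θ ^ n * κ + η) := by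
    intro n
    induction n with
    | zero =>
      intro η hη
      exact hmono κ _ (by rw [pow_zero, one_mul]; linarith)
        ⟨1, one_pos, fun x y _ _ => hcone x y⟩
    | succ n ih =>
      intro η hη
      refine hmono _ _ ?_ (himprove _ (by positivity) (ih (η / 2) (half_pos hη)) (η / 2)
        (half_pos hη))
      have : θ * (η / 2) ≤ η / 2 := mul_le_of_le_one_left (by positivity) hθ1.le
      rw [pow_succ]
      linarith
  have hall : ∀ k > 0, Good k := by
    intro k hk
    have ht : Tendsto (fun n : ℕ => θ ^ n * κ) atTop (𝓝 0) := by
      simpa using (tendsto_pow_atTop_nhds_zero_of_lt_one hθ0 hθ1).mul_const κ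
    obtain ⟨n, hn⟩ := (ht.eventually_lt_const (half_pos hk)).exists
    exact hmono _ _ (by linarith) (hpow n (k / 2) (half_pos hk))
  obtain ⟨h1, h2⟩ := contDiff_of_cone_condition p hpσ hoff hall
  exact ⟨σ, h1, h2, hσker 0 (map_zero p), hpσ, hσA⟩

end SlowManifold

/-! ### Orbit displacements under a smooth contraction -/

section Iteration

variable {V : Type*} [NormedAddCommGroup V] [NormedSpace ℝ V]

theorem contDiff_iterate {n : WithTop ℕ∞} {f : V → V} (hf : ContDiff ℝ n f) (k : ℕ) :
    ContDiff ℝ n f^[k] := by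
  induction k with
  | zero => exact contDiff_id
  | succ k ih =>
    rw [Function.iterate_succ']
    exact hf.comp ih

/-- A `C¹` contraction fixing the origin, with Lipschitz derivative and linear part `A`. -/
structure IsSmoothContraction (f : V → V) (A : V →L[ℝ] V) (l M : ℝ) : Prop where
  contDiff : ContDiff ℝ 1 f
  map_zero : f 0 = 0
  fderiv_zero : fderiv ℝ f 0 = A
  pos : 0 < l
  lt_one : l < 1
  norm_fderiv_le : ∀ x, ‖fderiv ℝ f x‖ ≤ l
  nonneg : 0 ≤ M
  lipschitz : ∀ x y, ‖fderiv ℝ f x - fderiv ℝ f y‖ ≤ M * ‖x - y‖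

namespace IsSmoothContraction

variable {f : V → V} {A : V →L[ℝ] V} {l M : ℝ}

theorem differentiable (hf : IsSmoothContraction f A l M) : Differentiable ℝ f :=
  hf.contDiff.differentiable (by simp)

theorem contDiff_iterate (hf : IsSmoothContraction f A l M) (k : ℕ) : ContDiff ℝ 1 f^[k] :=
  _root_.contDiff_iterate hf.contDiff k

theorem differentiable_iterate (hf : IsSmoothContraction f A l M) (k : ℕ) :
    Differentiable ℝ f^[k] :=
  (hf.contDiff_iterate k).differentiable (by simp)

theorem iterate_zero (hf : IsSmoothContraction f A l M) (k : ℕ) : f^[k] 0 = 0 :=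
  Function.iterate_fixed hf.map_zero k

theorem fderiv_iterate_succ (hf : IsSmoothContraction f A l M) (k : ℕ) (x : V) :
    fderiv ℝ f^[k + 1] x = (fderiv ℝ f (f^[k] x)).comp (fderiv ℝ f^[k] x) := by
  rw [Function.iterate_succ']
  exact fderiv_comp x (hf.differentiable _) (hf.differentiable_iterate k x)

theorem norm_fderiv_iterate_le (hf : IsSmoothContraction f A l M) (k : ℕ) (x : V) :
    ‖fderiv ℝ f^[k] x‖ ≤ l ^ k := by
  induction k with
  | zero => simpa using ContinuousLinearMap.norm_id_le (𝕜 := ℝ) (E := V)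
  | succ k ih =>
    rw [hf.fderiv_iterate_succ, pow_succ']
    exact (ContinuousLinearMap.opNorm_comp_le _ _).trans
      (mul_le_mul (hf.norm_fderiv_le _) ih (norm_nonneg _) hf.pos.le)

theorem norm_iterate_le (hf : IsSmoothContraction f A l M) (k : ℕ) (x : V) :
    ‖f^[k] x‖ ≤ l ^ k * ‖x‖ := by
  simpa [hf.iterate_zero] using convex_univ.norm_image_sub_le_of_norm_fderiv_le (𝕜 := ℝ)
    (fun z _ => hf.differentiable_iterate k z) (fun z _ => hf.norm_fderiv_iterate_le k z)
    (Set.mem_univ (0 : V)) (Set.mem_univ x)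

theorem norm_apply_le (hf : IsSmoothContraction f A l M) (x : V) : ‖f x‖ ≤ l * ‖x‖ := by
  simpa using hf.norm_iterate_le 1 x

theorem fderiv_iterate_zero (hf : IsSmoothContraction f A l M) (k : ℕ) :
    fderiv ℝ f^[k] 0 = A ^ k := by
  induction k with
  | zero => simp; rfl
  | succ k ih =>
    rw [hf.fderiv_iterate_succ, hf.iterate_zero, hf.fderiv_zero, ih, pow_succ']
    rfl

theorem tendsto_zero (hf : IsSmoothContraction f A l M) : Tendsto f (𝓝 0) (𝓝 0) := by
  have := hf.contDiff.continuous.tendsto 0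
  rwa [hf.map_zero] at this

theorem mem_ball (hf : IsSmoothContraction f A l M) {R : ℝ} {x : V}
    (hx : x ∈ Metric.ball (0 : V) R) : f x ∈ Metric.ball (0 : V) R := by
  rw [mem_ball_zero_iff] at *
  have h1 := hf.norm_apply_le x
  have h2 : l * ‖x‖ ≤ ‖x‖ := mul_le_of_le_one_left (norm_nonneg _) hf.lt_one.le
  linarith

end IsSmoothContraction

/-- The displacement between the orbits of `x` and of `P x`. -/
def orbitDisplacement (f P : V → V) (k : ℕ) (x : V) : V :=
  f^[k] x - f^[k] (P x)

variable {f : V → V} {A : V →L[ℝ] V} {l M : ℝ} {P : V → V} {x : V}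

theorem contDiffAt_orbitDisplacement (hf : IsSmoothContraction f A l M)
    (hP : ContDiffAt ℝ 1 P x) (k : ℕ) : ContDiffAt ℝ 1 (orbitDisplacement f P k) x :=
  (hf.contDiff_iterate k).contDiffAt.sub ((hf.contDiff_iterate k).contDiffAt.comp x hP)

theorem fderiv_orbitDisplacement (hf : IsSmoothContraction f A l M)
    (hP : DifferentiableAt ℝ P x) (k : ℕ) : fderiv ℝ (orbitDisplacement f P k) x =
      fderiv ℝ f^[k] x - (fderiv ℝ f^[k] (P x)).comp (fderiv ℝ P x) :=
  ((hf.differentiable_iterate k x).hasFDerivAt.sub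
    ((hf.differentiable_iterate k (P x)).hasFDerivAt.comp x hP.hasFDerivAt)).fderiv

theorem orbitDisplacement_zero {V : Type*} [NormedAddCommGroup V] {f P : V → V}
    (hP : P 0 = 0) (k : ℕ) :
    orbitDisplacement f P k 0 = 0 := by
  simp [orbitDisplacement, hP]

/-- With `x_k = f^k x`, `y_k = f^k (P x)` and `Δ_k` the displacement, the chain rule splits
`DΔ_(k+1) - A DΔ_k` into `(Df(x_k) - A) DΔ_k` and `(Df(x_k) - Df(y_k)) D(f^k ∘ P)`. In each term the
Lipschitz bound on `Df` gives a factor `l^k` beside `τ^k`; this gain drives both the convergence and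
the bootstrap. -/
theorem norm_fderiv_orbitDisplacement_defect_le (hf : IsSmoothContraction f A l M)
    {R L C τ : ℝ} (hP : ∀ x ∈ Metric.ball (0 : V) R, ContDiffAt ℝ 1 P x) (hP0 : P 0 = 0)
    (hL : ∀ x ∈ Metric.ball (0 : V) R, ‖fderiv ℝ P x‖ ≤ L)
    (hC : ∀ x ∈ Metric.ball (0 : V) R, ∀ k, ‖fderiv ℝ (orbitDisplacement f P k) x‖ ≤ C * τ ^ k) :
    ∀ x ∈ Metric.ball (0 : V) R, ∀ k, ‖fderiv ℝ (orbitDisplacement f P (k + 1)) x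
      - A.comp (fderiv ℝ (orbitDisplacement f P k) x)‖ ≤ M * R * C * (1 + L) * (l * τ) ^ k := by
  intro x hx k
  have hR : 0 < R := Metric.pos_of_mem_ball hx
  have hM := hf.nonneg
  have hl := hf.pos
  have hL0 : 0 ≤ L := (norm_nonneg _).trans (hL x hx)
  have hd : ∀ y ∈ Metric.ball (0 : V) R, DifferentiableAt ℝ P y := fun y hy =>
    (hP y hy).differentiableAt (by simp)
  have hCτ : 0 ≤ C * τ ^ k := (norm_nonneg _).trans (hC x hx k)
  have hΔ : ‖f^[k] x - f^[k] (P x)‖ ≤ C * τ ^ k * R := by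
    have := (convex_ball (0 : V) R).norm_image_sub_le_of_norm_fderiv_le (𝕜 := ℝ)
      (f := orbitDisplacement f P k)
      (fun y hy => (contDiffAt_orbitDisplacement hf (hP y hy) k).differentiableAt (by simp))
      (fun y hy => hC y hy k) (Metric.mem_ball_self hR) hx
    rw [orbitDisplacement_zero hP0, sub_zero, sub_zero] at this
    exact this.trans (mul_le_mul_of_nonneg_left (mem_ball_zero_iff.1 hx).le hCτ)
  have e : fderiv ℝ (orbitDisplacement f P (k + 1)) x
        - A.comp (fderiv ℝ (orbitDisplacement f P k) x)
      = (fderiv ℝ f (f^[k] x) - A).comp (fderiv ℝ (orbitDisplacement f P k) x)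
        + (fderiv ℝ f (f^[k] x) - fderiv ℝ f (f^[k] (P x))).comp
          ((fderiv ℝ f^[k] (P x)).comp (fderiv ℝ P x)) := by
    rw [fderiv_orbitDisplacement hf (hd x hx), fderiv_orbitDisplacement hf (hd x hx),
      hf.fderiv_iterate_succ, hf.fderiv_iterate_succ]
    ext v
    simp
    abel
  have h1 : ‖fderiv ℝ f (f^[k] x) - A‖ ≤ M * (l ^ k * R) := by
    rw [← hf.fderiv_zero]
    refine (hf.lipschitz _ _).trans ?_
    rw [sub_zero]
    have := hf.norm_iterate_le k x
    have hx' := (mem_ball_zero_iff.1 hx).le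
    gcongr
    exact this.trans (by gcongr)
  have h2 : ‖fderiv ℝ f (f^[k] x) - fderiv ℝ f (f^[k] (P x))‖ ≤ M * (C * τ ^ k * R) :=
    (hf.lipschitz _ _).trans (by gcongr)
  have h3 : ‖(fderiv ℝ f^[k] (P x)).comp (fderiv ℝ P x)‖ ≤ l ^ k * L :=
    (ContinuousLinearMap.opNorm_comp_le _ _).trans
      (mul_le_mul (hf.norm_fderiv_iterate_le k _) (hL x hx) (norm_nonneg _) (by positivity))
  rw [e]
  calc _ ≤ M * (l ^ k * R) * (C * τ ^ k) + M * (C * τ ^ k * R) * (l ^ k * L) := by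
        refine (norm_add_le _ _).trans (add_le_add ?_ ?_)
        · exact (ContinuousLinearMap.opNorm_comp_le _ _).trans
            (mul_le_mul h1 (hC x hx k) (norm_nonneg _) (by positivity))
        · exact (ContinuousLinearMap.opNorm_comp_le _ _).trans
            (mul_le_mul h2 h3 (norm_nonneg _) (by positivity))
    _ = _ := by
        rw [mul_pow]
        ring

end Iteration

/-! ### Decay rates of almost invariant sequences -/

section Splitting

variable {V : Type*} [NormedAddCommGroup V] [NormedSpace ℝ V]

theorem pow_mul_norm_symm_pow_le (A : V ≃L[ℝ] V) (p : V →L[ℝ] V)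
    (hAp : ∀ x, p (A x) = A (p x)) {a : ℝ} (ha : 0 < a) (hslow : ∀ v, a * ‖p v‖ ≤ ‖A (p v)‖)
    (k : ℕ) (v : V) (hv : p v = v) : a ^ k * ‖((A.symm : V →L[ℝ] V) ^ k) v‖ ≤ ‖v‖ := by
  have hAp' : ∀ x, p (A.symm x) = A.symm (p x) := fun x => by
    apply A.injective
    rw [← hAp, A.apply_symm_apply, A.apply_symm_apply]
  induction k generalizing v with
  | zero => simp
  | succ k ih =>
    have h1 := ih (A.symm v) (by rw [hAp', hv])
    have h2 := hslow (A.symm v)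
    rw [hAp', hv, A.apply_symm_apply] at h2
    calc a ^ (k + 1) * ‖((A.symm : V →L[ℝ] V) ^ (k + 1)) v‖
        = a * (a ^ k * ‖((A.symm : V →L[ℝ] V) ^ k) (A.symm v)‖) := by
          rw [pow_succ, pow_succ]
          simp only [mul_apply_eq_comp, ContinuousLinearEquiv.coe_coe]
          ring
      _ ≤ a * ‖A.symm v‖ := by gcongr
      _ ≤ ‖v‖ := h2

theorem norm_symm_pow_comp_le (A : V ≃L[ℝ] V) (p : V →L[ℝ] V)
    (hAp : ∀ x, p (A x) = A (p x)) {a : ℝ} (ha : 0 < a) (hslow : ∀ v, a * ‖p v‖ ≤ ‖A (p v)‖)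
    (k : ℕ) (E : V →L[ℝ] V) (hE : ∀ v, p (E v) = E v) :
    ‖(A.symm : V →L[ℝ] V) ^ k * E‖ ≤ ‖E‖ / a ^ k := by
  refine ContinuousLinearMap.opNorm_le_bound _ (by positivity) fun v => ?_
  have h := pow_mul_norm_symm_pow_le A p hAp ha hslow k (E v) (hE v)
  rw [mul_apply_eq_comp, div_mul_eq_mul_div, le_div_iff₀ (by positivity), mul_comm]
  exact h.trans (E.le_opNorm v)

theorem symm_pow_mul_pow (A : V ≃L[ℝ] V) (k : ℕ) :
    (A.symm : V →L[ℝ] V) ^ k * (A : V →L[ℝ] V) ^ k = 1 := by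
  have h : (A.symm : V →L[ℝ] V) * (A : V →L[ℝ] V) = 1 := by
    ext v
    simp
  have c : Commute (A.symm : V →L[ℝ] V) (A : V →L[ℝ] V) := by
    rw [Commute, SemiconjBy, h]
    ext v
    simp
  rw [← c.mul_pow, h, one_pow]

theorem pow_mul_symm_pow (A : V ≃L[ℝ] V) (k : ℕ) :
    (A : V →L[ℝ] V) ^ k * (A.symm : V →L[ℝ] V) ^ k = 1 := by
  have := symm_pow_mul_pow A.symm k
  simpa using this

/-- The slow component of an almost `A`-invariant sequence with no asymptotic slow part. -/
theorem norm_slow_component_le (A : V ≃L[ℝ] V) (p : V →L[ℝ] V) (hpp : ∀ x, p (p x) = p x)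
    (hAp : ∀ x, p (A x) = A (p x)) {a θ C : ℝ} (hθ : 0 ≤ θ) (hθa : θ < a)
    (hslow : ∀ v, a * ‖p v‖ ≤ ‖A (p v)‖) (e : ℕ → V →L[ℝ] V)
    (he : ∀ k, ‖e (k + 1) - (A : V →L[ℝ] V) * e k‖ ≤ C * θ ^ k)
    (hlim : Tendsto (fun k => (A.symm : V →L[ℝ] V) ^ k * p * e k) atTop (𝓝 0)) (k : ℕ) :
    ‖p * e k‖ ≤ ‖p‖ * C / (a - θ) * θ ^ k := by
  have ha : 0 < a := hθ.trans_lt hθa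
  have hcomm : p * (A : V →L[ℝ] V) = (A : V →L[ℝ] V) * p := by
    ext v
    exact hAp v
  set S : V →L[ℝ] V := (A.symm : V →L[ℝ] V) with hS
  have hSA : S * (A : V →L[ℝ] V) = 1 := by simpa using symm_pow_mul_pow A 1
  have hpow : ∀ i j, (A : V →L[ℝ] V) ^ i * S ^ (i + j) = S ^ j := by
    intro i j
    rw [pow_add, ← mul_assoc, pow_mul_symm_pow, one_mul]
  have hpos : 0 < a - θ := by linarith
  -- The rescaled slow parts `A^(-i) p e_(k+i)` have increments of ratio `θ / a < 1` and tend to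
  -- zero, so the initial one is bounded by the geometric sum of all increments.
  have hw : ∀ i, dist (S ^ i * p * e (k + i)) (S ^ (i + 1) * p * e (k + (i + 1)))
      ≤ ‖p‖ * C * θ ^ k / a * (θ / a) ^ i := by
    intro i
    have e1 : S ^ (i + 1) * p * e (k + (i + 1)) - S ^ i * p * e (k + i)
        = S ^ (i + 1) * p * (e (k + i + 1) - (A : V →L[ℝ] V) * e (k + i)) := by
      have : S ^ (i + 1) * p * ((A : V →L[ℝ] V) * e (k + i)) = S ^ i * p * e (k + i) := by
        calc _ = S ^ i * (S * ((p * (A : V →L[ℝ] V)) * e (k + i))) := by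
              rw [pow_succ]
              simp only [mul_assoc]
          _ = S ^ i * ((S * (A : V →L[ℝ] V)) * (p * e (k + i))) := by
              rw [hcomm]
              simp only [mul_assoc]
          _ = _ := by rw [hSA, one_mul, mul_assoc]
      rw [mul_sub, this, add_assoc]
    rw [dist_comm, dist_eq_norm, e1]
    calc _ ≤ ‖p‖ / a ^ (i + 1) * (C * θ ^ (k + i)) :=
          (norm_mul_le _ _).trans (mul_le_mul
            (norm_symm_pow_comp_le A p hAp ha hslow (i + 1) p hpp) (he _) (norm_nonneg _)
            (by positivity))
      _ = _ := by
          rw [div_pow, pow_add θ]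
          field_simp
          ring
  have hlim' : Tendsto (fun i => S ^ i * p * e (k + i)) atTop (𝓝 0) := by
    have h1 : Tendsto (fun i => (A : V →L[ℝ] V) ^ k * (S ^ (k + i) * p * e (k + i))) atTop
        (𝓝 ((A : V →L[ℝ] V) ^ k * 0)) :=
      ((tendsto_const_nhds (x := (A : V →L[ℝ] V) ^ k)).mul
        (hlim.comp (tendsto_add_atTop_nat k))).congr fun i => by
          simp only [Function.comp_apply, add_comm i k]
    rw [mul_zero] at h1
    refine h1.congr fun i => ?_
    rw [← hpow k i]
    simp only [mul_assoc]
  have := dist_le_of_le_geometric_of_tendsto₀ (θ / a) _ ((div_lt_one ha).2 hθa) hw hlim'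
  rw [dist_zero_right, pow_zero, one_mul, add_zero] at this
  refine this.trans_eq ?_
  field_simp

theorem le_of_linear_recursion {y : ℕ → ℝ} {b K θ τ : ℝ} (hb : 0 ≤ b) (hK : 0 ≤ K)
    (hθ : 0 ≤ θ) (hθτ : θ ≤ τ) (hbτ : b < τ) (hy : ∀ k, y (k + 1) ≤ b * y k + K * θ ^ k) {Y : ℝ}
    (hY : y 0 ≤ Y) (k : ℕ) : y k ≤ max Y (K / (τ - b)) * τ ^ k := by
  have hpos : 0 < τ - b := by linarith
  set D := max Y (K / (τ - b))
  have hD : K ≤ D * (τ - b) := by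
    rw [← div_le_iff₀ hpos]
    exact le_max_right _ _
  induction k with
  | zero =>
    rw [pow_zero, mul_one]
    exact hY.trans (le_max_left _ _)
  | succ k ih =>
    calc y (k + 1) ≤ b * (D * τ ^ k) + D * (τ - b) * τ ^ k := by
          refine (hy k).trans ?_
          have : 0 ≤ τ := hθ.trans hθτ
          gcongr
      _ = D * τ ^ (k + 1) := by ring

/-- Families of almost `A`-invariant sequences without asymptotic slow part decay at the fast
rate. -/
theorem exists_fast_decay {ι : Type*} (A : V ≃L[ℝ] V) (π : V →L[ℝ] V) (hππ : ∀ x, π (π x) = π x)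
    (hAπ : ∀ x, π (A x) = A (π x)) {a b β β' l : ℝ} (hb : 0 ≤ b) (hl0 : 0 < l) (hl1 : l < 1)
    (hfast : ∀ v, ‖A (π v)‖ ≤ b * ‖π v‖)
    (hslow : ∀ v, a * ‖(1 - π) v‖ ≤ ‖A ((1 - π) v)‖)
    (hlβ : l * β < a) (hbβ' : b < β') (hβ'β : β' ≤ β)
    (e : ι → ℕ → V →L[ℝ] V)
    (hdefect : ∀ C τ, 0 < τ → (∀ i k, ‖e i k‖ ≤ C * τ ^ k) →
      ∃ C', ∀ i k, ‖e i (k + 1) - (A : V →L[ℝ] V) * e i k‖ ≤ C' * (l * τ) ^ k)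
    (hβ : ∃ C, ∀ i k, ‖e i k‖ ≤ C * β ^ k)
    (hlim : ∀ i, Tendsto (fun k => (A.symm : V →L[ℝ] V) ^ k * (1 - π) * e i k) atTop (𝓝 0)) :
    ∃ C, ∀ i k, ‖e i k‖ ≤ C * β' ^ k := by
  have hβ'0 : 0 < β' := hb.trans_lt hbβ'
  have hβ0 : 0 < β := hβ'0.trans_le hβ'β
  -- Bootstrap: from rate `τ` the defect has rate `l τ`. The slow part inherits `l τ` because its
  -- limit vanishes; the fast part, driven by the same defect, decays at any rate that is at least
  -- `l τ` and exceeds `b`. Each round gains a factor `l` until `β'` is reached.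
  have hstep : ∀ n : ℕ, ∃ C, ∀ i k, ‖e i k‖ ≤ C * (max β' (l ^ n * β)) ^ k := by
    intro n
    induction n with
    | zero =>
      obtain ⟨C, hC⟩ := hβ
      refine ⟨C, fun i k => ?_⟩
      rw [pow_zero, one_mul, max_eq_right hβ'β]
      exact hC i k
    | succ n ih =>
      obtain ⟨C, hC⟩ := ih
      set τ := max β' (l ^ n * β) with hτ
      set τ' := max β' (l ^ (n + 1) * β) with hτ'
      have hτ0 : 0 < τ := lt_max_of_lt_left hβ'0
      have hτβ : τ ≤ β :=
        max_le hβ'β (mul_le_of_le_one_left hβ0.le (pow_le_one₀ hl0.le hl1.le))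
      obtain ⟨C', hC'⟩ := hdefect C τ hτ0 hC
      have hlτ : l * τ < a := (mul_le_mul_of_nonneg_left hτβ hl0.le).trans_lt hlβ
      have hlττ' : l * τ ≤ τ' := by
        rw [hτ, mul_max_of_nonneg _ _ hl0.le, ← mul_assoc, ← pow_succ']
        exact max_le_max (mul_le_of_le_one_left hβ'0.le hl1.le) le_rfl
      have hbτ' : b < τ' := hbβ'.trans_le (le_max_left _ _)
      have hlτ0 : 0 ≤ l * τ := by positivity
      rcases isEmpty_or_nonempty ι with hι | ⟨⟨i₀⟩⟩
      · exact ⟨0, fun i => (hι.false i).elim⟩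
      have hC'0 : 0 ≤ C' := by simpa using (norm_nonneg _).trans (hC' i₀ 0)
      have hpp : ∀ x, (1 - π) ((1 - π) x) = (1 - π) x := fun x => by simp [hππ]
      have hAp : ∀ x, (1 - π) (A x) = A ((1 - π) x) := fun x => by simp [hAπ]
      refine ⟨‖(1 - π)‖ * C' / (a - l * τ) + max (‖π‖ * C) (‖π‖ * C' / (τ' - b)), fun i k => ?_⟩
      have h1 := norm_slow_component_le A (1 - π) hpp hAp hlτ0 hlτ hslow (e i) (hC' i) (hlim i) k
      have h2 : ‖π * e i k‖ ≤ max (‖π‖ * C) (‖π‖ * C' / (τ' - b)) * τ' ^ k := by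
        refine le_of_linear_recursion (y := fun k => ‖π * e i k‖) hb (by positivity) hlτ0 hlττ' hbτ'
          (fun k => ?_) ?_ k
        · have e1 : π * e i (k + 1) = (A : V →L[ℝ] V) * (π * e i k)
              + π * (e i (k + 1) - (A : V →L[ℝ] V) * e i k) := by
            ext v
            simp [hAπ]
          rw [e1]
          refine (norm_add_le _ _).trans (add_le_add ?_ ?_)
          · refine ContinuousLinearMap.opNorm_le_bound _ (by positivity) fun v => ?_
            rw [mul_assoc]
            exact (hfast _).trans (mul_le_mul_of_nonneg_left ((π * e i k).le_opNorm v) hb)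
          · rw [mul_assoc]
            exact (norm_mul_le _ _).trans (mul_le_mul_of_nonneg_left (hC' i k) (norm_nonneg _))
        · have := hC i 0
          rw [pow_zero, mul_one] at this
          exact (norm_mul_le _ _).trans (mul_le_mul_of_nonneg_left this (norm_nonneg _))
      have e2 : e i k = (1 - π) * e i k + π * e i k := by
        rw [sub_mul, one_mul, sub_add_cancel]
      have hpos : 0 < a - l * τ := by linarith
      rw [e2, add_mul]
      refine (norm_add_le _ _).trans (add_le_add (h1.trans ?_) h2)
      gcongr
  have ht : Tendsto (fun n : ℕ => l ^ n * β) atTop (𝓝 0) := by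
    simpa using (tendsto_pow_atTop_nhds_zero_of_lt_one hl0.le hl1).mul_const β
  obtain ⟨n, hn⟩ := (ht.eventually_lt_const hβ'0).exists
  have := hstep n
  rwa [max_eq_left hn.le] at this

end Splitting

/-! ### Linearizing the next spectral block -/

section PartialLinearization

variable {V : Type*} [NormedAddCommGroup V] [NormedSpace ℝ V]

/-- Near the fixed point `0`, the map `Φ` linearizes the quotient of `f` by the fast directions
`range π`, and `σ ∘ Φ` is a retraction onto a slow invariant manifold, whose orbits shadow those of
`f` at the rate `β`. -/
structure IsPartialLinearization (f : V → V) (A : V ≃L[ℝ] V) (π : V →L[ℝ] V) (β : ℝ)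
    (Φ σ : V → V) : Prop where
  contDiffAt : ContDiffAt ℝ 1 Φ 0
  map_zero : Φ 0 = 0
  hasFDerivAt : HasFDerivAt Φ (1 - π) 0
  proj : ∀ᶠ x in 𝓝 0, π (Φ x) = 0
  semiconj : ∀ᶠ x in 𝓝 0, Φ (f x) = A (Φ x)
  contDiffAt_retraction : ContDiffAt ℝ 1 (σ ∘ Φ) 0
  section_zero : σ 0 = 0
  hasFDerivAt_retraction : HasFDerivAt (σ ∘ Φ) (1 - π) 0
  comm : ∀ᶠ x in 𝓝 0, σ (Φ (f x)) = f (σ (Φ x))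
  decay : ∃ C, ∀ᶠ x in 𝓝 0, ∀ k, ‖fderiv ℝ (orbitDisplacement f (σ ∘ Φ) k) x‖ ≤ C * β ^ k
  slow_limit : ∀ᶠ x in 𝓝 0, Tendsto (fun k => (A.symm : V →L[ℝ] V) ^ k * (1 - π) *
    fderiv ℝ (orbitDisplacement f (σ ∘ Φ) k) x) atTop (𝓝 0)

theorem exists_local_inverse [CompleteSpace V] {Ψ : V → V} (h : ContDiffAt ℝ 1 Ψ 0)
    (h0 : Ψ 0 = 0) (hd : HasFDerivAt Ψ (ContinuousLinearMap.id ℝ V) 0) :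
    ∃ κ : V → V, ContDiffAt ℝ 1 κ 0 ∧ κ 0 = 0 ∧ HasFDerivAt κ (ContinuousLinearMap.id ℝ V) 0 ∧
      (∀ᶠ x in 𝓝 0, κ (Ψ x) = x) ∧ ∀ᶠ y in 𝓝 0, Ψ (κ y) = y := by
  have hd' : HasFDerivAt Ψ ((ContinuousLinearEquiv.refl ℝ V : V ≃L[ℝ] V) : V →L[ℝ] V) 0 := hd
  have hs : HasStrictFDerivAt Ψ ((ContinuousLinearEquiv.refl ℝ V : V ≃L[ℝ] V) : V →L[ℝ] V) 0 :=
    h.hasStrictFDerivAt' hd' (by simp)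
  refine ⟨hs.localInverse, ?_, ?_, ?_, ?_, ?_⟩
  · have := h.to_localInverse hd' (by simp)
    rwa [h0] at this
  · have := hs.localInverse_apply_image
    rwa [h0] at this
  · have := hs.to_localInverse.hasFDerivAt
    rw [h0] at this
    exact this
  · exact hs.eventually_left_inverse
  · have := hs.eventually_right_inverse
    rwa [h0] at this

variable {f : V → V} {A : V ≃L[ℝ] V} {l M : ℝ} {π π' : V →L[ℝ] V} {β : ℝ} {Φ σ : V → V}

theorem IsPartialLinearization.exists_radius (h : IsPartialLinearization f A π β Φ σ) :
    ∃ R > 0, ∃ C L, ∀ x ∈ Metric.ball (0 : V) R, ContDiffAt ℝ 1 (σ ∘ Φ) x ∧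
      ‖fderiv ℝ (σ ∘ Φ) x‖ ≤ L ∧ σ (Φ (f x)) = f (σ (Φ x)) ∧
      (∀ k, ‖fderiv ℝ (orbitDisplacement f (σ ∘ Φ) k) x‖ ≤ C * β ^ k) ∧
      Tendsto (fun k => (A.symm : V →L[ℝ] V) ^ k * (1 - π) *
        fderiv ℝ (orbitDisplacement f (σ ∘ Φ) k) x) atTop (𝓝 0) := by
  obtain ⟨C, hC⟩ := h.decay
  have h1 := h.contDiffAt_retraction.eventually (by simp)
  have h2 : ∀ᶠ x in 𝓝 (0 : V), ‖fderiv ℝ (σ ∘ Φ) x‖ ≤ ‖fderiv ℝ (σ ∘ Φ) 0‖ + 1 :=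
    ((h.contDiffAt_retraction.continuousAt_fderiv (by simp)).norm.eventually_lt_const
      (lt_add_one _)).mono fun x hx => le_of_lt hx
  obtain ⟨R, hR, hb⟩ := Metric.eventually_nhds_iff_ball.1
    (h1.and (h2.and (h.comm.and (hC.and h.slow_limit))))
  exact ⟨R, hR, C, _, hb⟩

/-- The linearizing coordinate in the directions `range (π - π')`. -/
theorem IsPartialLinearization.exists_next_component [CompleteSpace V]
    (hf : IsSmoothContraction f (A : V →L[ℝ] V) l M) (h : IsPartialLinearization f A π β Φ σ)
    (hππ : π * π = π) (hπ'π' : π' * π' = π') (hππ' : π * π' = π') (hπ'π : π' * π = π')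
    (hAπ : π * (A : V →L[ℝ] V) = (A : V →L[ℝ] V) * π)
    (hAπ' : π' * (A : V →L[ℝ] V) = (A : V →L[ℝ] V) * π') {a : ℝ} (ha : 0 < a) (hβ : 0 < β)
    (hslow : ∀ v, a * ‖(1 - π') v‖ ≤ ‖A ((1 - π') v)‖) (hlβ : l * β < a) :
    ∃ ψ : V → V, ContDiffAt ℝ 1 ψ 0 ∧ ψ 0 = 0 ∧ HasFDerivAt ψ (π - π') 0 ∧
      (∀ᶠ x in 𝓝 0, (π - π') (ψ x) = ψ x) ∧ (∀ᶠ x in 𝓝 0, ψ (f x) = A (ψ x)) ∧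
      ∀ᶠ x in 𝓝 0, Tendsto (fun k => (A.symm : V →L[ℝ] V) ^ k * (π - π') *
        fderiv ℝ (orbitDisplacement f (σ ∘ Φ) k) x) atTop (𝓝 (fderiv ℝ ψ x)) := by
  obtain ⟨R, hR, C, L, hball⟩ := h.exists_radius
  set P := σ ∘ Φ with hP
  have hP0 : P 0 = 0 := by simp [hP, h.map_zero, h.section_zero]
  set E : V →L[ℝ] V := π - π' with hE
  set S : V →L[ℝ] V := (A.symm : V →L[ℝ] V) with hS
  have hEE : E * E = E := by
    rw [hE, sub_mul, mul_sub, mul_sub, hππ, hππ', hπ'π, hπ'π', sub_self, sub_zero]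
  have hAE : E * (A : V →L[ℝ] V) = (A : V →L[ℝ] V) * E := by
    rw [hE, sub_mul, mul_sub, hAπ, hAπ']
  have hSA : S * (A : V →L[ℝ] V) = 1 := by simpa using symm_pow_mul_pow A 1
  have hAS : (A : V →L[ℝ] V) * S = 1 := by simpa using pow_mul_symm_pow A 1
  have hSE : Commute E S := by
    calc E * S = (S * (A : V →L[ℝ] V)) * (E * S) := by rw [hSA, one_mul]
      _ = S * (E * (A : V →L[ℝ] V)) * S := by rw [hAE]; simp only [mul_assoc]
      _ = S * E := by rw [mul_assoc, mul_assoc, hAS, mul_one]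
  have hpE : ∀ v, (1 - π') (E v) = E v := by
    intro v
    have : (1 - π') * E = E := by
      rw [hE, sub_mul, one_mul, mul_sub, hπ'π, hπ'π', sub_self, sub_zero]
    exact DFunLike.congr_fun this v
  have hAp : ∀ x, (1 - π') (A x) = A ((1 - π') x) := by
    intro x
    have := DFunLike.congr_fun hAπ' x
    simp only [mul_apply_eq_comp, ContinuousLinearEquiv.coe_coe] at this
    simp [this]
  have hT : ∀ k, ‖S ^ k * E‖ ≤ ‖E‖ / a ^ k := fun k =>
    norm_symm_pow_comp_le A (1 - π') hAp ha hslow k E hpE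
  have hshift : ∀ k, S ^ (k + 1) * E * (A : V →L[ℝ] V) = S ^ k * E := by
    intro k
    rw [mul_assoc, hAE, ← mul_assoc, pow_succ, mul_assoc (S ^ k), hSA, mul_one]
  have hshift' : ∀ k, (A : V →L[ℝ] V) * (S ^ (k + 1) * E) = S ^ k * E := by
    intro k
    rw [pow_succ', ← mul_assoc, ← mul_assoc, hAS, one_mul]
  have hΔd : ∀ k, ∀ x ∈ Metric.ball (0 : V) R, ContDiffAt ℝ 1 (orbitDisplacement f P k) x :=
    fun k x hx => contDiffAt_orbitDisplacement hf (hball x hx).1 k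
  -- The rescaled `E`-components of the displacement. By `hshift`, an increment of the derivatives
  -- sees only the defect: `a^(-k)` from the rescaling against `(l β)^k`.
  let u : ℕ → V → V := fun k x => (S ^ k * E) (orbitDisplacement f P k x)
  have hu : ∀ k, ∀ x ∈ Metric.ball (0 : V) R, ContDiffAt ℝ 1 (u k) x := fun k x hx =>
    (S ^ k * E).contDiff.contDiffAt.comp x (hΔd k x hx)
  have hu' : ∀ k, ∀ x ∈ Metric.ball (0 : V) R,
      fderiv ℝ (u k) x = S ^ k * E * fderiv ℝ (orbitDisplacement f P k) x := fun k x hx =>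
    ((S ^ k * E).hasFDerivAt.comp x
      ((hΔd k x hx).differentiableAt (by simp)).hasFDerivAt).fderiv
  have hu0 : ∀ k, u k 0 = 0 := fun k => by
    simp only [u, orbitDisplacement_zero hP0, _root_.map_zero]
  have hdefect := norm_fderiv_orbitDisplacement_defect_le (R := R) hf (fun x hx => (hball x hx).1)
    hP0 (fun x hx => (hball x hx).2.1) (fun x hx => (hball x hx).2.2.2.1)
  have hl := hf.pos
  have hstep : ∀ k, ∀ x ∈ Metric.ball (0 : V) R,
      ‖fderiv ℝ (u (k + 1)) x - fderiv ℝ (u k) x‖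
        ≤ ‖E‖ * (M * R * C * (1 + L)) / a * (l * β / a) ^ k := by
    intro k x hx
    have e1 : fderiv ℝ (u (k + 1)) x - fderiv ℝ (u k) x = S ^ (k + 1) * E *
        (fderiv ℝ (orbitDisplacement f P (k + 1)) x
          - (A : V →L[ℝ] V) * fderiv ℝ (orbitDisplacement f P k) x) := by
      rw [hu' _ x hx, hu' _ x hx, mul_sub (S ^ (k + 1) * E),
        ← mul_assoc (S ^ (k + 1) * E), hshift]
    rw [e1]
    calc _ ≤ ‖E‖ / a ^ (k + 1) * (M * R * C * (1 + L) * (l * β) ^ k) :=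
          (norm_mul_le _ _).trans (mul_le_mul (hT _) (hdefect x hx k) (norm_nonneg _)
            (by positivity))
      _ = _ := by
          rw [div_pow]
          field_simp
          ring
  obtain ⟨ψ, hψ1, hψ2⟩ := exists_contDiffOn_limit u
    (fun k x hx => (hu k x hx).contDiffWithinAt) hu0 ((div_lt_one ha).2 hlβ) hstep
  have h0 : (0 : V) ∈ Metric.ball (0 : V) R := Metric.mem_ball_self hR
  have hmem : Metric.ball (0 : V) R ∈ 𝓝 (0 : V) := Metric.ball_mem_nhds 0 hR
  have hψc : ContDiffAt ℝ 1 ψ 0 := hψ1.contDiffAt hmem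
  refine ⟨ψ, hψc, ?_, ?_, ?_, ?_, ?_⟩
  · have := (hψ2 0 h0).1
    simp only [hu0] at this
    exact (tendsto_nhds_unique this tendsto_const_nhds)
  · have h1 := (hψ2 0 h0).2
    -- At `0` the displacement has derivative `A^k - A^k (1 - π) = A^k π`, and `A^(-k) E A^k π = E π
    -- = E`.
    have h2 : ∀ k, fderiv ℝ (u k) 0 = E := by
      intro k
      rw [hu' k 0 h0, fderiv_orbitDisplacement hf ((hball 0 h0).1.differentiableAt (by simp)), hP0,
        hf.fderiv_iterate_zero, h.hasFDerivAt_retraction.fderiv]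
      change S ^ k * E * ((A : V →L[ℝ] V) ^ k - (A : V →L[ℝ] V) ^ k * (1 - π)) = E
      have c1 : Commute E ((A : V →L[ℝ] V) ^ k) := Commute.pow_right hAE k
      have e1 : E * π = E := by rw [hE, sub_mul, hππ, hπ'π]
      have e2 : (A : V →L[ℝ] V) ^ k - (A : V →L[ℝ] V) ^ k * (1 - π) = (A : V →L[ℝ] V) ^ k * π := by
        rw [mul_sub, mul_one, sub_sub_cancel]
      rw [e2, ← mul_assoc, mul_assoc (S ^ k), c1.eq, ← mul_assoc,
        symm_pow_mul_pow, one_mul, e1]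
    simp only [h2] at h1
    have h3 := tendsto_nhds_unique h1 tendsto_const_nhds
    rw [← h3]
    exact (hψc.differentiableAt (by simp)).hasFDerivAt
  · filter_upwards [hmem] with x hx
    have h1 := (hψ2 x hx).1
    refine tendsto_nhds_unique ((E.continuous.tendsto _).comp h1) (h1.congr fun k => ?_)
    have : E * (S ^ k * E) = S ^ k * E := by
      rw [← mul_assoc, (hSE.pow_right k).eq, mul_assoc, hEE]
    exact (DFunLike.congr_fun this _).symm
  · filter_upwards [hmem] with x hx
    have h1 := (hψ2 (f x) (hf.mem_ball hx)).1
    have h2 := ((A.continuous.tendsto _).comp ((hψ2 x hx).1.comp (tendsto_add_atTop_nat 1)))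
    refine tendsto_nhds_unique h1 (h2.congr fun k => ?_)
    -- Since `P` commutes with `f`, moving from `x` to `f x` only shifts the index; in the limit
    -- this is the conjugacy relation for `ψ`.
    have e1 : orbitDisplacement f P k (f x) = orbitDisplacement f P (k + 1) x := by
      have : P (f x) = f (P x) := (hball x hx).2.2.1
      simp only [orbitDisplacement, this, Function.iterate_succ_apply]
    change A ((S ^ (k + 1) * E) (orbitDisplacement f P (k + 1) x)) =
      (S ^ k * E) (orbitDisplacement f P k (f x))
    rw [e1, ← hshift' k]
    rfl
  · filter_upwards [hmem] with x hx
    exact (hψ2 x hx).2.congr fun k => hu' k x hx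

end PartialLinearization

/-! ### The induction step -/

section Step

variable {V : Type*} [NormedAddCommGroup V] [NormedSpace ℝ V] [FiniteDimensional ℝ V]
variable {f : V → V} {A : V ≃L[ℝ] V} {l M : ℝ} {π π' : V →L[ℝ] V} {β : ℝ} {Φ σ : V → V}

/-- A linearization of the slow quotient can be inverted along a slow invariant manifold. -/
theorem exists_slow_section (hf : IsSmoothContraction f (A : V →L[ℝ] V) l M)
    (hππ : π * π = π) (hAπ : π * (A : V →L[ℝ] V) = (A : V →L[ℝ] V) * π) {a b : ℝ}
    (ha : 0 < a) (hb : 0 ≤ b) (hba : b < a) (hfast : ∀ v, ‖A (π v)‖ ≤ b * ‖π v‖)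
    (hslow : ∀ v, a * ‖(1 - π) v‖ ≤ ‖A ((1 - π) v)‖)
    (hΦ : ContDiffAt ℝ 1 Φ 0) (hΦ0 : Φ 0 = 0) (hΦd : HasFDerivAt Φ (1 - π) 0)
    (hπΦ : ∀ᶠ x in 𝓝 0, π (Φ x) = 0) (hsemi : ∀ᶠ x in 𝓝 0, Φ (f x) = A (Φ x)) :
    ∃ σ : V → V, ContDiffAt ℝ 1 σ 0 ∧ σ 0 = 0 ∧ HasFDerivAt σ (1 - π) 0 ∧
      (∀ᶠ x in 𝓝 0, Φ (σ (Φ x)) = Φ x) ∧ ∀ᶠ x in 𝓝 0, σ (Φ (f x)) = f (σ (Φ x)) := by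
  have := FiniteDimensional.complete ℝ V
  have hππ' : ∀ v, π (π v) = π v := fun v => DFunLike.congr_fun hππ v
  have hAπ' : ∀ v, π (A v) = A (π v) := fun v => DFunLike.congr_fun hAπ v
  -- Completing `Φ` by the fast coordinates `π` gives a local chart tangent to the identity.
  set Ψ : V → V := fun x => Φ x + π x with hΨ
  have hΨd : HasFDerivAt Ψ (ContinuousLinearMap.id ℝ V) 0 := by
    have := hΦd.add π.hasFDerivAt
    rwa [sub_add_cancel] at this
  obtain ⟨κ, hκ, hκ0, hκd, hκΨ, hΨκ⟩ := exists_local_inverse (hΦ.add π.contDiff.contDiffAt)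
    (by simp [hΦ0]) hΨd
  have hfκ : HasFDerivAt (fun w => π (f (κ w))) (π.comp ((A : V →L[ℝ] V).comp
      (ContinuousLinearMap.id ℝ V))) 0 := by
    refine π.hasFDerivAt.comp 0 (HasFDerivAt.comp (g := f) 0 ?_ hκd)
    rw [hκ0, ← hf.fderiv_zero]
    exact (hf.differentiable 0).hasFDerivAt
  -- In this chart the slow component of `f` is already linear by the semiconjugacy, so `f` reads `A
  -- + r₀` with `r₀` valued in the fast directions. This is the form that `exists_slow_manifold`
  -- needs.
  set r₀ : V → V := fun w => π (f (κ w)) - π (A w) with hr₀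
  have hr₀d : fderiv ℝ r₀ 0 = 0 := by
    have h1 : HasFDerivAt (fun w => π (A w)) (π.comp (A : V →L[ℝ] V)) 0 :=
      π.hasFDerivAt.comp 0 A.hasFDerivAt
    have := (hfκ.sub h1).fderiv
    rw [ContinuousLinearMap.comp_id, sub_self] at this
    exact this
  have hr₀c : ContDiffAt ℝ (1 : ℕ) r₀ 0 := by
    have h1 : ContDiffAt ℝ 1 (fun w => π (f (κ w))) 0 :=
      π.contDiff.contDiffAt.comp 0 (hf.contDiff.contDiffAt.comp 0 hκ)
    have h2 : ContDiff ℝ 1 (fun w => π (A w)) := π.contDiff.comp A.contDiff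
    exact_mod_cast h1.sub h2.contDiffAt
  have hr₀0 : r₀ 0 = 0 := by simp [hr₀, hκ0, hf.map_zero]
  obtain ⟨χ, hχc, hχ1, hχε, hχs⟩ := exists_cutoff one_ne_zero hr₀c hr₀0 hr₀d
    (ε := (a - b) / 2) (by linarith)
  set r : V → V := fun w => χ w • r₀ w with hr
  have hrr₀ : r =ᶠ[𝓝 0] r₀ := by
    filter_upwards [hχ1] with w hw
    rw [hr]
    simp [hw]
  have hrπ : ∀ w, (1 - π) (r w) = 0 := by
    intro w
    simp [hr, hr₀, hππ']
  obtain ⟨R, hR⟩ := hχs.isCompact.isBounded.exists_norm_le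
  have hsupp : ∀ w, R + 1 ≤ ‖w‖ → r w = 0 := by
    intro w hw
    by_contra hne
    have := hR w (subset_tsupport _ hne)
    linarith
  have hAl : ∀ v, ‖A v‖ ≤ l * ‖v‖ := by
    intro v
    have h1 := (A : V →L[ℝ] V).le_opNorm v
    have h2 := hf.norm_fderiv_le 0
    rw [hf.fderiv_zero] at h2
    exact h1.trans (by gcongr)
  obtain ⟨s, hs, hsd, hs0, hps, hsA⟩ := exists_slow_manifold A (1 - π)
    (fun x => by simp [hππ']) (fun x => by simp [hAπ']) (by exact_mod_cast hχc)
    (by simp [hr, hr₀0]) (hrr₀.fderiv_eq.trans hr₀d) hrπ hsupp ha hb (by linarith) hχε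
    (fun v hv => by
      have : π v = v := by
        have h : v - π v = 0 := hv
        rw [sub_eq_zero] at h
        exact h.symm
      have h := hfast v
      rwa [this] at h) hslow (by linarith) hf.pos.le hf.lt_one hAl
  have hΦt : Tendsto Φ (𝓝 0) (𝓝 0) := by
    have := hΦ.continuousAt.tendsto
    rwa [hΦ0] at this
  have hκt : Tendsto κ (𝓝 0) (𝓝 0) := by
    have := hκ.continuousAt.tendsto
    rwa [hκ0] at this
  have hst : Tendsto s (𝓝 0) (𝓝 0) := by
    have := hs.continuous.tendsto 0
    rwa [hs0] at this
  have hΦκ : ∀ᶠ w in 𝓝 0, Φ (κ w) = (1 - π) w := by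
    filter_upwards [hΨκ, hκt.eventually hπΦ] with w h1 h2
    conv_rhs => rw [← h1]
    simp [h2, hππ']
  have hFκ : ∀ᶠ w in 𝓝 0, κ (A w + r w) = f (κ w) := by
    filter_upwards [hΦκ, hκt.eventually hsemi, (hf.tendsto_zero.comp hκt).eventually hκΨ, hrr₀]
      with w h1 h2 h3 h4
    have h3' : κ (Ψ (f (κ w))) = f (κ w) := h3
    rw [← h3']
    congr 1
    simp only [hΨ]
    rw [h2, h1, h4]
    simp [hr₀, hAπ']
    abel
  refine ⟨κ ∘ s, ?_, by simp [hs0, hκ0], ?_, ?_, ?_⟩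
  · refine ContDiffAt.comp 0 ?_ hs.contDiffAt
    rwa [hs0]
  · have := HasFDerivAt.comp (g := κ) 0 (by rwa [hs0]) hsd
    rwa [ContinuousLinearMap.id_comp] at this
  · filter_upwards [(hst.comp hΦt).eventually hΦκ, hπΦ] with x h1 h2
    simp only [Function.comp_apply] at h1 ⊢
    rw [h1, hps]
    simp [h2]
  · filter_upwards [(hst.comp hΦt).eventually hFκ, hsemi] with x h1 h2
    simp only [Function.comp_apply] at h1 ⊢
    rw [h2, hsA, h1]

/-- A partial linearization extends across the next spectral block. -/
theorem IsPartialLinearization.exists_refinement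
    (hf : IsSmoothContraction f (A : V →L[ℝ] V) l M) (h : IsPartialLinearization f A π β Φ σ)
    (hππ : π * π = π) (hπ'π' : π' * π' = π') (hππ' : π * π' = π') (hπ'π : π' * π = π')
    (hAπ : π * (A : V →L[ℝ] V) = (A : V →L[ℝ] V) * π)
    (hAπ' : π' * (A : V →L[ℝ] V) = (A : V →L[ℝ] V) * π') {a b β' : ℝ} (hb : 0 ≤ b)
    (hbβ' : b < β') (hβ'β : β' ≤ β) (hba : b < a) (hlβ : l * β < a)
    (hfast : ∀ v, ‖A (π' v)‖ ≤ b * ‖π' v‖)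
    (hslow : ∀ v, a * ‖(1 - π') v‖ ≤ ‖A ((1 - π') v)‖) :
    ∃ Φ' σ' : V → V, IsPartialLinearization f A π' β' Φ' σ' := by
  have := FiniteDimensional.complete ℝ V
  have ha : 0 < a := hb.trans_lt hba
  have hβ0 : 0 < β := (hb.trans_lt hbβ').trans_le hβ'β
  obtain ⟨ψ, hψ, hψ0, hψd, hψE, hψf, hψlim⟩ :=
    h.exists_next_component hf hππ hπ'π' hππ' hπ'π hAπ hAπ' ha hβ0 hslow hlβ
  have a1 : ∀ v, π (π v) = π v := fun v => DFunLike.congr_fun hππ v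
  have a2 : ∀ v, π' (π' v) = π' v := fun v => DFunLike.congr_fun hπ'π' v
  have a3 : ∀ v, π (π' v) = π' v := fun v => DFunLike.congr_fun hππ' v
  have a4 : ∀ v, π' (π v) = π' v := fun v => DFunLike.congr_fun hπ'π v
  set Φ' : V → V := fun x => Φ x + ψ x with hΦ'
  have hΦ'c : ContDiffAt ℝ 1 Φ' 0 := h.contDiffAt.add hψ
  have hΦ'0 : Φ' 0 = 0 := by simp [hΦ', h.map_zero, hψ0]
  have hΦ'd : HasFDerivAt Φ' (1 - π') 0 := by
    have := h.hasFDerivAt.add hψd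
    rwa [sub_add_sub_cancel] at this
  have hπ'Φ' : ∀ᶠ x in 𝓝 0, π' (Φ' x) = 0 := by
    filter_upwards [h.proj, hψE] with x h1 h2
    rw [hΦ']
    simp only
    rw [map_add, ← a4 (Φ x), h1, ← h2]
    simp [a2, a4]
  have hsemi : ∀ᶠ x in 𝓝 0, Φ' (f x) = A (Φ' x) := by
    filter_upwards [h.semiconj, hψf] with x h1 h2
    simp only [hΦ']
    rw [h1, h2, map_add]
  obtain ⟨σ', hσ', hσ'0, hσ'd, hsec, hcomm⟩ := exists_slow_section hf hπ'π' hAπ' ha hb hba hfast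
    hslow hΦ'c hΦ'0 hΦ'd hπ'Φ' hsemi
  set P := σ ∘ Φ with hP
  set P' := σ' ∘ Φ' with hP'
  have hP'0 : P' 0 = 0 := by simp [hP', hΦ'0, hσ'0]
  have hP'c : ContDiffAt ℝ 1 P' 0 := by
    have h0 : ContDiffAt ℝ 1 σ' (Φ' 0) := by rwa [hΦ'0]
    exact h0.comp 0 hΦ'c
  have hP't : Tendsto P' (𝓝 0) (𝓝 0) := by
    have := hP'c.continuousAt.tendsto
    rwa [hP'0] at this
  have hP'd : HasFDerivAt P' (1 - π') 0 := by
    have h0 : HasFDerivAt σ' (1 - π') (Φ' 0) := by rwa [hΦ'0]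
    have h1 := h0.comp 0 hΦ'd
    have e : (1 - π').comp (1 - π') = 1 - π' := by
      ext v
      simp [a2]
    rwa [e] at h1
  have hΦΦ' : ∀ᶠ x in 𝓝 0, Φ x = (1 - π) (Φ' x) := by
    filter_upwards [h.proj, hψE] with x h1 h2
    simp only [hΦ']
    rw [map_add, ← h2]
    simp [h1, a1, a3]
  have hψΦ' : ∀ᶠ x in 𝓝 0, ψ x = (π - π') (Φ' x) := by
    filter_upwards [h.proj, hψE] with x h1 h2
    simp only [hΦ']
    rw [map_add, h2]
    have : π' (Φ x) = 0 := by rw [← a4, h1, _root_.map_zero]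
    simp [h1, this]
  -- `P'` preserves `Φ'`, of which both `Φ` and `ψ` are projections. Consequently `P ∘ P' = P` near
  -- `0`.
  have hΦP' : ∀ᶠ x in 𝓝 0, Φ (P' x) = Φ x := by
    filter_upwards [hP't.eventually hΦΦ', hΦΦ', hsec] with x h1 h2 h3
    rw [h1, h2]
    congr 1
  have hψP' : ∀ᶠ x in 𝓝 0, ψ (P' x) = ψ x := by
    filter_upwards [hP't.eventually hψΦ', hψΦ', hsec] with x h1 h2 h3
    rw [h1, h2]
    congr 1
  obtain ⟨R₀, hR₀, C₀, L₀, hball₀⟩ := h.exists_radius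
  obtain ⟨R₁, hR₁, hball₁⟩ := Metric.eventually_nhds_iff_ball.1
    (hψlim.and (hψ.eventually (by simp)))
  set R₂ := min R₀ R₁
  have hR₂ : 0 < R₂ := lt_min hR₀ hR₁
  have hball2 : ∀ᶠ x in 𝓝 (0 : V), P' x ∈ Metric.ball (0 : V) R₂ :=
    hP't.eventually (Metric.ball_mem_nhds 0 hR₂)
  have hL' : ∀ᶠ x in 𝓝 (0 : V), ‖fderiv ℝ P' x‖ ≤ ‖fderiv ℝ P' 0‖ + 1 :=
    ((hP'c.continuousAt_fderiv (by simp)).norm.eventually_lt_const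
      (lt_add_one _)).mono fun x hx => le_of_lt hx
  obtain ⟨R₃, hR₃, hball₃⟩ := Metric.eventually_nhds_iff_ball.1
    (hΦP'.and (hψP'.and (hball2.and (hL'.and (hP'c.eventually (by simp))))))
  set R := min R₂ R₃ with hR
  have hR0 : 0 < R := lt_min hR₂ hR₃
  have hsub0 : ∀ x ∈ Metric.ball (0 : V) R₂, x ∈ Metric.ball (0 : V) R₀ := fun x hx =>
    Metric.ball_subset_ball (min_le_left _ _) hx
  have hsub1 : ∀ x ∈ Metric.ball (0 : V) R₂, x ∈ Metric.ball (0 : V) R₁ := fun x hx =>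
    Metric.ball_subset_ball (min_le_right _ _) hx
  have hsub2 : ∀ x ∈ Metric.ball (0 : V) R, x ∈ Metric.ball (0 : V) R₂ := fun x hx =>
    Metric.ball_subset_ball (min_le_left _ _) hx
  have hsub3 : ∀ x ∈ Metric.ball (0 : V) R, x ∈ Metric.ball (0 : V) R₃ := fun x hx =>
    Metric.ball_subset_ball (min_le_right _ _) hx
  have hnhds : ∀ x ∈ Metric.ball (0 : V) R, Metric.ball (0 : V) R ∈ 𝓝 x := fun x hx =>
    Metric.isOpen_ball.mem_nhds hx
  have hΔdiff : ∀ k, ∀ x ∈ Metric.ball (0 : V) R₂,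
      DifferentiableAt ℝ (orbitDisplacement f P k) x := fun k x hx =>
    (contDiffAt_orbitDisplacement hf (hball₀ x (hsub0 x hx)).1 k).differentiableAt (by simp)
  have hP'diff : ∀ x ∈ Metric.ball (0 : V) R, DifferentiableAt ℝ P' x := fun x hx =>
    (hball₃ x (hsub3 x hx)).2.2.2.2.differentiableAt (by simp)
  -- From `P ∘ P' = P` the new displacement at `y` is the old one at `y` minus the old one at `P'
  -- y`, so both decay and limits transfer from the previous stage.
  have hdecomp : ∀ k, ∀ x ∈ Metric.ball (0 : V) R, fderiv ℝ (orbitDisplacement f P' k) x =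
      fderiv ℝ (orbitDisplacement f P k) x
        - fderiv ℝ (orbitDisplacement f P k) (P' x) * fderiv ℝ P' x := by
    intro k x hx
    have e : orbitDisplacement f P' k =ᶠ[𝓝 x]
        fun y => orbitDisplacement f P k y - orbitDisplacement f P k (P' y) := by
      filter_upwards [hnhds x hx] with y hy
      have : P (P' y) = P y := by
        simp only [hP, Function.comp_apply]
        rw [(hball₃ y (hsub3 y hy)).1]
      simp only [orbitDisplacement, this]
      abel
    rw [e.fderiv_eq]
    exact ((hΔdiff k x (hsub2 x hx)).hasFDerivAt.sub
      ((hΔdiff k (P' x) (hball₃ x (hsub3 x hx)).2.2.1).hasFDerivAt.comp x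
        (hP'diff x hx).hasFDerivAt)).fderiv
  have hψfix : ∀ x ∈ Metric.ball (0 : V) R,
      fderiv ℝ ψ x - fderiv ℝ ψ (P' x) * fderiv ℝ P' x = 0 := by
    intro x hx
    have e : ψ ∘ P' =ᶠ[𝓝 x] ψ := by
      filter_upwards [hnhds x hx] with y hy
      exact (hball₃ y (hsub3 y hy)).2.1
    have h1 := (hball₁ (P' x) (hsub1 _ (hball₃ x (hsub3 x hx)).2.2.1)).2.differentiableAt (by simp)
    rw [← e.fderiv_eq, fderiv_comp x h1 (hP'diff x hx)]
    exact sub_self _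
  -- Write `1 - π' = (1 - π) + (π - π')`. The first part tends to zero by the previous stage; the
  -- second tends to `Dψ(x) - Dψ(P' x) DP'(x)`, which vanishes because `ψ ∘ P' = ψ`.
  have hslow_lim : ∀ x ∈ Metric.ball (0 : V) R, Tendsto (fun k => (A.symm : V →L[ℝ] V) ^ k *
      (1 - π') * fderiv ℝ (orbitDisplacement f P' k) x) atTop (𝓝 0) := by
    intro x hx
    have hx2 := hsub2 x hx
    have hPx := (hball₃ x (hsub3 x hx)).2.2.1
    have h1 := (hball₀ x (hsub0 x hx2)).2.2.2.2
    have h2 := (hball₀ (P' x) (hsub0 _ hPx)).2.2.2.2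
    have h3 := (hball₁ x (hsub1 x hx2)).1
    have h4 := (hball₁ (P' x) (hsub1 _ hPx)).1
    have h5 := (h1.add h3).sub ((h2.add h4).mul_const (fderiv ℝ P' x))
    rw [zero_add, zero_add, hψfix x hx] at h5
    refine h5.congr fun k => ?_
    rw [hdecomp k x hx]
    simp only [mul_sub, sub_mul, add_mul, mul_one, mul_assoc]
    abel
  have hdecay : ∃ C, ∀ (x : Metric.ball (0 : V) R) (k : ℕ),
      ‖fderiv ℝ (orbitDisplacement f P' k) x‖ ≤ C * β' ^ k := by
    refine exists_fast_decay (ι := Metric.ball (0 : V) R) A π' a2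
      (fun v => DFunLike.congr_fun hAπ' v) hb hf.pos hf.lt_one hfast hslow hlβ hbβ' hβ'β
      (fun x k => fderiv ℝ (orbitDisplacement f P' k) x) ?_ ?_ fun x => hslow_lim x x.2
    · intro C τ _ hC
      exact ⟨_, fun x k => norm_fderiv_orbitDisplacement_defect_le hf
        (fun y hy => (hball₃ y (hsub3 y hy)).2.2.2.2) hP'0
        (fun y hy => (hball₃ y (hsub3 y hy)).2.2.2.1) (fun y hy k => hC ⟨y, hy⟩ k) x x.2 k⟩
    -- `hdecomp` gives only the old rate `β`, which seeds the bootstrap to `β'`.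
    · refine ⟨C₀ * (1 + (‖fderiv ℝ P' 0‖ + 1)), fun x k => ?_⟩
      have hPx := (hball₃ x (hsub3 x x.2)).2.2.1
      have h1 := (hball₀ x (hsub0 x (hsub2 x x.2))).2.2.2.1 k
      have h2 := (hball₀ (P' x) (hsub0 _ hPx)).2.2.2.1 k
      have h3 := (hball₃ x (hsub3 x x.2)).2.2.2.1
      have h0 : 0 ≤ C₀ * β ^ k := (norm_nonneg _).trans h1
      rw [hdecomp k x x.2]
      calc _ ≤ C₀ * β ^ k + (C₀ * β ^ k) * (‖fderiv ℝ P' 0‖ + 1) :=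
            (norm_sub_le _ _).trans (add_le_add h1 ((norm_mul_le _ _).trans
              (mul_le_mul h2 h3 (norm_nonneg _) h0)))
        _ = _ := by ring
  obtain ⟨C, hC⟩ := hdecay
  have hmem : Metric.ball (0 : V) R ∈ 𝓝 (0 : V) := Metric.ball_mem_nhds 0 hR0
  exact ⟨Φ', σ', {
    contDiffAt := hΦ'c
    map_zero := hΦ'0
    hasFDerivAt := hΦ'd
    proj := hπ'Φ'
    semiconj := hsemi
    contDiffAt_retraction := hP'c
    section_zero := hσ'0
    hasFDerivAt_retraction := hP'd
    comm := hcomm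
    decay := ⟨C, by
      filter_upwards [hmem] with x hx k
      exact hC ⟨x, hx⟩ k⟩
    slow_limit := by
      filter_upwards [hmem] with x hx
      exact hslow_lim x hx }⟩

end Step

/-! ### From iterates and flags to a full linearization -/

section Flag

theorem orthogonal_idempotents_tail_mul {R : Type*} [Ring R] {m : ℕ} {e : ℕ → R}
    (he : ∀ i < m, ∀ j < m, i ≠ j → e i * e j = 0) (hsum : ∑ i ∈ Finset.range m, e i = 1)
    {j k : ℕ} (hjk : j ≤ k) :
    (∑ i ∈ Finset.Ico j m, e i) * ∑ i ∈ Finset.Ico k m, e i = ∑ i ∈ Finset.Ico k m, e i ∧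
      (∑ i ∈ Finset.Ico k m, e i) * ∑ i ∈ Finset.Ico j m, e i = ∑ i ∈ Finset.Ico k m, e i := by
  have hidem : ∀ i < m, e i * e i = e i := by
    intro i hi
    have h := congrArg (e i * ·) hsum
    simp only [Finset.mul_sum, mul_one] at h
    rwa [Finset.sum_eq_single_of_mem i (Finset.mem_range.2 hi) fun b hb hbi =>
      he i hi b (Finset.mem_range.1 hb) hbi.symm] at h
  constructor
  · rw [Finset.mul_sum]
    refine Finset.sum_congr rfl fun i hi => ?_
    rw [Finset.mem_Ico] at hi
    rw [Finset.sum_mul, Finset.sum_eq_single_of_mem i (Finset.mem_Ico.2 ⟨by omega, hi.2⟩)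
      fun b hb hbi => he b (Finset.mem_Ico.1 hb).2 i hi.2 hbi, hidem i hi.2]
  · rw [Finset.sum_mul]
    refine Finset.sum_congr rfl fun i hi => ?_
    rw [Finset.mem_Ico] at hi
    rw [Finset.mul_sum, Finset.sum_eq_single_of_mem i (Finset.mem_Ico.2 ⟨by omega, hi.2⟩)
      fun b hb hbi => he i hi.2 b (Finset.mem_Ico.1 hb).2 hbi.symm, hidem i hi.2]

variable {V : Type*} [NormedAddCommGroup V] [NormedSpace ℝ V]

/-- Start of the induction: every direction still counts as fast, the retraction is zero, and the
displacement is the orbit itself, which decays at rate `l`. -/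
theorem isPartialLinearization_zero {f : V → V} {A : V ≃L[ℝ] V} {l M : ℝ}
    (hf : IsSmoothContraction f (A : V →L[ℝ] V) l M) :
    IsPartialLinearization f A 1 l (fun _ => 0) (fun _ => 0) := by
  have h0 : ((fun _ => 0 : V → V) ∘ fun _ => 0 : V → V) = fun _ => 0 := rfl
  have h1 : HasFDerivAt (fun _ : V => (0 : V)) (1 - 1 : V →L[ℝ] V) 0 := by
    rw [sub_self]
    exact hasFDerivAt_const 0 0
  constructor
  · exact contDiffAt_const
  · rfl
  · exact h1
  · simp
  · simp
  · exact contDiffAt_const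
  · rfl
  · exact h1
  · simp [hf.map_zero]
  · refine ⟨1, Eventually.of_forall fun x k => ?_⟩
    rw [h0, fderiv_orbitDisplacement hf (differentiableAt_const _), fderiv_fun_const]
    simpa using hf.norm_fderiv_iterate_le k x
  · refine Eventually.of_forall fun x => ?_
    simp

/-- A linearization of an iterate yields, by averaging, a linearization of the map itself. -/
theorem exists_linearization_of_iterate {g : V → V} {A : V ≃L[ℝ] V} (hg : ContDiff ℝ 1 g)
    (hg0 : g 0 = 0) (hgA : HasFDerivAt g (A : V →L[ℝ] V) 0) {q : ℕ} (hq : q ≠ 0) {φ : V → V}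
    (hφ : ContDiffAt ℝ 1 φ 0) (hφ0 : φ 0 = 0) (hφd : HasFDerivAt φ (1 : V →L[ℝ] V) 0)
    (hφq : ∀ᶠ x in 𝓝 0, φ (g^[q] x) = ((A : V →L[ℝ] V) ^ q) (φ x)) :
    ∃ φ : V → V, ContDiffAt ℝ 1 φ 0 ∧ φ 0 = 0 ∧ HasFDerivAt φ (1 : V →L[ℝ] V) 0 ∧
      ∀ᶠ x in 𝓝 0, φ (g x) = A (φ x) := by
  set S : V →L[ℝ] V := (A.symm : V →L[ℝ] V) with hS
  have hAS : (A : V →L[ℝ] V) * S = 1 := by simpa using pow_mul_symm_pow A 1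
  have hgi : ∀ j, ContDiff ℝ 1 g^[j] := contDiff_iterate hg
  have hgi0 : ∀ j, g^[j] 0 = 0 := fun j => Function.iterate_fixed hg0 j
  have hq' : (q : ℝ) ≠ 0 := by exact_mod_cast hq
  refine ⟨fun x => (q : ℝ)⁻¹ • ∑ j ∈ Finset.range q, (S ^ j) (φ (g^[j] x)), ?_, ?_, ?_, ?_⟩
  · refine contDiffAt_const.smul (ContDiffAt.sum fun j _ => ?_)
    have h : ContDiffAt ℝ 1 φ (g^[j] 0) := by rwa [hgi0]
    exact (S ^ j).contDiff.contDiffAt.comp 0 (h.comp 0 (hgi j).contDiffAt)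
  · simp [hgi0, hφ0]
  · have h1 : ∀ j, HasFDerivAt (fun x => (S ^ j) (φ (g^[j] x))) (1 : V →L[ℝ] V) 0 := by
      intro j
      have h : HasFDerivAt φ (1 : V →L[ℝ] V) (g^[j] 0) := by rwa [hgi0]
      have h2 := (S ^ j).hasFDerivAt.comp 0 (h.comp 0 (hgA.iterate hg0 j))
      convert! h2 using 1
      exact (symm_pow_mul_pow A j).symm
    have h2 := (HasFDerivAt.fun_sum (u := Finset.range q) fun j _ => h1 j).const_smul (q : ℝ)⁻¹
    convert! h2 using 1
    rw [Finset.sum_const, Finset.card_range, ← Nat.cast_smul_eq_nsmul ℝ, smul_smul,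
      inv_mul_cancel₀ hq', one_smul]
  · filter_upwards [hφq] with x hx
    have h1 : ∀ j, (S ^ j) (φ (g^[j] (g x))) = A ((S ^ (j + 1)) (φ (g^[j + 1] x))) := by
      intro j
      have : S ^ j = (A : V →L[ℝ] V) * S ^ (j + 1) := by
        rw [pow_succ', ← mul_assoc, hAS, one_mul]
      rw [this, ← Function.iterate_succ_apply]
      rfl
    simp only [h1]
    rw [← map_sum, ← map_smul]
    congr 2
    -- Applying `g` shifts the summation range from `0, …, q - 1` to `1, …, q`; the two end terms
    -- agree because `φ` linearizes `g^[q]`.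
    have h2 := Finset.sum_range_succ (fun j => (S ^ j) (φ (g^[j] x))) q
    rw [Finset.sum_range_succ'] at h2
    have h3 : (S ^ q) (φ (g^[q] x)) = φ x := by
      rw [hx]
      exact DFunLike.congr_fun (symm_pow_mul_pow A q) (φ x)
    rw [h3] at h2
    simpa using h2

variable [FiniteDimensional ℝ V]

theorem exists_linearization_of_flag {f : V → V} {A : V ≃L[ℝ] V} {l M : ℝ}
    (hf : IsSmoothContraction f (A : V →L[ℝ] V) l M) (m : ℕ) (π : ℕ → V →L[ℝ] V) (a b β : ℕ → ℝ)
    (hπ0 : π 0 = 1) (hπm : π m = 0) (hβ0 : β 0 = l)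
    (hmul : ∀ j k, j ≤ k → π j * π k = π k ∧ π k * π j = π k)
    (hcomm : ∀ j, π j * (A : V →L[ℝ] V) = (A : V →L[ℝ] V) * π j)
    (hb : ∀ j < m, 0 ≤ b j ∧ b j < β (j + 1) ∧ β (j + 1) ≤ β j ∧ b j < a j ∧ l * β j < a j)
    (hfast : ∀ j < m, ∀ v, ‖A (π (j + 1) v)‖ ≤ b j * ‖π (j + 1) v‖)
    (hslow : ∀ j < m, ∀ v, a j * ‖(1 - π (j + 1)) v‖ ≤ ‖A ((1 - π (j + 1)) v)‖) :
    ∃ φ : V → V, ContDiffAt ℝ 1 φ 0 ∧ φ 0 = 0 ∧ HasFDerivAt φ (1 : V →L[ℝ] V) 0 ∧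
      ∀ᶠ x in 𝓝 0, φ (f x) = A (φ x) := by
  have key : ∀ j ≤ m, ∃ Φ σ, IsPartialLinearization f A (π j) (β j) Φ σ := by
    intro j
    induction j with
    | zero =>
      intro _
      rw [hπ0, hβ0]
      exact ⟨_, _, isPartialLinearization_zero hf⟩
    | succ j ih =>
      intro hj
      obtain ⟨Φ, σ, h⟩ := ih (by omega)
      obtain ⟨h1, h2, h3, h4, h5⟩ := hb j hj
      exact h.exists_refinement hf (hmul j j le_rfl).1 (hmul (j + 1) (j + 1) le_rfl).1
        (hmul j (j + 1) (by omega)).1 (hmul j (j + 1) (by omega)).2 (hcomm j) (hcomm (j + 1))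
        h1 h2 h3 h4 h5 (hfast j hj) (hslow j hj)
  obtain ⟨Φ, σ, h⟩ := key m le_rfl
  rw [hπm] at h
  exact ⟨Φ, h.contDiffAt, h.map_zero, by simpa using h.hasFDerivAt, h.semiconj⟩

/-- Cut off the remainder `g - A`, allowing its derivative at most `l - ‖A‖`. The cut-off remainder
is `C²` with compact support, so its derivative is globally Lipschitz. -/
theorem exists_isSmoothContraction_eventuallyEq {g : V → V} {A : V →L[ℝ] V}
    (hg : ContDiffAt ℝ 2 g 0) (hg0 : g 0 = 0) (hgA : HasFDerivAt g A 0) {l : ℝ} (hA : ‖A‖ < l)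
    (hl : l < 1) : ∃ (f : V → V) (M : ℝ), IsSmoothContraction f A l M ∧ f =ᶠ[𝓝 0] g := by
  set r : V → V := fun x => g x - A x with hr
  have hrc : ContDiffAt ℝ (2 : ℕ) r 0 := by
    have := hg.sub (A.contDiff (n := 2)).contDiffAt
    exact_mod_cast this
  have hrd : HasFDerivAt r (0 : V →L[ℝ] V) 0 := by
    have := hgA.sub A.hasFDerivAt
    rwa [sub_self] at this
  obtain ⟨χ, h1, h2, h3, h4⟩ := exists_cutoff two_ne_zero hrc (by simp [hr, hg0]) hrd.fderiv
    (ε := l - ‖A‖) (by linarith)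
  set s : V → V := fun x => χ x • r x with hs
  have h1' : ContDiff ℝ 2 s := by exact_mod_cast h1
  have hsd : Differentiable ℝ s := h1'.differentiable (by simp)
  have hs1 : ContDiff ℝ 1 (fderiv ℝ s) := h1'.fderiv_right (by norm_num)
  obtain ⟨M, hM⟩ := hs1.lipschitzWith_of_hasCompactSupport (h4.fderiv (𝕜 := ℝ)) (by simp)
  have hfd : ∀ x, HasFDerivAt (fun x => A x + s x) (A + fderiv ℝ s x) x := fun x =>
    A.hasFDerivAt.add (hsd x).hasFDerivAt
  have hsr : s =ᶠ[𝓝 0] r := by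
    filter_upwards [h2] with x hx
    simp [hs, hx]
  refine ⟨fun x => A x + s x, M, ⟨?_, ?_, ?_, ?_, hl, ?_, M.2, ?_⟩, ?_⟩
  · exact A.contDiff.add (h1'.of_le (by norm_num))
  · simp [hs, hr, hg0]
  · rw [(hfd 0).fderiv, hsr.fderiv_eq, hrd.fderiv, add_zero]
  · exact (norm_nonneg _).trans_lt hA
  · intro x
    rw [(hfd x).fderiv]
    calc _ ≤ ‖A‖ + (l - ‖A‖) := (norm_add_le _ _).trans (add_le_add le_rfl (h3 x))
      _ = l := by ring
  · intro x y
    rw [(hfd x).fderiv, (hfd y).fderiv, add_sub_add_left_eq_sub]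
    simpa [dist_eq_norm] using hM.dist_le_mul x y
  · filter_upwards [hsr] with x hx
    rw [hx, hr]
    simp

end Flag

/-! ### Hartman's theorem for contractions -/

section Local

/-- Both inequalities are strict at `c = 1`, so they persist slightly above it. The first gives `(c
ρ₀) (c ρ_j) < ρ_j / c`, which makes the defect summable after rescaling; the second separates
consecutive blocks. -/
theorem exists_spectral_margin {m : ℕ} {ρ : ℕ → ℝ} (hρ : StrictAnti ρ)
    (h1 : ρ 0 < 1) : ∃ c : ℝ, 1 < c ∧ c ^ 3 * ρ 0 < 1 ∧ ∀ j < m, c * ρ (j + 1) < ρ j / c := by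
  have e1 : ∀ᶠ c : ℝ in 𝓝[>] 1, c ^ 3 * ρ 0 < 1 := by
    have : Tendsto (fun c : ℝ => c ^ 3 * ρ 0) (𝓝[>] 1) (𝓝 (1 ^ 3 * ρ 0)) :=
      (Continuous.tendsto (by fun_prop) 1).mono_left nhdsWithin_le_nhds
    rw [one_pow, one_mul] at this
    exact this.eventually_lt_const h1
  have e2 : ∀ᶠ c : ℝ in 𝓝[>] 1, ∀ j ∈ Finset.range m, c * c * ρ (j + 1) < ρ j := by
    rw [Filter.eventually_all_finset]
    intro j _
    have : Tendsto (fun c : ℝ => c * c * ρ (j + 1)) (𝓝[>] 1) (𝓝 (1 * 1 * ρ (j + 1))) :=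
      (Continuous.tendsto (by fun_prop) 1).mono_left nhdsWithin_le_nhds
    rw [one_mul, one_mul] at this
    exact this.eventually_lt_const (hρ (Nat.lt_succ_self j))
  obtain ⟨c, hc1, hc2, hc3⟩ := (e1.and (e2.and self_mem_nhdsWithin)).exists
  have hc0 : 0 < c := by
    have : (1 : ℝ) < c := hc3
    linarith
  refine ⟨c, hc3, hc1, fun j hj => ?_⟩
  rw [lt_div_iff₀ hc0]
  have := hc2 j (Finset.mem_range.2 hj)
  linarith

/-- The constant does not depend on the subset `t`, so a single iterate will work for every partial
sum of the idempotents. -/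
theorem exists_uniform_growth_bound {R : Type*} [NormedRing R] (T : R) (s : Finset ℕ)
    (e : ℕ → R) (w : ℕ → ℝ) (hw : ∀ i ∈ s, 0 ≤ w i)
    (h : ∀ i ∈ s, ∃ K, ∀ k : ℕ, ‖T ^ k * e i‖ ≤ K * w i ^ k) :
    ∃ K, 0 ≤ K ∧ ∀ t ⊆ s, ∀ W, 0 ≤ W → (∀ i ∈ t, w i ≤ W) → ∀ k, ‖T ^ k * ∑ i ∈ t, e i‖ ≤ K * W ^ k := by
  choose! K hK using h
  refine ⟨∑ i ∈ s, |K i|, Finset.sum_nonneg fun i _ => abs_nonneg _, fun t ht W hW0 hW k => ?_⟩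
  rw [Finset.mul_sum, Finset.sum_mul]
  refine (norm_sum_le _ _).trans ((Finset.sum_le_sum fun i hi => ?_).trans
    (Finset.sum_le_sum_of_subset_of_nonneg ht fun i _ _ => by positivity))
  refine (hK i (ht hi) k).trans ?_
  have := hw i (ht hi)
  have := hW i hi
  calc K i * w i ^ k ≤ |K i| * w i ^ k := by gcongr; exact le_abs_self _
    _ ≤ |K i| * W ^ k := by gcongr

theorem coe_continuousLinearEquiv_pow {V : Type*} [NormedAddCommGroup V] [NormedSpace ℝ V]
    (A : V ≃L[ℝ] V) (k : ℕ) : ((A ^ k : V ≃L[ℝ] V) : V →L[ℝ] V) = (A : V →L[ℝ] V) ^ k := by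
  induction k with
  | zero => rfl
  | succ k ih =>
    rw [pow_succ, pow_succ, ← ih]
    rfl

/-- **Hartman's `C¹` linearization theorem** for contractions: a `C²` local diffeomorphism whose
linear part at a fixed point is a contraction is `C¹` conjugate to it near the fixed point. -/
theorem exists_local_linearization {N : ℕ}
    {g : EuclideanSpace ℝ (Fin N) → EuclideanSpace ℝ (Fin N)}
    {A : EuclideanSpace ℝ (Fin N) ≃L[ℝ] EuclideanSpace ℝ (Fin N)} (hg : ContDiff ℝ 2 g)
    (hg0 : g 0 = 0)
    (hgA : HasFDerivAt g (A : EuclideanSpace ℝ (Fin N) →L[ℝ] EuclideanSpace ℝ (Fin N)) 0)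
    (hA : ‖(A : EuclideanSpace ℝ (Fin N) →L[ℝ] EuclideanSpace ℝ (Fin N))‖ < 1) :
    ∃ φ : EuclideanSpace ℝ (Fin N) → EuclideanSpace ℝ (Fin N),
      ContDiffAt ℝ 1 φ 0 ∧ φ 0 = 0 ∧
      HasFDerivAt φ (1 : EuclideanSpace ℝ (Fin N) →L[ℝ] EuclideanSpace ℝ (Fin N)) 0 ∧
      ∀ᶠ x in 𝓝 0, φ (g x) = A (φ x) := by
  set T : EuclideanSpace ℝ (Fin N) →L[ℝ] EuclideanSpace ℝ (Fin N) := (A : EuclideanSpace ℝ (Fin N) →L[ℝ] EuclideanSpace ℝ (Fin N)) with hT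
  set S : EuclideanSpace ℝ (Fin N) →L[ℝ] EuclideanSpace ℝ (Fin N) := (A.symm : EuclideanSpace ℝ (Fin N) →L[ℝ] EuclideanSpace ℝ (Fin N)) with hS
  have hST : S * T = 1 := by simpa using symm_pow_mul_pow A 1
  have hTS : T * S = 1 := by simpa using pow_mul_symm_pow A 1
  obtain ⟨m, ρ, e, hρ, hρ0, hρ1, he, hsum, hcomm, hgrow⟩ :=
    exists_modulus_decomposition T S hTS hST hA
  obtain ⟨c, hc1, hc3, hcgap⟩ := exists_spectral_margin (m := m) hρ hρ1
  -- Growth is measured at the intermediate rate `d < c`; the factor `(d / c)^q` then absorbs the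
  -- constants `K₁` and `K₂` once `q` is large.
  set d := (1 + c) / 2 with hd
  have hd1 : 1 < d := by rw [hd]; linarith
  have hdc : d < c := by rw [hd]; linarith
  have hc0 : 0 < c := by linarith
  have hd0 : 0 < d := by linarith
  obtain ⟨K₁, hK₁0, hK₁⟩ := exists_uniform_growth_bound T (Finset.range m) e (fun i => d * ρ i)
    (fun i _ => (mul_pos hd0 (hρ0 i)).le) fun i hi => (hgrow d hd1 i (Finset.mem_range.1 hi)).1
  obtain ⟨K₂, hK₂0, hK₂⟩ := exists_uniform_growth_bound S (Finset.range m) e (fun i => d / ρ i)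
    (fun i _ => (div_pos hd0 (hρ0 i)).le) fun i hi => (hgrow d hd1 i (Finset.mem_range.1 hi)).2
  obtain ⟨q, hq1, hqK₁, hqK₂⟩ : ∃ q : ℕ, 1 ≤ q ∧ K₁ * (d / c) ^ q < 1 / 2 ∧
      K₂ * (d / c) ^ q < 1 / 2 := by
    have ht : ∀ K : ℝ, Tendsto (fun q : ℕ => K * (d / c) ^ q) atTop (𝓝 0) := fun K => by
      simpa using (tendsto_pow_atTop_nhds_zero_of_lt_one (by positivity)
        ((div_lt_one hc0).2 hdc)).const_mul K
    exact ((eventually_ge_atTop 1).and (((ht K₁).eventually_lt_const (by norm_num)).and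
      ((ht K₂).eventually_lt_const (by norm_num)))).exists
  have hq0 : q ≠ 0 := by omega
  set π : ℕ → EuclideanSpace ℝ (Fin N) →L[ℝ] EuclideanSpace ℝ (Fin N) := fun j => ∑ i ∈ Finset.Ico j m, e i with hπ
  have hπmul : ∀ j k, j ≤ k → π j * π k = π k ∧ π k * π j = π k := fun j k hjk =>
    orthogonal_idempotents_tail_mul he hsum hjk
  have hπT : ∀ j, Commute T (π j) := fun j => Commute.sum_right _ _ _ fun i _ => hcomm i
  have hfast : ∀ j, ‖T ^ q * π j‖ ≤ (c * ρ j) ^ q / 2 := by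
    intro j
    refine (hK₁ (Finset.Ico j m) (fun i hi => Finset.mem_range.2 (Finset.mem_Ico.1 hi).2)
      (d * ρ j) (mul_pos hd0 (hρ0 j)).le (fun i hi => ?_) q).trans ?_
    · exact mul_le_mul_of_nonneg_left (hρ.antitone (Finset.mem_Ico.1 hi).1) hd0.le
    · have : K₁ * (d * ρ j) ^ q = K₁ * (d / c) ^ q * (c * ρ j) ^ q := by
        rw [mul_assoc, ← mul_pow]
        congr 2
        field_simp
      rw [this]
      have hpos : 0 < (c * ρ j) ^ q := pow_pos (mul_pos hc0 (hρ0 j)) q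
      nlinarith
  have hπ1 : ∀ j < m, 1 - π (j + 1) = ∑ i ∈ Finset.range (j + 1), e i := by
    intro j hj
    rw [← hsum, sub_eq_iff_eq_add, hπ]
    exact (Finset.sum_range_add_sum_Ico e hj).symm
  have hslow : ∀ j < m, ‖S ^ q * (1 - π (j + 1))‖ ≤ (c / ρ j) ^ q := by
    intro j hj
    rw [hπ1 j hj]
    refine (hK₂ (Finset.range (j + 1)) (fun i hi => Finset.mem_range.2 (by
      have := Finset.mem_range.1 hi
      omega)) (d / ρ j) (div_pos hd0 (hρ0 j)).le (fun i hi => ?_) q).trans ?_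
    · have hij : ρ j ≤ ρ i := hρ.antitone (by
        have := Finset.mem_range.1 hi
        omega)
      exact div_le_div_of_nonneg_left hd0.le (hρ0 j) hij
    · have : K₂ * (d / ρ j) ^ q = K₂ * (d / c) ^ q * (c / ρ j) ^ q := by
        rw [mul_assoc, ← mul_pow]
        congr 2
        field_simp
      rw [this]
      have hpos : 0 < (c / ρ j) ^ q := pow_pos (div_pos hc0 (hρ0 j)) q
      nlinarith
  set l := (c * ρ 0) ^ q with hl
  have hcρ : c * ρ 0 < 1 := by
    refine lt_of_le_of_lt ?_ hc3
    exact mul_le_mul_of_nonneg_right (le_self_pow₀ hc1.le (by norm_num)) (hρ0 0).le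
  have hl0 : 0 < l := pow_pos (mul_pos hc0 (hρ0 0)) q
  have hl1 : l < 1 := pow_lt_one₀ (mul_pos hc0 (hρ0 0)).le hcρ hq0
  have hπ0 : π 0 = 1 := by
    rw [hπ, ← hsum, Finset.range_eq_Ico]
  have hTq : ‖((A ^ q : EuclideanSpace ℝ (Fin N) ≃L[ℝ] EuclideanSpace ℝ (Fin N)) : EuclideanSpace ℝ (Fin N) →L[ℝ] EuclideanSpace ℝ (Fin N))‖ < l := by
    have := hfast 0
    rw [hπ0, mul_one] at this
    rw [coe_continuousLinearEquiv_pow]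
    exact this.trans_lt (half_lt_self hl0)
  have hgq : ContDiff ℝ 2 g^[q] := contDiff_iterate hg q
  have hgqd : HasFDerivAt g^[q] ((A ^ q : EuclideanSpace ℝ (Fin N) ≃L[ℝ] EuclideanSpace ℝ (Fin N)) : EuclideanSpace ℝ (Fin N) →L[ℝ] EuclideanSpace ℝ (Fin N)) 0 := by
    rw [coe_continuousLinearEquiv_pow]
    exact hgA.iterate hg0 q
  obtain ⟨f, M, hf, hfg⟩ := exists_isSmoothContraction_eventuallyEq hgq.contDiffAt
    (Function.iterate_fixed hg0 q) hgqd hTq hl1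
  have happ : ∀ v, (A ^ q : EuclideanSpace ℝ (Fin N) ≃L[ℝ] EuclideanSpace ℝ (Fin N)) v = (T ^ q) v := fun v =>
    DFunLike.congr_fun (coe_continuousLinearEquiv_pow A q) v
  -- The factor `1 / 2` gained in `hfast` makes `b j < β (j + 1)` strict. The condition `l * β j < a
  -- j` is where `c ^ 3 * ρ 0 < 1` enters.
  obtain ⟨φ, hφ, hφ0, hφd, hφf⟩ := exists_linearization_of_flag hf m π
    (fun j => (ρ j / c) ^ q) (fun j => (c * ρ (j + 1)) ^ q / 2) (fun j => (c * ρ j) ^ q)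
    hπ0 (by simp [hπ]) rfl hπmul
    (fun j => by
      rw [coe_continuousLinearEquiv_pow]
      exact ((hπT j).pow_left q).symm.eq)
    (fun j hj => by
      have h1 : 0 < (c * ρ (j + 1)) ^ q := pow_pos (mul_pos hc0 (hρ0 _)) q
      have hpj := hρ0 j
      have hpj' := hρ0 (j + 1)
      have hp0 := hρ0 0
      refine ⟨by positivity, half_lt_self h1, ?_, ?_, ?_⟩
      · exact pow_le_pow_left₀ (mul_pos hc0 (hρ0 _)).le
          (mul_le_mul_of_nonneg_left (hρ.antitone (Nat.le_succ j)) hc0.le) q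
      · exact (half_lt_self h1).trans (pow_lt_pow_left₀ (hcgap j hj)
          (mul_pos hc0 (hρ0 _)).le hq0)
      · rw [hl, ← mul_pow]
        refine pow_lt_pow_left₀ ?_ (by positivity) hq0
        rw [lt_div_iff₀ hc0]
        nlinarith)
    (fun j _ v => by
      have h := (T ^ q * π (j + 1)).le_of_opNorm_le (hfast (j + 1)) (π (j + 1) v)
      rw [happ]
      have e1 : (T ^ q * π (j + 1)) (π (j + 1) v) = (T ^ q) (π (j + 1) v) := by
        have := DFunLike.congr_fun (hπmul (j + 1) (j + 1) le_rfl).1 v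
        simp only [mul_apply_eq_comp] at this ⊢
        rw [this]
      rwa [e1] at h)
    (fun j hj v => by
      have hpp : (1 - π (j + 1)) * (1 - π (j + 1)) = 1 - π (j + 1) := by
        rw [mul_sub, mul_one, sub_mul, one_mul, (hπmul (j + 1) (j + 1) le_rfl).1, sub_self,
          sub_zero]
      have hcm : Commute (T ^ q) (1 - π (j + 1)) :=
        (Commute.one_right _).sub_right ((hπT (j + 1)).pow_left q)
      have e1 : S ^ q * (1 - π (j + 1)) * (T ^ q * (1 - π (j + 1))) = 1 - π (j + 1) := by
        rw [hcm.eq, mul_assoc, ← mul_assoc (1 - π (j + 1)), hpp, ← hcm.eq, ← mul_assoc,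
          symm_pow_mul_pow, one_mul]
      have h := (S ^ q * (1 - π (j + 1))).le_of_opNorm_le (hslow j hj)
        ((T ^ q * (1 - π (j + 1))) v)
      have e2 := DFunLike.congr_fun e1 v
      rw [mul_apply_eq_comp] at e2
      rw [e2] at h
      rw [happ]
      have hpos : 0 < ρ j := hρ0 j
      calc (ρ j / c) ^ q * ‖(1 - π (j + 1)) v‖
          ≤ (ρ j / c) ^ q * ((c / ρ j) ^ q * ‖(T ^ q) ((1 - π (j + 1)) v)‖) := by
            gcongr
            exact h
        _ = ‖(T ^ q) ((1 - π (j + 1)) v)‖ := by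
            have : ρ j / c * (c / ρ j) = 1 := by field_simp
            rw [← mul_assoc, ← mul_pow, this, one_pow, one_mul])
  refine exists_linearization_of_iterate (hg.of_le (by norm_num)) hg0 hgA hq0 hφ hφ0 hφd ?_
  filter_upwards [hφf, hfg] with x h1 h2
  rw [← h2, h1, happ]

end Local

/-! ### Quadratic forms and Jacobians -/

/-- By homogeneity it suffices to bound `Q` on `K` times the unit sphere, which is compact. -/
theorem IsCompact.exists_quadratic_bounds {X : Type*} [TopologicalSpace X] {n : ℕ} {K : Set X}
    (hK : IsCompact K) (Q : X → EuclideanSpace ℝ (Fin n) → ℝ)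
    (hQ : ContinuousOn (fun p : X × EuclideanSpace ℝ (Fin n) => Q p.1 p.2) (K ×ˢ Set.univ))
    (hsmul : ∀ x (c : ℝ) v, Q x (c • v) = c ^ 2 * Q x v)
    (hpos : ∀ x ∈ K, ∀ v, v ≠ 0 → 0 < Q x v) :
    ∃ a₁ a₂ : ℝ, 0 < a₁ ∧ a₁ ≤ a₂ ∧ ∀ x ∈ K, ∀ v, a₁ * ‖v‖ ^ 2 ≤ Q x v ∧ Q x v ≤ a₂ * ‖v‖ ^ 2 := by
  have hC := hK.prod (isCompact_sphere (0 : EuclideanSpace ℝ (Fin n)) 1)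
  have hQC := hQ.mono (Set.prod_mono_right (Set.subset_univ
    (Metric.sphere (0 : EuclideanSpace ℝ (Fin n)) 1)))
  obtain ⟨a, ha, hlow⟩ := hC.exists_forall_le' (a := 0) hQC (by
    rintro ⟨x, v⟩ ⟨hx, hv⟩
    refine hpos x hx v ?_
    rintro rfl
    simp at hv)
  obtain ⟨b, hb⟩ := hC.bddAbove_image hQC
  -- The maximum keeps the constants ordered even if `K` times the sphere is empty.
  refine ⟨a, max a b, ha, le_max_left _ _, fun x hx v => ?_⟩
  rcases eq_or_ne v 0 with rfl | hv
  · have := hsmul x 0 0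
    simp at this
    simp [this]
  · have hmem : (x, ‖v‖⁻¹ • v) ∈ K ×ˢ Metric.sphere (0 : EuclideanSpace ℝ (Fin n)) 1 := by
      refine ⟨hx, ?_⟩
      simp [norm_smul, hv]
    have hv' : 0 < ‖v‖ ^ 2 := by positivity
    have h1 : Q x v = ‖v‖ ^ 2 * Q x (‖v‖⁻¹ • v) := by
      rw [hsmul]
      field_simp
    have h2 := hlow _ hmem
    have h3 := hb (Set.mem_image_of_mem _ hmem)
    simp only at h2 h3
    rw [h1]
    constructor
    · rw [mul_comm]; gcongr
    · rw [mul_comm]; gcongr; exact h3.trans (le_max_right _ _)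

theorem loewnerLE_of_forall_dotProduct {n : ℕ} {A B : Matrix (Fin n) (Fin n) ℝ}
    (hA : A.IsHermitian) (hB : B.IsHermitian)
    (h : ∀ v, v ⬝ᵥ A *ᵥ v ≤ v ⬝ᵥ B *ᵥ v) : LoewnerLE A B := by
  refine Matrix.PosSemidef.of_dotProduct_mulVec_nonneg (hB.sub hA) fun v => ?_
  simp only [star_trivial, Matrix.sub_mulVec, dotProduct_sub]
  linarith [h v]

theorem dotProduct_transpose_mul_mul_mulVec {n N : ℕ} (J : Matrix (Fin N) (Fin n) ℝ)
    (P : Matrix (Fin N) (Fin N) ℝ) (v : Fin n → ℝ) :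
    v ⬝ᵥ (Jᵀ * P * J) *ᵥ v = (J *ᵥ v) ⬝ᵥ P *ᵥ (J *ᵥ v) := by
  rw [← Matrix.mulVec_mulVec, ← Matrix.mulVec_mulVec, Matrix.dotProduct_mulVec v,
    Matrix.vecMul_transpose]

theorem dotProduct_self_eq_norm_sq {n : ℕ} (v : Fin n → ℝ) :
    v ⬝ᵥ v = ‖WithLp.toLp 2 v‖ ^ 2 := by
  rw [EuclideanSpace.real_norm_sq_eq]
  simp [dotProduct, sq]

theorem Matrix.IsHermitian.transpose_mul_mul {n N : ℕ} {P : Matrix (Fin N) (Fin N) ℝ}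
    (hP : P.IsHermitian) (J : Matrix (Fin N) (Fin n) ℝ) : (Jᵀ * P * J).IsHermitian := by
  have := Matrix.isHermitian_conjTranspose_mul_mul J hP
  rwa [Matrix.conjTranspose_eq_transpose_of_trivial] at this

theorem isHermitian_smul_one {n : ℕ} (a : ℝ) :
    (a • (1 : Matrix (Fin n) (Fin n) ℝ)).IsHermitian := by
  simp [Matrix.IsHermitian]

theorem dotProduct_smul_one_mulVec {n : ℕ} (a : ℝ) (v : Fin n → ℝ) :
    v ⬝ᵥ (a • (1 : Matrix (Fin n) (Fin n) ℝ)) *ᵥ v = a * (v ⬝ᵥ v) := by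
  simp [Matrix.smul_mulVec]

theorem jacobian_mulVec {n N : ℕ} (φ : EuclideanSpace ℝ (Fin n) → EuclideanSpace ℝ (Fin N))
    (x : EuclideanSpace ℝ (Fin n)) (v : Fin n → ℝ) :
    WithLp.toLp 2 (jacobian φ x *ᵥ v) = fderiv ℝ φ x (WithLp.toLp 2 v) := by
  have hv : WithLp.toLp 2 v = ∑ j, v j • EuclideanSpace.single j (1 : ℝ) := by
    ext i
    simp [Finset.sum_apply, Pi.single_apply]
  rw [hv, map_sum]
  ext i
  simp [jacobian, Matrix.mulVec, dotProduct, mul_comm]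

theorem rank_jacobian_of_injective {n N : ℕ}
    {φ : EuclideanSpace ℝ (Fin n) → EuclideanSpace ℝ (Fin N)} {x : EuclideanSpace ℝ (Fin n)}
    (h : Function.Injective (fderiv ℝ φ x)) : (jacobian φ x).rank = n := by
  have : Function.Injective (jacobian φ x).mulVecLin := by
    intro v w hvw
    have := congrArg (WithLp.toLp 2) hvw
    simp only [Matrix.mulVecLin_apply, jacobian_mulVec] at this
    simpa using h this
  rw [Matrix.rank, LinearMap.finrank_range_of_inj this]
  simp

theorem nondegenerateOn_of_injective_fderiv {n N : ℕ}
    {φ : EuclideanSpace ℝ (Fin n) → EuclideanSpace ℝ (Fin N)} (hφ : ContDiff ℝ 1 φ)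
    {X : Set (EuclideanSpace ℝ (Fin n))} (hX : IsCompact X)
    (h : ∀ x ∈ X, Function.Injective (fderiv ℝ φ x)) : NondegenerateOn φ X := by
  refine ⟨fun x hx => rank_jacobian_of_injective (h x hx), ?_⟩
  obtain ⟨a₁, a₂, h0, h12, hb⟩ := hX.exists_quadratic_bounds
    (fun x v => ‖fderiv ℝ φ x v‖ ^ 2) (by
      have := hφ.continuous_fderiv one_ne_zero
      fun_prop) (by
      intro x c v
      simp [norm_smul, mul_pow]) (by
      intro x hx v hv
      have : fderiv ℝ φ x v ≠ 0 := fun h0 => hv (h x hx (by simpa using h0))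
      positivity)
  have hher (x) : ((jacobian φ x)ᵀ * jacobian φ x).IsHermitian := by
    simpa using Matrix.isHermitian_one.transpose_mul_mul (jacobian φ x)
  have hq (x) (v : Fin n → ℝ) : v ⬝ᵥ ((jacobian φ x)ᵀ * jacobian φ x) *ᵥ v =
      ‖fderiv ℝ φ x (WithLp.toLp 2 v)‖ ^ 2 := by
    have := dotProduct_transpose_mul_mul_mulVec (jacobian φ x) 1 v
    rw [Matrix.mul_one, Matrix.one_mulVec, dotProduct_self_eq_norm_sq, jacobian_mulVec] at this
    exact this
  refine ⟨a₁, a₂, h0, h12, fun x hx => ⟨?_, ?_⟩⟩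
  · refine loewnerLE_of_forall_dotProduct (isHermitian_smul_one _) (hher x) fun v => ?_
    rw [dotProduct_smul_one_mulVec, dotProduct_self_eq_norm_sq, hq]
    exact (hb x hx _).1
  · refine loewnerLE_of_forall_dotProduct (hher x) (isHermitian_smul_one _) fun v => ?_
    rw [dotProduct_smul_one_mulVec, dotProduct_self_eq_norm_sq, hq]
    exact (hb x hx _).2

/-! ### From the local linearization to an embedding of a compact set -/

theorem exists_euclidean_isometric_embedding {n N : ℕ} (hN : n ≤ N) :
    ∃ ι : EuclideanSpace ℝ (Fin n) →L[ℝ] EuclideanSpace ℝ (Fin N),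
      (∀ x, ‖ι x‖ = ‖x‖) ∧ ∃ π : EuclideanSpace ℝ (Fin N) →L[ℝ] EuclideanSpace ℝ (Fin n),
        (∀ x, π (ι x) = x) ∧ ∀ y, ‖π y‖ ≤ ‖y‖ := by
  have hb : Orthonormal ℝ fun i : Fin n => EuclideanSpace.single (𝕜 := ℝ) (Fin.castLE hN i) (1 : ℝ) :=
    (EuclideanSpace.orthonormal_single (𝕜 := ℝ) (ι := Fin N)).comp _ (Fin.castLE_injective hN)
  let ι : EuclideanSpace ℝ (Fin n) →ₗᵢ[ℝ] EuclideanSpace ℝ (Fin N) :=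
    (EuclideanSpace.basisFun (Fin n) ℝ).toBasis.constr ℝ
      (fun i : Fin n => EuclideanSpace.single (𝕜 := ℝ) (Fin.castLE hN i) (1 : ℝ)) |>.isometryOfOrthonormal
      (v := (EuclideanSpace.basisFun (Fin n) ℝ).toBasis)
      (by simp)
      (by
        convert hb using 1
        ext i : 1
        simp only [Function.comp, Module.Basis.constr_basis])
  refine ⟨ι.toContinuousLinearMap, ι.norm_map, ContinuousLinearMap.adjoint ι.toContinuousLinearMap,
    fun x => ?_, fun y => ?_⟩
  · refine ext_inner_right ℝ fun y => ?_
    rw [ContinuousLinearMap.adjoint_inner_left]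
    exact ι.inner_map_map x y
  · refine (ContinuousLinearMap.le_opNorm _ y).trans ?_
    rw [LinearIsometryEquiv.norm_map]
    exact mul_le_of_le_one_left (norm_nonneg _) ι.norm_toContinuousLinearMap_le

/-- Cutting off `φ - id` so that its derivative stays below `1 / 2` leaves a small perturbation of
the identity, which is globally an injective immersion and still equals `φ` near `0`. -/
theorem exists_global_linearization {n : ℕ}
    {h : EuclideanSpace ℝ (Fin n) → EuclideanSpace ℝ (Fin n)}
    {A : EuclideanSpace ℝ (Fin n) ≃L[ℝ] EuclideanSpace ℝ (Fin n)}
    (hh : ContDiff ℝ 2 h) (hh0 : h 0 = 0)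
    (hhA : HasFDerivAt h (A : EuclideanSpace ℝ (Fin n) →L[ℝ] EuclideanSpace ℝ (Fin n)) 0)
    (hA : ‖(A : EuclideanSpace ℝ (Fin n) →L[ℝ] EuclideanSpace ℝ (Fin n))‖ < 1) :
    ∃ ψ : EuclideanSpace ℝ (Fin n) → EuclideanSpace ℝ (Fin n), ContDiff ℝ 1 ψ ∧
      Function.Injective ψ ∧ (∀ x, Function.Injective (fderiv ℝ ψ x)) ∧
      ∀ᶠ y in 𝓝 0, ψ (h y) = A (ψ y) := by
  obtain ⟨φ, hφ, hφ0, hφ1, hconj⟩ := exists_local_linearization hh hh0 hhA hA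
  have hr : ContDiffAt ℝ 1 (fun x => φ x - x) 0 := hφ.sub contDiffAt_id
  have hdr : fderiv ℝ (fun x => φ x - x) 0 = 0 := by
    have : HasFDerivAt (fun x => φ x - x) _ 0 := hφ1.sub (hasFDerivAt_id (𝕜 := ℝ) 0)
    simpa [ContinuousLinearMap.one_def] using this.fderiv
  obtain ⟨χ, hs, hχ, hds, -⟩ := exists_cutoff one_ne_zero hr (by simp [hφ0]) hdr
    (ε := 1 / 2) (by norm_num)
  generalize hsdef : (fun x => χ x • (φ x - x)) = s at hs hds
  have hsd : Differentiable ℝ s := hs.differentiable one_ne_zero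
  have hlip : LipschitzWith (1 / 2) s :=
    lipschitzWith_of_nnnorm_fderiv_le hsd fun x => by
      rw [← NNReal.coe_le_coe]
      simpa using hds x
  have hder (x) : fderiv ℝ (fun x => x + s x) x = ContinuousLinearMap.id ℝ _ + fderiv ℝ s x :=
    ((hasFDerivAt_id x).add (hsd x).hasFDerivAt).fderiv
  refine ⟨fun x => x + s x, contDiff_id.add hs, fun x y hxy => ?_, fun x => ?_, ?_⟩
  · have h1 := hlip.dist_le_mul x y
    have h2 : x - y = s y - s x := by
      simp only at hxy
      rw [sub_eq_sub_iff_add_eq_add, hxy, add_comm]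
    rw [dist_eq_norm, dist_eq_norm, norm_sub_rev, ← h2] at h1
    simp only [NNReal.coe_div, NNReal.coe_one, NNReal.coe_ofNat] at h1
    have : ‖x - y‖ ≤ 0 := by linarith
    exact sub_eq_zero.1 (norm_le_zero_iff.1 this)
  · rw [hder, injective_iff_map_eq_zero]
    intro v hv
    simp only [add_apply, ContinuousLinearMap.id_apply] at hv
    have h1 := (fderiv ℝ s x).le_of_opNorm_le (hds x) v
    rw [← norm_neg, ← eq_neg_of_add_eq_zero_left hv] at h1
    have : ‖v‖ ≤ 0 := by linarith
    exact norm_le_zero_iff.1 this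
  · have heq : ∀ᶠ x in 𝓝 0, x + s x = φ x := by
      filter_upwards [hχ] with x hx
      rw [← hsdef]
      simp [hx]
    have hcont : Tendsto h (𝓝 0) (𝓝 0) := by
      simpa [hh0] using hh.continuous.tendsto 0
    filter_upwards [heq, hcont.eventually heq, hconj] with x h1 h2 h3
    rw [h1, h2, h3]

theorem exists_fixedPoint_of_fderiv_lt_one {n : ℕ}
    {f : EuclideanSpace ℝ (Fin n) → EuclideanSpace ℝ (Fin n)} (hf : ContDiff ℝ 1 f)
    (hdf : ∀ x, ‖fderiv ℝ f x‖ < 1) {X : Set (EuclideanSpace ℝ (Fin n))} (hX : IsCompact X)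
    (hne : X.Nonempty) (hfX : Set.MapsTo f X X) :
    ∃ x₀ ∈ X, f x₀ = x₀ ∧ ∀ δ > 0, ∃ k, ∀ x ∈ X, ‖f^[k] x - x₀‖ < δ := by
  -- `X` need not be convex, so the mean value inequality is used on a ball containing it;
  -- compactness of the ball gives a constant `κ < 1`.
  obtain ⟨R, hR⟩ := hX.isBounded.subset_closedBall 0
  have hcd : Continuous fun x => ‖fderiv ℝ f x‖ := (hf.continuous_fderiv one_ne_zero).norm
  obtain ⟨κ, hκ0, hκ1, hκ⟩ : ∃ κ : ℝ, 0 ≤ κ ∧ κ < 1 ∧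
      ∀ x ∈ Metric.closedBall 0 R, ‖fderiv ℝ f x‖ ≤ κ := by
    obtain ⟨y, -, hy⟩ := (isCompact_closedBall (0 : EuclideanSpace ℝ (Fin n)) R).exists_isMaxOn
      (hne.mono hR) hcd.continuousOn
    exact ⟨_, norm_nonneg _, hdf y, fun x hx => hy hx⟩
  have hcontr : ∀ x ∈ X, ∀ y ∈ X, ‖f x - f y‖ ≤ κ * ‖x - y‖ := fun x hx y hy =>
    (convex_closedBall 0 R).norm_image_sub_le_of_norm_fderiv_le
      (fun z _ => hf.differentiable one_ne_zero z) hκ (hR hy) (hR hx)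
  -- At a minimizer of `‖f x - x‖` over `X` the value must be zero, since applying `f` would shrink
  -- it by `κ`.
  obtain ⟨x₀, hx₀, hmin⟩ := hX.exists_isMinOn hne
    ((hf.continuous.sub continuous_id).norm.continuousOn)
  have hfix : f x₀ = x₀ := by
    have h1 := hmin (hfX hx₀)
    have h2 := hcontr _ (hfX hx₀) _ hx₀
    simp only [Set.mem_ofPred_eq, Pi.sub_apply, id] at h1
    have : ‖f x₀ - x₀‖ ≤ 0 := by nlinarith [norm_nonneg (f x₀ - x₀)]
    exact sub_eq_zero.1 (norm_le_zero_iff.1 this)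
  refine ⟨x₀, hx₀, hfix, fun δ hδ => ?_⟩
  have hiter : ∀ k, ∀ x ∈ X, ‖f^[k] x - x₀‖ ≤ κ ^ k * ‖x - x₀‖ := by
    intro k
    induction k with
    | zero => simp
    | succ k ih =>
      intro x hx
      rw [Function.iterate_succ_apply', pow_succ']
      calc ‖f (f^[k] x) - x₀‖ = ‖f (f^[k] x) - f x₀‖ := by rw [hfix]
        _ ≤ κ * ‖f^[k] x - x₀‖ := hcontr _ (hfX.iterate k hx) _ hx₀
        _ ≤ κ * (κ ^ k * ‖x - x₀‖) := by gcongr; exact ih x hx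
        _ = _ := by ring
  obtain ⟨C, hC⟩ : ∃ C, ∀ x ∈ X, ‖x - x₀‖ ≤ C :=
    hX.exists_bound_of_continuousOn (by fun_prop)
  have hlim : Tendsto (fun k : ℕ => κ ^ k * C) atTop (𝓝 0) := by
    simpa using (tendsto_pow_atTop_nhds_zero_of_lt_one hκ0 hκ1).mul_const C
  obtain ⟨k, hk⟩ := (hlim.eventually_lt_const hδ).exists
  refine ⟨k, fun x hx => (hiter k x hx).trans_lt (lt_of_le_of_lt ?_ hk)⟩
  gcongr
  exact hC x hx

theorem injective_fderiv_iterate {n : ℕ}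
    {f : EuclideanSpace ℝ (Fin n) → EuclideanSpace ℝ (Fin n)} (hf : Differentiable ℝ f)
    (h : ∀ x, Function.Injective (fderiv ℝ f x)) (k : ℕ) (x : EuclideanSpace ℝ (Fin n)) :
    Function.Injective (fderiv ℝ f^[k] x) := by
  induction k with
  | zero =>
    rw [Function.iterate_zero, fderiv_id]
    exact Function.injective_id
  | succ k ih =>
    rw [Function.iterate_succ', fderiv_comp _ (hf _) (hf.iterate k x),
      ContinuousLinearMap.coe_comp]
    exact (h _).comp ih

theorem exists_fderiv_equiv_of_inverse {n : ℕ}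
    {f g : EuclideanSpace ℝ (Fin n) → EuclideanSpace ℝ (Fin n)} (hf : Differentiable ℝ f)
    (hg : Differentiable ℝ g) (hgf : Function.LeftInverse g f) (hfg : Function.RightInverse g f)
    (x : EuclideanSpace ℝ (Fin n)) :
    ∃ T : EuclideanSpace ℝ (Fin n) ≃L[ℝ] EuclideanSpace ℝ (Fin n),
      (T : EuclideanSpace ℝ (Fin n) →L[ℝ] EuclideanSpace ℝ (Fin n)) = fderiv ℝ f x := by
  have h1 : (fderiv ℝ g (f x)).comp (fderiv ℝ f x) = ContinuousLinearMap.id ℝ _ := by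
    rw [← fderiv_comp _ (hg _) (hf _), hgf.comp_eq_id, fderiv_id]
  have h2 : (fderiv ℝ f x).comp (fderiv ℝ g (f x)) = ContinuousLinearMap.id ℝ _ := by
    have := fderiv_comp (f x) (hf (g (f x))) (hg (f x))
    rw [hfg.comp_eq_id, fderiv_id, hgf x] at this
    exact this.symm
  exact ⟨ContinuousLinearEquiv.equivOfInverse _ _ (fun v => congrArg (· v) h1)
    fun v => congrArg (· v) h2, rfl⟩

theorem exists_linear_embedding_on_compact {n N : ℕ} (hN : n ≤ N)
    {f : EuclideanSpace ℝ (Fin n) → EuclideanSpace ℝ (Fin n)} (hf : ContDiff ℝ ∞ f)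
    (hinv : InverseGrowthAssumption f) {X : Set (EuclideanSpace ℝ (Fin n))} (hX : IsCompact X)
    (hfX : Set.MapsTo f X X) :
    ∃ φ : EuclideanSpace ℝ (Fin n) → EuclideanSpace ℝ (Fin N),
      ContDiff ℝ 1 φ ∧ Set.InjOn φ X ∧
      (∃ A : Matrix (Fin N) (Fin N) ℝ, IsSchurStable A ∧ IntertwinesOn f A φ X) ∧
      NondegenerateOn φ X := by
  obtain ⟨ι, hι, π, hπι, hπ⟩ := exists_euclidean_isometric_embedding hN
  have hιinj : Function.Injective ι := Function.LeftInverse.injective hπι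
  rcases X.eq_empty_or_nonempty with rfl | hne
  · refine ⟨ι, ι.contDiff, Set.injOn_empty _, ⟨0, ?_, fun x hx => hx.elim⟩,
      nondegenerateOn_of_injective_fderiv ι.contDiff isCompact_empty fun x hx => hx.elim⟩
    exact norm_mem_spectrum_lt_one _ (by simp)
  obtain ⟨⟨g, hgf, hfg, hg⟩, c₁, c₂, -, -, -, hnorm⟩ := hinv
  have hdf (x) : ‖fderiv ℝ f x‖ < 1 := (hnorm x).trans_le (min_le_left _ _)
  have hf1 : ContDiff ℝ 1 f := contDiff_infty.1 hf 1
  have hf2 : ContDiff ℝ 2 f := contDiff_infty.1 hf 2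
  have hfd : Differentiable ℝ f := hf1.differentiable one_ne_zero
  have hequiv := exists_fderiv_equiv_of_inverse hfd (hg.differentiable one_ne_zero) hgf hfg
  have hfinj (x) : Function.Injective (fderiv ℝ f x) := by
    obtain ⟨T, hT⟩ := hequiv x
    rw [← hT]
    exact T.injective
  obtain ⟨x₀, -, hx₀, hiter⟩ := exists_fixedPoint_of_fderiv_lt_one hf1 hdf hX hne hfX
  obtain ⟨T, hT⟩ := hequiv x₀
  have hhd : HasFDerivAt (fun y => f (x₀ + y) - x₀)
      (T : EuclideanSpace ℝ (Fin n) →L[ℝ] EuclideanSpace ℝ (Fin n)) 0 := by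
    rw [hT]
    have h1 : HasFDerivAt f (fderiv ℝ f x₀) (x₀ + 0) := by
      rw [add_zero]; exact (hfd x₀).hasFDerivAt
    have h2 := h1.comp (0 : EuclideanSpace ℝ (Fin n)) ((hasFDerivAt_id (𝕜 := ℝ) 0).const_add x₀)
    exact h2.sub_const x₀
  obtain ⟨ψ, hψ, hψinj, hψd, hconj⟩ := exists_global_linearization
    (h := fun y => f (x₀ + y) - x₀) (by fun_prop) (by simp [hx₀]) hhd (by rw [hT]; exact hdf x₀)
  obtain ⟨δ, hδ, hball⟩ := Metric.eventually_nhds_iff_ball.1 hconj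
  obtain ⟨k, hk⟩ := hiter δ hδ
  have hfk : ContDiff ℝ 1 f^[k] := contDiff_iterate hf1 k
  have hφ : ContDiff ℝ 1 fun x => ι (ψ (f^[k] x - x₀)) :=
    ι.contDiff.comp (hψ.comp (hfk.sub contDiff_const))
  have hφd (x) : HasFDerivAt (fun x => ι (ψ (f^[k] x - x₀)))
      (ι.comp ((fderiv ℝ ψ (f^[k] x - x₀)).comp (fderiv ℝ f^[k] x))) x :=
    ι.hasFDerivAt.comp x (((hψ.differentiable one_ne_zero _).hasFDerivAt).comp x
      ((hfk.differentiable one_ne_zero x).hasFDerivAt.sub_const x₀))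
  -- Precomposing with `f^[k]` keeps the conjugacy and makes it valid on all of `X`. The matrix of
  -- `ι T π` is Schur stable because its norm is at most `‖T‖ < 1`.
  refine ⟨_, hφ, ?_, ⟨(Matrix.toEuclideanCLM (𝕜 := ℝ)).symm
    (ι.comp ((T : EuclideanSpace ℝ (Fin n) →L[ℝ] EuclideanSpace ℝ (Fin n)).comp π)), ?_, ?_⟩,
    nondegenerateOn_of_injective_fderiv hφ hX fun x _ => ?_⟩
  · refine Function.Injective.injOn fun x y hxy => ?_
    have := hψinj (hιinj hxy)
    exact hgf.injective.iterate k (sub_left_injective this)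
  · refine norm_mem_spectrum_lt_one _ ?_
    rw [StarAlgEquiv.apply_symm_apply]
    refine lt_of_le_of_lt ?_ (hdf x₀)
    refine ContinuousLinearMap.opNorm_le_bound _ (norm_nonneg _) fun y => ?_
    rw [ContinuousLinearMap.comp_apply, hι, ContinuousLinearMap.comp_apply, hT]
    exact (ContinuousLinearMap.le_opNorm _ _).trans (by gcongr; exact hπ y)
  · intro x hx
    have h1 := hball (f^[k] x - x₀) (by simpa using hk x hx)
    simp only [add_sub_cancel] at h1
    beta_reduce
    rw [← Matrix.coe_toEuclideanCLM_eq_toEuclideanLin, StarAlgEquiv.apply_symm_apply,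
      ← Function.iterate_succ_apply, Function.iterate_succ_apply', h1]
    simp [hπι]
  · rw [(hφd x).fderiv]
    exact hιinj.comp ((hψd _).comp (injective_fderiv_iterate hfd hfinj k x))

/-! ### Lyapunov matrices and the contraction metric -/

/-- The finitely many eigenvalues lie below some `b < 1`, and by Cayley–Hamilton `clm_growth`
applies with `B = 1`, giving `‖A^k‖ ≤ K b^k`. -/
theorem exists_norm_pow_toEuclideanCLM_lt_one {N : ℕ} {A : Matrix (Fin N) (Fin N) ℝ}
    (hA : IsSchurStable A) : ∃ m, ‖Matrix.toEuclideanCLM (𝕜 := ℝ) A ^ m‖ < 1 ∧ 0 < m := by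
  obtain ⟨b, hb0, hb1, hb⟩ : ∃ b : ℝ, 0 < b ∧ b < 1 ∧
      ∀ z : ℂ, Polynomial.aeval z A.charpoly = 0 → ‖z‖ < b := by
    have hfin : (A.charpoly.rootSet ℂ).Finite := A.charpoly.rootSet_finite ℂ
    have hmem (z : ℂ) : z ∈ A.charpoly.rootSet ℂ ↔ Polynomial.aeval z A.charpoly = 0 := by
      rw [Polynomial.mem_rootSet, and_iff_right A.charpoly_monic.ne_zero]
    rcases (A.charpoly.rootSet ℂ).eq_empty_or_nonempty with he | hne
    · refine ⟨1 / 2, by norm_num, by norm_num, fun z hz => ?_⟩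
      rw [← hmem, he] at hz
      exact hz.elim
    · obtain ⟨w, hw, hmax⟩ := Set.exists_max_image _ (fun z : ℂ => ‖z‖) hfin hne
      have hw1 : ‖w‖ < 1 := hA w (mem_spectrum_of_aeval_charpoly A ((hmem w).1 hw))
      have := norm_nonneg w
      exact ⟨(‖w‖ + 1) / 2, by linarith, by linarith, fun z hz => by
        have := hmax z ((hmem z).2 hz)
        linarith⟩
  have hchar : Polynomial.aeval (Matrix.toEuclideanCLM (𝕜 := ℝ) A) A.charpoly = 0 := by
    have := Polynomial.aeval_algHom_apply
      ((Matrix.toEuclideanCLM (𝕜 := ℝ) (n := Fin N)).toStarAlgHom.toAlgHom) A A.charpoly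
    rw [Matrix.aeval_self_charpoly, map_zero] at this
    exact this
  obtain ⟨K, hK⟩ := clm_growth (Matrix.toEuclideanCLM (𝕜 := ℝ) A) 1 A.charpoly
    A.charpoly_monic.ne_zero hb0 hb (by rw [hchar, zero_mul])
  have hlim : Tendsto (fun k : ℕ => K * b ^ k) atTop (𝓝 0) := by
    simpa using (tendsto_pow_atTop_nhds_zero_of_lt_one hb0.le hb1).const_mul K
  obtain ⟨m, hm, hm0⟩ := ((hlim.eventually_lt_const one_pos).and (eventually_gt_atTop 0)).exists
  exact ⟨m, lt_of_le_of_lt (by simpa using hK m) hm, hm0⟩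

theorem toLp_pow_mulVec {N : ℕ} (A : Matrix (Fin N) (Fin N) ℝ) (k : ℕ) (v : Fin N → ℝ) :
    WithLp.toLp 2 ((A ^ k) *ᵥ v) =
      (Matrix.toEuclideanCLM (𝕜 := ℝ) A ^ k) (WithLp.toLp 2 v) := by
  rw [← map_pow, Matrix.toEuclideanCLM_toLp]

/-- A Schur stable matrix admits a solution of the discrete Lyapunov inequality. -/
theorem exists_posDef_lyapunov {N : ℕ} {A : Matrix (Fin N) (Fin N) ℝ} (hA : IsSchurStable A) :
    ∃ P : Matrix (Fin N) (Fin N) ℝ, P.PosDef ∧ (P - Aᵀ * P * A).PosDef := by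
  obtain ⟨m, hm, hm0⟩ := exists_norm_pow_toEuclideanCLM_lt_one hA
  set T := Matrix.toEuclideanCLM (𝕜 := ℝ) A with hT
  have hPh : (∑ k ∈ Finset.range m, (A ^ k)ᵀ * 1 * A ^ k).IsHermitian := by
    rw [Matrix.IsHermitian, Matrix.conjTranspose_sum]
    exact Finset.sum_congr rfl fun k _ => Matrix.isHermitian_one.transpose_mul_mul _
  have hPq (v : Fin N → ℝ) : v ⬝ᵥ (∑ k ∈ Finset.range m, (A ^ k)ᵀ * 1 * A ^ k) *ᵥ v =
      ∑ k ∈ Finset.range m, ‖(T ^ k) (WithLp.toLp 2 v)‖ ^ 2 := by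
    rw [Matrix.sum_mulVec, dotProduct_sum]
    refine Finset.sum_congr rfl fun k _ => ?_
    rw [dotProduct_transpose_mul_mul_mulVec, Matrix.one_mulVec, dotProduct_self_eq_norm_sq,
      toLp_pow_mulVec]
  refine ⟨∑ k ∈ Finset.range m, (A ^ k)ᵀ * 1 * A ^ k,
    Matrix.PosDef.of_dotProduct_mulVec_pos hPh fun v hv => ?_,
    Matrix.PosDef.of_dotProduct_mulVec_pos (hPh.sub (hPh.transpose_mul_mul A)) fun v hv => ?_⟩
  · have hv' : WithLp.toLp 2 v ≠ 0 := by simpa using hv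
    rw [star_trivial, hPq]
    -- The term `k = 0`, present because `0 < m`, is `‖v‖²`.
    refine Finset.sum_pos' (fun k _ => by positivity) ⟨0, by simpa using hm0, ?_⟩
    rw [pow_zero, one_apply_eq_self]
    positivity
  · have hv' : WithLp.toLp 2 v ≠ 0 := by simpa using hv
    have hAv : WithLp.toLp 2 (A *ᵥ v) = T (WithLp.toLp 2 v) :=
      (Matrix.toEuclideanCLM_toLp A v).symm
    rw [star_trivial, Matrix.sub_mulVec, dotProduct_sub, dotProduct_transpose_mul_mul_mulVec,
      hPq, hPq, hAv, ← Finset.sum_sub_distrib]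
    have hstep (k : ℕ) : (T ^ k) (T (WithLp.toLp 2 v)) = (T ^ (k + 1)) (WithLp.toLp 2 v) := by
      rw [pow_succ]; rfl
    simp only [hstep]
    -- The sum telescopes to `‖v‖² - ‖T^m v‖²`, positive because `‖T^m‖ < 1`.
    rw [Finset.sum_range_sub' (fun k => ‖(T ^ k) (WithLp.toLp 2 v)‖ ^ 2), pow_zero,
      one_apply_eq_self, sub_pos]
    have h1 : ‖(T ^ m) (WithLp.toLp 2 v)‖ < ‖WithLp.toLp 2 v‖ :=
      ((T ^ m).le_opNorm _).trans_lt (mul_lt_of_lt_one_left (norm_pos_iff.2 hv') hm)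
    gcongr

theorem Matrix.PosDef.exists_quadratic_bounds {N : ℕ} {P : Matrix (Fin N) (Fin N) ℝ}
    (hP : P.PosDef) : ∃ p₁ p₂ : ℝ, 0 < p₁ ∧ p₁ ≤ p₂ ∧
      ∀ v, p₁ * (v ⬝ᵥ v) ≤ v ⬝ᵥ P *ᵥ v ∧ v ⬝ᵥ P *ᵥ v ≤ p₂ * (v ⬝ᵥ v) := by
  obtain ⟨p₁, p₂, h0, h12, hb⟩ := (isCompact_singleton (x := ())).exists_quadratic_bounds
    (fun _ (v : EuclideanSpace ℝ (Fin N)) => v.ofLp ⬝ᵥ P *ᵥ v.ofLp) (by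
      refine Continuous.continuousOn ?_
      simp only [dotProduct, Matrix.mulVec]
      fun_prop) (by
      intro _ c v
      simp [Matrix.mulVec_smul]
      ring) (by
      intro _ _ v hv
      exact hP.dotProduct_mulVec_pos (x := v.ofLp) (by simpa using hv))
  refine ⟨p₁, p₂, h0, h12, fun v => ?_⟩
  rw [dotProduct_self_eq_norm_sq]
  exact hb () rfl (WithLp.toLp 2 v)

theorem jacobian_mul_of_intertwines {n N : ℕ}
    {f : EuclideanSpace ℝ (Fin n) → EuclideanSpace ℝ (Fin n)}
    {φ : EuclideanSpace ℝ (Fin n) → EuclideanSpace ℝ (Fin N)} {A : Matrix (Fin N) (Fin N) ℝ}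
    (hf : Differentiable ℝ f) (hφ : Differentiable ℝ φ) (h : IntertwinesOn f A φ Set.univ)
    (x : EuclideanSpace ℝ (Fin n)) :
    jacobian φ (f x) * jacobian f x = A * jacobian φ x := by
  have h1 : φ ∘ f = Matrix.toEuclideanCLM (𝕜 := ℝ) A ∘ φ := by
    funext y
    simpa [← Matrix.coe_toEuclideanCLM_eq_toEuclideanLin] using h y (Set.mem_univ y)
  have h2 := congrArg (fun F => fderiv ℝ F x) h1
  rw [fderiv_comp _ (hφ _) (hf _), fderiv_comp _ (ContinuousLinearMap.differentiableAt _) (hφ _),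
    ContinuousLinearMap.fderiv] at h2
  refine Matrix.ext_of_mulVec_single fun i => ?_
  apply WithLp.toLp_injective 2
  rw [← Matrix.mulVec_mulVec, ← Matrix.mulVec_mulVec, jacobian_mulVec, jacobian_mulVec]
  have h3 := congrArg (fun L => L (WithLp.toLp 2 (Pi.single i 1))) h2
  simp only [ContinuousLinearMap.comp_apply] at h3
  rw [h3, ← jacobian_mulVec]
  simp

theorem continuous_jacobian {n N : ℕ}
    {φ : EuclideanSpace ℝ (Fin n) → EuclideanSpace ℝ (Fin N)} (hφ : ContDiff ℝ 1 φ) :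
    Continuous (jacobian φ) := by
  have := hφ.continuous_fderiv one_ne_zero
  refine continuous_matrix fun i j => ?_
  simp only [jacobian, Matrix.of_apply]
  fun_prop

/-- With `Q = P - Aᵀ P A`, the chain rule turns the metric increment into `-Jφᵀ Q Jφ`. If `Q ≽ q₁ I`
and `P ≼ p₂ I` then `Q ≽ (q₁ / p₂) P`, which is the contraction rate. -/
theorem isContractionMetric_of_intertwines {n N : ℕ}
    {f : EuclideanSpace ℝ (Fin n) → EuclideanSpace ℝ (Fin n)}
    {φ : EuclideanSpace ℝ (Fin n) → EuclideanSpace ℝ (Fin N)} {A P : Matrix (Fin N) (Fin N) ℝ}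
    (hf : Differentiable ℝ f) (hφ : Differentiable ℝ φ) (h : IntertwinesOn f A φ Set.univ)
    (hJ : UniformlyBoundedOn (fun x => (jacobian φ x)ᵀ * jacobian φ x) Set.univ)
    (hP : P.PosDef) (hQ : (P - Aᵀ * P * A).PosDef) :
    IsContractionMetric f (fun x => (jacobian φ x)ᵀ * P * jacobian φ x) := by
  obtain ⟨a₁, a₂, ha0, ha12, ha⟩ := hJ
  obtain ⟨p₁, p₂, hp0, hp12, hp⟩ := hP.exists_quadratic_bounds
  obtain ⟨q₁, _, hq0, -, hq⟩ := hQ.exists_quadratic_bounds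
  have hher (x) := hP.1.transpose_mul_mul (jacobian φ x)
  have hlow (x) (v : Fin n → ℝ) :
      a₁ * (v ⬝ᵥ v) ≤ (jacobian φ x *ᵥ v) ⬝ᵥ (jacobian φ x *ᵥ v) := by
    have h1 := (ha x (Set.mem_univ x)).1.dotProduct_mulVec_nonneg v
    have h2 := dotProduct_transpose_mul_mul_mulVec (jacobian φ x) 1 v
    rw [Matrix.mul_one, Matrix.one_mulVec] at h2
    rw [star_trivial, Matrix.sub_mulVec, dotProduct_sub, h2, dotProduct_smul_one_mulVec] at h1
    linarith
  have hupp (x) (v : Fin n → ℝ) :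
      (jacobian φ x *ᵥ v) ⬝ᵥ (jacobian φ x *ᵥ v) ≤ a₂ * (v ⬝ᵥ v) := by
    have h1 := (ha x (Set.mem_univ x)).2.dotProduct_mulVec_nonneg v
    have h2 := dotProduct_transpose_mul_mul_mulVec (jacobian φ x) 1 v
    rw [Matrix.mul_one, Matrix.one_mulVec] at h2
    rw [star_trivial, Matrix.sub_mulVec, dotProduct_sub, h2, dotProduct_smul_one_mulVec] at h1
    linarith
  have hp20 : 0 < p₂ := hp0.trans_le hp12
  -- The minimum with `1 / 2` ensures that the rate is less than `1`.
  refine ⟨⟨p₁ * a₁, p₂ * a₂, by positivity, by gcongr, fun x _ => ⟨?_, ?_⟩⟩,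
    min (1 / 2) (q₁ / p₂), by positivity, (min_le_left _ _).trans_lt (by norm_num), fun x => ?_⟩
  · refine loewnerLE_of_forall_dotProduct (isHermitian_smul_one _) (hher x) fun v => ?_
    rw [dotProduct_smul_one_mulVec, dotProduct_transpose_mul_mul_mulVec, mul_assoc]
    exact (mul_le_mul_of_nonneg_left (hlow x v) hp0.le).trans (hp _).1
  · refine loewnerLE_of_forall_dotProduct (hher x) (isHermitian_smul_one _) fun v => ?_
    rw [dotProduct_smul_one_mulVec, dotProduct_transpose_mul_mul_mulVec, mul_assoc]
    exact (hp _).2.trans (mul_le_mul_of_nonneg_left (hupp x v) hp20.le)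
  · have hkey : (jacobian f x)ᵀ * ((jacobian φ (f x))ᵀ * P * jacobian φ (f x)) * jacobian f x -
        (jacobian φ x)ᵀ * P * jacobian φ x =
        -((jacobian φ x)ᵀ * (P - Aᵀ * P * A) * jacobian φ x) := by
      have hc := jacobian_mul_of_intertwines hf hφ h x
      calc _ = (jacobian φ (f x) * jacobian f x)ᵀ * P * (jacobian φ (f x) * jacobian f x) -
            (jacobian φ x)ᵀ * P * jacobian φ x := by
            rw [Matrix.transpose_mul]
            simp only [Matrix.mul_assoc]
        _ = _ := by
            rw [hc, Matrix.transpose_mul, Matrix.mul_sub, Matrix.sub_mul, neg_sub]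
            simp only [Matrix.mul_assoc]
    simp only [hkey]
    refine loewnerLE_of_forall_dotProduct (hQ.1.transpose_mul_mul _).neg
      ((hher x).smul (star_trivial _)).neg fun v => ?_
    rw [Matrix.neg_mulVec, Matrix.neg_mulVec, dotProduct_neg, dotProduct_neg, neg_le_neg_iff,
      Matrix.smul_mulVec, dotProduct_smul, dotProduct_transpose_mul_mul_mulVec,
      dotProduct_transpose_mul_mul_mulVec, smul_eq_mul]
    generalize jacobian φ x *ᵥ v = w
    have hw : 0 ≤ w ⬝ᵥ w := by rw [dotProduct_self_eq_norm_sq]; positivity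
    calc min (1 / 2) (q₁ / p₂) * (w ⬝ᵥ P *ᵥ w)
        ≤ q₁ / p₂ * (p₂ * (w ⬝ᵥ w)) := by
          gcongr
          · exact (mul_nonneg hp0.le hw).trans (hp w).1
          · exact min_le_right _ _
          · exact (hp w).2
      _ = q₁ * (w ⬝ᵥ w) := by field_simp
      _ ≤ _ := (hq w).1

theorem theorem1 {n N : ℕ} (hN : n ≤ N)
    (f : EuclideanSpace ℝ (Fin n) → EuclideanSpace ℝ (Fin n)) (hf : ContDiff ℝ ∞ f) :
    (∀ (φ : EuclideanSpace ℝ (Fin n) → EuclideanSpace ℝ (Fin N))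
        (A : Matrix (Fin N) (Fin N) ℝ),
        ContDiff ℝ 1 φ → IsSchurStable A → IntertwinesOn f A φ Set.univ →
        NondegenerateOn φ Set.univ →
          IsContracting f ∧
          ∀ P : Matrix (Fin N) (Fin N) ℝ, P.PosDef → (P - Aᵀ * P * A).PosDef →
            Continuous (fun x => (jacobian φ x)ᵀ * P * jacobian φ x) ∧
            IsContractionMetric f (fun x => (jacobian φ x)ᵀ * P * jacobian φ x)) ∧
    (IsContracting f → InverseGrowthAssumption f →
      ∀ X : Set (EuclideanSpace ℝ (Fin n)), IsCompact X → Set.MapsTo f X X →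
        ∃ φ : EuclideanSpace ℝ (Fin n) → EuclideanSpace ℝ (Fin N),
          ContDiff ℝ 1 φ ∧ Set.InjOn φ X ∧
          (∃ A : Matrix (Fin N) (Fin N) ℝ, IsSchurStable A ∧ IntertwinesOn f A φ X) ∧
          NondegenerateOn φ X) := by
  have hfd : Differentiable ℝ f := hf.differentiable (by simp)
  refine ⟨fun φ A hφ hA hφA hnd => ?_, fun _ hinv X hX hfX =>
    exists_linear_embedding_on_compact hN hf hinv hX hfX⟩
  have hmetric (P : Matrix (Fin N) (Fin N) ℝ) (hP : P.PosDef) (hQ : (P - Aᵀ * P * A).PosDef) :=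
    isContractionMetric_of_intertwines hfd (hφ.differentiable one_ne_zero) hφA hnd.2 hP hQ
  obtain ⟨P, hP, hQ⟩ := exists_posDef_lyapunov hA
  refine ⟨⟨_, hmetric P hP hQ⟩, fun P hP hQ => ⟨?_, hmetric P hP hQ⟩⟩
  have hJ := continuous_jacobian hφ
  exact (hJ.matrix_transpose.matrix_mul continuous_const).matrix_mul hJ
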